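/- Let $d\ge 2$, let $\mathcal S(\mathbb S^{d-1})=C^\infty(\mathbb S^{d-1},\mathbb C)$ with the Fréchet topology of the norms $\|(\mathrm{Id}-\Delta)^k h\|_\infty$, $k\in\mathbb N$ ($\Delta$ the Laplace–Beltrami operator), let $\mathcal S'(\mathbb S^{d-1})$ be its topological dual, with duality product $\langle\cdot|\cdot\rangle$, and let $\langle f,g\rangle=\int_{\mathbb S^{d-1}}f\,\overline g$. For $n\in\mathbb N$ let $\{Y_n^m\}_m$ be an orthonormal basis of the space $\mathrm{Harm}_n=\{Y:\Delta Y=-n(n+d-2)Y\}$ of spherical harmonics of order $n$. A *pseudo-differential operator* with symbol $\{\hat D_n\}_{n\in\mathbb N}\subset\mathbb R$ and spectral growth order $p\ge 0$ is a linear operator $\mathcal D:\mathcal S(\mathbb S^{d-1})\to\mathcal S(\mathbb S^{d-1})$ with $\mathcal Dh=\sum_{n\ge 0}\hat D_n\sum_m\langle h,Y_n^m\rangle Y_n^m$ for all $h$, where $\hat D_n=0$ for at most finitely many $n$ and $|\hat D_n|=\Theta(n^p)$. It acts on $f\in\mathcal S'(\mathbb S^{d-1})$ by $\langle\mathcal Df|\varphi\rangle=\langle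 f|\mathcal D\varphi\rangle$. It is *positive-definite* if $\langle\mathcal Dh,h\rangle>0$ for all $h\ne 0$. A *$\mathcal D$-spline* is an $\mathfrak s\in\mathcal S'(\mathbb S^{d-1})$ such that $\mathcal D\mathfrak s=\sum_{i=1}^M\alpha_i\delta_{\mathbf r_i}$ for some $M\in\mathbb N$, $\alpha_i\in\mathbb C$, $\mathbf r_i\in\mathbb S^{d-1}$. **Proposition 9 (native space for $\mathcal D$-splines).** Let $\mathcal D$ be a positive-definite pseudo-differential operator on $\mathbb S^{d-1}$ with symbol $\{\hat D_n\}$ and spectral growth order $p>d-1$. Then $\hat D_n>0$ for all $n$, and $\mathcal D$ has a unique Hermitian square root $\mathcal D^{1/2}$ (a self-adjoint, positive semi-definite linear operator $\mathcal S(\mathbb S^{d-1})\to\mathcal S(\mathbb S^{d-1})$ with $\mathcal D^{1/2}\mathcal D^{1/2}=\mathcal D$). It is a pseudo-differential operator with symbol $\{\sqrt{\hat D_n}\}$ and spectral growth order $p/2$. Moreover, the generalised Sobolev space $$\mathcal H_{\mathcal D^{1/2}}(\mathbb S^{d-1})=\{f\in\mathcal S'(\mathbb S^{d-1}):\mathcal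 D^{1/2}f\in\mathcal L^2(\mathbb S^{d-1})\},\qquad \langle f,g\rangle_{\mathcal D^{1/2}}=\langle\mathcal D^{1/2}f,\mathcal D^{1/2}g\rangle,$$ is a reproducing kernel Hilbert space: the form $\langle\cdot,\cdot\rangle_{\mathcal D^{1/2}}$ is an inner product for which it is complete, each of its elements is (given by integration against) a continuous function on $\mathbb S^{d-1}$, and evaluation at each point of $\mathbb S^{d-1}$ is a continuous linear functional on it. It contains all $\mathcal D$-splines. -/

import Mathlib

open MeasureTheory Metric Set Filter Topology Module
open scoped Manifold ContDiff ComplexConjugate Laplacian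

namespace Spherical

/-- The ambient Euclidean space `ℝ^d`. -/
abbrev Amb (d : ℕ) : Type := EuclideanSpace ℝ (Fin d)

/-- The hypersphere `S^{d-1}`, the unit sphere of `ℝ^d`. -/
abbrev Sph (d : ℕ) : Type := sphere (0 : Amb d) 1

variable {d : ℕ}

instance instFactFinrank [h : Fact (2 ≤ d)] : Fact (finrank ℝ (Amb d) = (d - 1) + 1) :=
  ⟨by have := h.out; simp; omega⟩

/-- The surface measure of `S^{d-1}`. -/
noncomputable def surf (d : ℕ) : Measure (Sph d) := (volume : Measure (Amb d)).toSphere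

instance : IsFiniteMeasure (surf d) := inferInstanceAs (IsFiniteMeasure (volume.toSphere))

/-! ### Smooth functions and the Laplace-Beltrami operator -/

/-- The extension of `h : S^{d-1} → ℂ` to a function on `ℝ^d` which is constant along
the rays from the origin (and vanishes at the origin). -/
noncomputable def radialExt (h : Sph d → ℂ) (x : Amb d) : ℂ :=
  if hx : x = 0 then 0 else h ⟨‖x‖⁻¹ • x, by simp [norm_smul, hx]⟩

/-- The Laplace-Beltrami operator of the unit sphere: the Euclidean Laplacian of the extension
constant along rays, evaluated on the sphere. -/
noncomputable def lapBeltramiFun (h : Sph d → ℂ) : Sph d → ℂ :=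
  fun r => (Δ (radialExt h)) (r : Amb d)

instance : (surf d).IsOpenPosMeasure :=
  inferInstanceAs ((volume : Measure (Amb d)).toSphere.IsOpenPosMeasure)

theorem coe_ne_zero (r : Sph d) : (r : Amb d) ≠ 0 :=
  ne_zero_of_mem_unit_sphere r

theorem integrable_mul_cont {g : Sph d → ℂ} (hg : Integrable g (surf d)) (φ : C(Sph d, ℂ)) :
    Integrable (fun r => g r * φ r) (surf d) :=
  hg.mul_bdd (c := ‖φ‖) φ.continuous.aestronglyMeasurable
    (Eventually.of_forall fun r => φ.norm_coe_le_norm r)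

/-- Infinitely differentiable functions `S^{d-1} → ℂ`, as a subspace of all functions. -/
def smoothSubmodule (d : ℕ) [Fact (2 ≤ d)] : Submodule ℂ (Sph d → ℂ) where
  carrier := {h | ContMDiff (𝓡 (d - 1)) 𝓘(ℝ, ℂ) ∞ h}
  add_mem' hf hg := ContMDiff.add hf hg
  zero_mem' := contMDiff_const
  smul_mem' c f hf :=
    ((ContinuousLinearMap.mul ℝ ℂ c).contDiff.contMDiff (n := ∞)).comp
      (show ContMDiff (𝓡 (d - 1)) 𝓘(ℝ, ℂ) ∞ f from hf)

/-- The space `𝒮(S^{d-1}) = C^∞(S^{d-1})` of Schwartz functions. Its topology is defined below. -/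
def Schwartz (d : ℕ) [Fact (2 ≤ d)] : Type := ↥(smoothSubmodule d)

section
variable [Fact (2 ≤ d)]

noncomputable instance : AddCommGroup (Schwartz d) := inferInstanceAs (AddCommGroup (smoothSubmodule d))
noncomputable instance : Module ℂ (Schwartz d) := inferInstanceAs (Module ℂ (smoothSubmodule d))

instance : FunLike (Schwartz d) (Sph d) ℂ where
  coe h := h.1
  coe_injective := Subtype.val_injective

theorem Schwartz.contMDiff (h : Schwartz d) : ContMDiff (𝓡 (d - 1)) 𝓘(ℝ, ℂ) ∞ h := h.2

@[simp] theorem Schwartz.add_apply (f g : Schwartz d) (r : Sph d) : (f + g) r = f r + g r := rfl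

@[simp] theorem Schwartz.smul_apply (c : ℂ) (f : Schwartz d) (r : Sph d) :
    (c • f) r = c * f r := rfl

theorem contDiffAt_radialExt (h : Schwartz d) {x : Amb d} (hx : x ≠ 0) :
    ContDiffAt ℝ ∞ (radialExt h) x := by
  let U : TopologicalSpace.Opens (Amb d) := ⟨{0}ᶜ, isOpen_compl_singleton⟩
  have h1 : ContMDiff 𝓘(ℝ, Amb d) 𝓘(ℝ, Amb d) ∞ (fun y : U => ‖(y : Amb d)‖⁻¹ • (y : Amb d)) := by
    intro y
    have hy : (y : Amb d) ≠ 0 := y.2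
    exact contMDiffAt_subtype_iff (U := U) (f := fun y : Amb d => ‖y‖⁻¹ • y) |>.2
      ((((contDiffAt_norm ℝ hy).inv (norm_ne_zero_iff.2 hy)).smul contDiffAt_id).contMDiffAt)
  have hmem : ∀ y : U, ‖(y : Amb d)‖⁻¹ • (y : Amb d) ∈ sphere (0 : Amb d) 1 := fun y => by
    have hy : (y : Amb d) ≠ 0 := y.2
    simp [norm_smul, hy]
  have h2 := h.contMDiff.comp (h1.codRestrict_sphere hmem)
  have h3 : ContMDiffAt 𝓘(ℝ, Amb d) 𝓘(ℝ, ℂ) ∞ (fun y : U => radialExt h y) ⟨x, hx⟩ := by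
    refine (h2 ⟨x, hx⟩).congr_of_eventuallyEq (Eventually.of_forall fun y => ?_)
    have hy : (y : Amb d) ≠ 0 := y.2
    simp only [radialExt, dif_neg hy]
    rfl
  exact (contMDiffAt_subtype_iff (U := U) (f := radialExt h) (x := ⟨x, hx⟩) |>.1 h3).contDiffAt

theorem radialExt_add (f g : Schwartz d) : radialExt ⇑(f + g) = radialExt f + radialExt g := by
  ext x
  by_cases hx : x = 0 <;> simp [radialExt, hx]

theorem radialExt_smul (c : ℂ) (f : Schwartz d) :
    radialExt ⇑(c • f) = ContinuousLinearMap.mul ℝ ℂ c ∘ radialExt f := by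
  ext x
  by_cases hx : x = 0 <;> simp [radialExt, hx]

/-- The Laplace-Beltrami operator as an endomorphism of `𝒮(S^{d-1})`. -/
noncomputable def lapBeltrami (d : ℕ) [Fact (2 ≤ d)] : Schwartz d →ₗ[ℂ] Schwartz d where
  toFun h := ⟨lapBeltramiFun h, by
    intro r
    have h1 : ContDiffAt ℝ ∞ (Δ (radialExt h)) (r : Amb d) := by
      rw [InnerProductSpace.laplacian_eq_iteratedFDeriv_stdOrthonormalBasis]
      refine ContDiffAt.sum fun i _ => ?_
      have h2 : ContDiffAt ℝ ∞ (iteratedFDeriv ℝ 2 (radialExt h)) (r : Amb d) :=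
        (contDiffAt_radialExt h (coe_ne_zero r)).iteratedFDeriv_right (i := 2)
          (by norm_cast)
      exact (ContinuousMultilinearMap.apply ℝ (fun _ : Fin 2 => Amb d) ℂ _).contDiff.contDiffAt.comp
        _ h2
    exact ContMDiffAt.comp r h1.contMDiffAt (contMDiff_coe_sphere.contMDiffAt)⟩
  map_add' f g := by
    apply DFunLike.ext
    intro r
    have h2 : ∀ h : Schwartz d, ContDiffAt ℝ 2 (radialExt h) (r : Amb d) := fun h =>
      (contDiffAt_radialExt h (coe_ne_zero r)).of_le (WithTop.coe_le_coe.2 le_top)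
    change (Δ (radialExt ⇑(f + g))) (r : Amb d) = _
    rw [radialExt_add]
    exact (h2 f).laplacian_add (h2 g)
  map_smul' c f := by
    apply DFunLike.ext
    intro r
    have h2 : ContDiffAt ℝ 2 (radialExt f) (r : Amb d) :=
      (contDiffAt_radialExt f (coe_ne_zero r)).of_le (WithTop.coe_le_coe.2 le_top)
    change (Δ (radialExt ⇑(c • f))) (r : Amb d) = _
    rw [radialExt_smul]
    exact h2.laplacian_CLM_comp_left (l := ContinuousLinearMap.mul ℝ ℂ c)

/-- The inclusion of `𝒮(S^{d-1})` into the continuous functions. -/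
def toContₗ (d : ℕ) [Fact (2 ≤ d)] : Schwartz d →ₗ[ℂ] C(Sph d, ℂ) where
  toFun h := ⟨h, h.contMDiff.continuous⟩
  map_add' _ _ := rfl
  map_smul' _ _ := rfl

/-- The norms `‖h‖_{k,∞} = ‖(Id - Δ)^k h‖_∞`, `k ∈ ℕ`. -/
noncomputable def schwartzSeminorm (d : ℕ) [Fact (2 ≤ d)] : SeminormFamily ℂ (Schwartz d) ℕ :=
  fun k => (normSeminorm ℂ C(Sph d, ℂ)).comp (toContₗ d ∘ₗ (LinearMap.id - lapBeltrami d) ^ k)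

noncomputable instance : TopologicalSpace (Schwartz d) :=
  (schwartzSeminorm d).moduleFilterBasis.topology

theorem schwartz_withSeminorms : WithSeminorms (schwartzSeminorm d) := ⟨rfl⟩

/-- The space `𝒮'(S^{d-1})` of generalised functions, the topological dual of `𝒮(S^{d-1})`. -/
abbrev GenFun (d : ℕ) [Fact (2 ≤ d)] : Type := Schwartz d →L[ℂ] ℂ

/-- The continuous inclusion of `𝒮(S^{d-1})` into the continuous functions. -/
noncomputable def toCont (d : ℕ) [Fact (2 ≤ d)] : Schwartz d →L[ℂ] C(Sph d, ℂ) where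
  toLinearMap := toContₗ d
  cont := by
    refine WithSeminorms.continuous_normedSpace_rng C(Sph d, ℂ) schwartz_withSeminorms _
      ⟨{0}, 1, fun h => ?_⟩
    simp [schwartzSeminorm]

/-- The Dirac measure `δ_r` as a generalised function: `⟨δ_r | φ⟩ = φ(r)`. -/
noncomputable def dirac (r : Sph d) : GenFun d := (ContinuousMap.evalCLM ℂ r).comp (toCont d)

/-- An integrable function `g` as a generalised function: `⟨g | φ⟩ = ∫ g(r) φ(r) dr`. -/
noncomputable def ofIntegrable (g : Sph d → ℂ) (hg : Integrable g (surf d)) : GenFun d :=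
  ContinuousLinearMap.comp
    (LinearMap.mkContinuous
      { toFun := fun φ : C(Sph d, ℂ) => ∫ r, g r * φ r ∂(surf d)
        map_add' := fun φ ψ => by
          simp only [ContinuousMap.add_apply, mul_add]
          exact integral_add (integrable_mul_cont hg φ) (integrable_mul_cont hg ψ)
        map_smul' := fun c φ => by
          simp only [ContinuousMap.smul_apply, smul_eq_mul, RingHom.id_apply, mul_left_comm _ c]
          exact integral_const_mul c _ }
      (∫ r, ‖g r‖ ∂(surf d)) (fun φ => by
        rw [← integral_mul_const]
        refine norm_integral_le_of_norm_le (hg.norm.mul_const _) (Eventually.of_forall fun r => ?_)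
        rw [norm_mul]
        exact mul_le_mul_of_nonneg_left (φ.norm_coe_le_norm r) (norm_nonneg _)))
    (toCont d)

/-- The embedding of `ℒ²(S^{d-1})` into `𝒮'(S^{d-1})`. -/
noncomputable def ofL2 (g : Lp ℂ 2 (surf d)) : GenFun d :=
  ofIntegrable g ((Lp.memLp g).integrable (by norm_num))

theorem ofL2_apply (g : Lp ℂ 2 (surf d)) (φ : Schwartz d) :
    ofL2 g φ = ∫ r, g r * φ r ∂(surf d) := rfl

theorem ofL2_add (g g' : Lp ℂ 2 (surf d)) : ofL2 (g + g') = ofL2 g + ofL2 g' := by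
  ext φ
  refine Eq.trans ?_
    (integral_add (integrable_mul_cont ((Lp.memLp g).integrable (by norm_num)) (toCont d φ))
      (integrable_mul_cont ((Lp.memLp g').integrable (by norm_num)) (toCont d φ)))
  refine integral_congr_ae ?_
  filter_upwards [Lp.coeFn_add g g'] with r hr
  exact (congrArg (· * φ r) hr).trans (add_mul _ _ _)

theorem ofL2_smul (c : ℂ) (g : Lp ℂ 2 (surf d)) : ofL2 (c • g) = c • ofL2 g := by
  ext φ
  rw [smul_apply, ofL2_apply, ofL2_apply, smul_eq_mul, ← integral_const_mul]
  refine integral_congr_ae ?_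
  filter_upwards [Lp.coeFn_smul c g] with r hr
  rw [hr, Pi.smul_apply, smul_eq_mul, mul_assoc]

/-- The embedding of the continuous functions into `𝒮'(S^{d-1})`. -/
noncomputable def ofCont (u : C(Sph d, ℂ)) : GenFun d :=
  ofIntegrable u (u.continuous.integrable_of_hasCompactSupport (HasCompactSupport.of_compactSpace u))

/-! ### Spherical harmonics and Fourier expansion -/

/-- The inner product `⟨f, g⟩ = ∫ f(r) conj(g(r)) dr` on `𝒮(S^{d-1})`, linear in `f`. -/
noncomputable def ip (f g : Schwartz d) : ℂ := ∫ r, f r * conj (g r) ∂(surf d)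

theorem integrable_ip (f g : Schwartz d) : Integrable (fun r => f r * conj (g r)) (surf d) :=
  (f.contMDiff.continuous.mul (Complex.continuous_conj.comp
    g.contMDiff.continuous)).integrable_of_hasCompactSupport (HasCompactSupport.of_compactSpace _)

theorem ip_add_left (f f' g : Schwartz d) : ip (f + f') g = ip f g + ip f' g := by
  rw [ip, ip, ip, ← integral_add (integrable_ip f g) (integrable_ip f' g)]
  simp only [Schwartz.add_apply, add_mul]

theorem ip_smul_left (c : ℂ) (f g : Schwartz d) : ip (c • f) g = c * ip f g := by
  rw [ip, ip, ← integral_const_mul]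
  simp only [Schwartz.smul_apply, mul_assoc]

theorem ip_conj (f g : Schwartz d) : conj (ip f g) = ip g f := by
  rw [ip, ip, ← integral_conj]
  simp only [map_mul, Complex.conj_conj, mul_comm]

theorem eq_zero_of_ip_self {f : Schwartz d} (h : ip f f = 0) : f = 0 := by
  have hc : Continuous f := f.contMDiff.continuous
  have h1 : ∫ r, ‖f r‖ ^ 2 ∂(surf d) = 0 := by
    have h2 : ip f f = ((∫ r, ‖f r‖ ^ 2 ∂(surf d) : ℝ) : ℂ) := by
      rw [ip, ← integral_complex_ofReal]
      simp only [Complex.mul_conj, Complex.normSq_eq_norm_sq]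
    rw [h2] at h
    exact_mod_cast h
  have h3 := (integral_eq_zero_iff_of_nonneg (fun r => sq_nonneg ‖f r‖)
    ((hc.norm.pow 2).integrable_of_hasCompactSupport (HasCompactSupport.of_compactSpace _))).1 h1
  have h4 := ((hc.norm.pow 2).ae_eq_iff_eq (surf d) continuous_const).1 h3
  apply DFunLike.ext
  intro r
  have h5 : ‖f r‖ ^ 2 = 0 := congrFun h4 r
  exact norm_eq_zero.1 (pow_eq_zero_iff two_ne_zero |>.1 h5)

/-- `Harm_n(S^{d-1})`, the eigenspace of the Laplace-Beltrami operator for the eigenvalue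
`-n(n+d-2)`. Its elements are the spherical harmonics of order `n`. -/
noncomputable def Harm (d : ℕ) [Fact (2 ≤ d)] (n : ℕ) : Submodule ℂ (Schwartz d) :=
  End.eigenspace (lapBeltrami d) (-((n : ℂ) * ((n : ℂ) + (d : ℂ) - 2)))

/-- `q` is the `n`-th level of the Fourier expansion of `h`, i.e. its orthogonal projection onto
`Harm_n`. -/
def IsHarmPart (n : ℕ) (h q : Schwartz d) : Prop :=
  q ∈ Harm d n ∧ ∀ Y ∈ Harm d n, ip h Y = ip q Y

open Classical in
/-- The `n`-th level `∑_m ĥ_n^m Y_n^m` of the Fourier expansion of `h`, where `(Y_n^m)_m` is any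
orthonormal basis of `Harm_n` and `ĥ_n^m = ⟨h, Y_n^m⟩` (see `harmPart_eq_sum`). -/
noncomputable def harmPart (n : ℕ) (h : Schwartz d) : Schwartz d :=
  if H : ∃ q, IsHarmPart n h q then H.choose else 0

theorem IsHarmPart.unique {n : ℕ} {h q q' : Schwartz d}
    (hq : IsHarmPart n h q) (hq' : IsHarmPart n h q') : q = q' := by
  have h0 : ip (q - q') (q - q') = 0 := by
    have h1 := (hq.2 (q - q') (sub_mem hq.1 hq'.1)).symm.trans (hq'.2 _ (sub_mem hq.1 hq'.1))
    have h2 : ip (q - q' + q') (q - q') = ip (q - q') (q - q') + ip q' (q - q') := ip_add_left ..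
    rw [sub_add_cancel, h1] at h2
    exact (left_eq_add.1 (h2.trans (add_comm _ _)))
  exact sub_eq_zero.1 (eq_zero_of_ip_self h0)

/-- In any orthonormal basis of `Harm_n`, `harmPart n h` is the usual finite Fourier sum. -/
theorem harmPart_eq_sum {n N : ℕ} (Y : Fin N → Schwartz d)
    (hspan : Submodule.span ℂ (range Y) = Harm d n)
    (horth : ∀ i j, ip (Y i) (Y j) = if i = j then 1 else 0) (h : Schwartz d) :
    harmPart n h = ∑ m, ip h (Y m) • Y m := by
  have hsum : ∀ (s : Finset (Fin N)) (Z : Schwartz d),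
      ip (∑ m ∈ s, ip h (Y m) • Y m) Z = ∑ m ∈ s, ip h (Y m) * ip (Y m) Z := by
    intro s Z
    induction s using Finset.induction_on with
    | empty =>
      have := ip_smul_left 0 (0 : Schwartz d) Z
      rw [zero_smul, zero_mul] at this
      simpa using this
    | insert a s ha ih => rw [Finset.sum_insert ha, Finset.sum_insert ha, ip_add_left,
        ip_smul_left, ih]
  have key : IsHarmPart n h (∑ m, ip h (Y m) • Y m) := by
    refine ⟨Submodule.sum_mem _ fun m _ => Submodule.smul_mem _ _ ?_, fun Z hZ => ?_⟩
    · rw [← hspan]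
      exact Submodule.subset_span (mem_range_self m)
    rw [← hspan] at hZ
    have hconj : ip Z h = ip Z (∑ m, ip h (Y m) • Y m) := by
      induction hZ using Submodule.span_induction with
      | mem Z hZ =>
        obtain ⟨j, rfl⟩ := hZ
        rw [← ip_conj, ← ip_conj _ (Y j), hsum]
        simp [horth]
      | zero =>
        have h0 : ∀ g : Schwartz d, ip 0 g = 0 := fun g => by
          simpa using ip_smul_left 0 (0 : Schwartz d) g
        rw [h0, h0]
      | add Z W _ _ hZ hW => rw [ip_add_left, ip_add_left, hZ, hW]
      | smul c Z _ hZ => rw [ip_smul_left, ip_smul_left, hZ]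
    rw [← ip_conj, hconj, ip_conj]
  have H : ∃ q, IsHarmPart n h q := ⟨_, key⟩
  rw [harmPart, dif_pos H]
  exact H.choose_spec.unique key

/-! ### Pseudo-differential operators -/

/-- `D` is a spherical pseudo-differential operator with Fourier symbol `σ` and spectral growth
order `p`. -/
structure IsPseudoDiff (D : Schwartz d →ₗ[ℂ] Schwartz d) (σ : ℕ → ℝ) (p : ℝ) : Prop where
  /-- `D h = ∑_{n=0}^∞ σ_n ∑_m ĥ_n^m Y_n^m`, as a convergent series in `𝒮(S^{d-1})` -/
  series : ∀ h, Tendsto (fun N => ∑ n ∈ Finset.range N, (σ n : ℂ) • harmPart n h) atTop (𝓝 (D h))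
  finite_zeros : {n | |σ n| = 0}.Finite
  order_nonneg : 0 ≤ p
  growth : (fun n => |σ n|) =Θ[atTop] (fun n : ℕ => (n : ℝ) ^ p)

/-- `D` is positive-definite: `⟨D h, h⟩` is real and positive for `h ≠ 0`. -/
def IsPosDef (D : Schwartz d →ₗ[ℂ] Schwartz d) : Prop :=
  ∀ h, h ≠ 0 → (ip (D h) h).im = 0 ∧ 0 < (ip (D h) h).re

/-- `R` is a Hermitian square root of `D`: a self-adjoint positive semi-definite operator whose
square is `D`. -/
structure IsHermitianSqrt (D R : Schwartz d →ₗ[ℂ] Schwartz d) : Prop where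
  selfAdjoint : ∀ f g, ip (R f) g = ip f (R g)
  nonneg : ∀ f, 0 ≤ (ip (R f) f).re
  sq : R ∘ₗ R = D

/-- The action of `D` on generalised functions, `⟨D f | φ⟩ = ⟨f | D φ⟩`. (An element of the
algebraic dual of `𝒮(S^{d-1})`, since no continuity of `D` is presupposed.) -/
noncomputable def actGen (D : Schwartz d →ₗ[ℂ] Schwartz d) (f : GenFun d) : Schwartz d →ₗ[ℂ] ℂ :=
  (f : Schwartz d →ₗ[ℂ] ℂ) ∘ₗ D

/-- `s ∈ 𝒮'(S^{d-1})` is a `D`-spline: `D s = ∑_i α_i δ_{r_i}` for finitely many knots `r_i` and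
amplitudes `α_i`. -/
def IsSpline (D : Schwartz d →ₗ[ℂ] Schwartz d) (s : GenFun d) : Prop :=
  ∃ (M : ℕ) (r : Fin M → Sph d) (α : Fin M → ℂ),
    actGen D s = ((∑ i, α i • dirac (r i) : GenFun d) : Schwartz d →ₗ[ℂ] ℂ)

/-- The generalised Sobolev space `{f ∈ 𝒮' : D f ∈ ℒ²}` as a subspace of `𝒮'(S^{d-1})`. -/
noncomputable def sobolev (D : Schwartz d →ₗ[ℂ] Schwartz d) : Submodule ℂ (GenFun d) where
  carrier := {f | ∃ g : Lp ℂ 2 (surf d), actGen D f = (ofL2 g : Schwartz d →ₗ[ℂ] ℂ)}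
  add_mem' := by
    rintro f f' ⟨g, hg⟩ ⟨g', hg'⟩
    refine ⟨g + g', ?_⟩
    rw [ofL2_add, ContinuousLinearMap.toLinearMap_add, ← hg, ← hg']
    rfl
  zero_mem' := ⟨0, by
    have : ofL2 (0 : Lp ℂ 2 (surf d)) = 0 := by
      rw [← zero_smul ℂ (0 : Lp ℂ 2 (surf d)), ofL2_smul]
      exact ContinuousLinearMap.ext fun φ => zero_mul _
    rw [this]
    rfl⟩
  smul_mem' := by
    rintro c f ⟨g, hg⟩
    refine ⟨c • g, ?_⟩
    rw [ofL2_smul, ContinuousLinearMap.toLinearMap_smul, ← hg]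
    rfl

/-- The generalised Sobolev space as a bare vector space, without the topology of `𝒮'`. -/
def Sobolev (D : Schwartz d →ₗ[ℂ] Schwartz d) : Type := ↥(sobolev D)

noncomputable instance (D : Schwartz d →ₗ[ℂ] Schwartz d) : AddCommGroup (Sobolev D) :=
  inferInstanceAs (AddCommGroup (sobolev D))
noncomputable instance (D : Schwartz d →ₗ[ℂ] Schwartz d) : Module ℂ (Sobolev D) :=
  inferInstanceAs (Module ℂ (sobolev D))

/-- The generalised function underlying an element of the generalised Sobolev space. -/
def Sobolev.toGenFun {D : Schwartz d →ₗ[ℂ] Schwartz d} (f : Sobolev D) : GenFun d := f.1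

/-- The generalised Sobolev space of `D` is a reproducing kernel Hilbert space:
`⟨f, f'⟩ = ⟨D f, D f'⟩_{ℒ²}` defines an inner product on it, for which it is complete; each of its
elements is an ordinary (continuous) function, and evaluation at each point is a continuous linear
functional. (Mathlib's inner products are linear in the second argument.) -/
def IsSobolevRKHS (D : Schwartz d →ₗ[ℂ] Schwartz d) : Prop :=
  ∃ c : InnerProductSpace.Core ℂ (Sobolev D),
    (∀ (f f' : Sobolev D) (g g' : Lp ℂ 2 (surf d)),
      actGen D f.toGenFun = (ofL2 g : Schwartz d →ₗ[ℂ] ℂ) →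
      actGen D f'.toGenFun = (ofL2 g' : Schwartz d →ₗ[ℂ] ℂ) →
      c.inner f f' = inner ℂ g g') ∧
    letI : NormedAddCommGroup (Sobolev D) := c.toNormedAddCommGroup
    letI : InnerProductSpace ℂ (Sobolev D) := InnerProductSpace.ofCore c.toCore
    CompleteSpace (Sobolev D) ∧
    ∃ K : RKHS ℂ (Sobolev D) (Sph d) ℂ,
      ∀ f : Sobolev D, ∃ u : C(Sph d, ℂ), K.coeCLM f = u ∧ f.toGenFun = ofCont u

end

end Spherical

open Spherical

/-!
Spherical harmonics of order `n` extend to homogeneous harmonic functions of degree `n`. The mean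
value property, integrated over an annulus of half-width comparable to `1 / N`, gives the Nikolskii
inequality `‖f‖_∞² ≤ C N ^ (d - 1) ‖f‖₂²` for sums `f` of spherical harmonics of orders at most `N`.
It makes each `Harm_n` finite-dimensional, and it makes series of spherical harmonics with rapidly
decreasing norms converge in `𝒮(S^{d-1})`, so that symbols of polynomial growth define multipliers.
The powers of the linear forms `⟨r, ·⟩` lie in the span of the spherical harmonics and
`(1 + ⟨r, ·⟩) ^ n` peaks at `r`, so a smooth function is determined by its Fourier expansion. Hence
`D` is a multiplier with positive symbol, and a Hermitian square root of `D` must act on `Harm_n`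
as `√σ_n`.

On the dyadic block `2 ^ j ≤ n < 2 ^ (j + 1)`, the multiplier `D^{-1/2}` with symbol of order
`n ^ (-p / 2)` has norm at most a constant times `2 ^ (j (d - 1 - p) / 2)` from `ℒ²` to the
continuous functions, again by the Nikolskii inequality. These norms are summable when `p > d - 1`,
so `D^{-1/2}` extends to an injection of `ℒ²` into the continuous functions, whose image is the
generalised Sobolev space with its inner product transported from `ℒ²`. A `D`-spline `s` lies in it
because `D^{1/2} s` is a combination of the functionals `φ ↦ (D^{-1/2} φ)(r_i)`, which are bounded
on `ℒ²`.
-/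

namespace Spherical

section LinearVectorFields

open scoped RealInnerProductSpace

variable {E V : Type*} [NormedAddCommGroup E] [InnerProductSpace ℝ E] [NormedAddCommGroup V]
  [NormedSpace ℝ V] {A B : E →L[ℝ] E} {F G : E → V} {x : E}

/-- The derivative of `F` along the linear vector field `x ↦ A x`. It is the Euler operator when
`A` is the identity and an infinitesimal rotation when `A` is skew. -/
noncomputable def linDeriv (A : E →L[ℝ] E) (F : E → V) (x : E) : V := fderiv ℝ F x (A x)

/-- Skew-symmetry of an operator on a real inner product space. -/
def IsSkew (A : E →L[ℝ] E) : Prop := ∀ x, ⟪A x, x⟫ = 0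

/-- The generator `⟪u, ·⟫ v - ⟪v, ·⟫ u` of the rotations of the plane spanned by `u` and `v`. -/
noncomputable def planeRot (u v : E) : E →L[ℝ] E :=
  (innerSL ℝ u).smulRight v - (innerSL ℝ v).smulRight u

/-- Smoothness on the complement of the origin. -/
def SmoothOffZero (F : E → V) : Prop := ∀ x ≠ 0, ContDiffAt ℝ ∞ F x

theorem planeRot_apply (u v x : E) : planeRot u v x = ⟪u, x⟫ • v - ⟪v, x⟫ • u := rfl

theorem isSkew_planeRot (u v : E) : IsSkew (planeRot u v) := fun x => by
  rw [planeRot_apply, inner_sub_left, real_inner_smul_left, real_inner_smul_left, mul_comm,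
    sub_self]

theorem IsSkew.inner_apply (hA : IsSkew A) (x y : E) : ⟪A x, y⟫ = -⟪A y, x⟫ := by
  have h := hA (x + y)
  rw [map_add, inner_add_left, inner_add_right, inner_add_right, hA, hA] at h
  linarith

theorem linDeriv_congr (h : F =ᶠ[𝓝 x] G) : linDeriv A F x = linDeriv A G x := by
  rw [linDeriv, linDeriv, h.fderiv_eq]

theorem linDeriv_smul {𝕜 : Type*} [NormedRing 𝕜] [NormedAlgebra ℝ 𝕜] [Module 𝕜 V]
    [IsBoundedSMul 𝕜 V] [IsScalarTower ℝ 𝕜 V] {c : E → 𝕜} (hc : DifferentiableAt ℝ c x)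
    (hF : DifferentiableAt ℝ F x) :
    linDeriv A (fun y => c y • F y) x = c x • linDeriv A F x + linDeriv A c x • F x := by
  simp [linDeriv, fderiv_fun_smul hc hF]

theorem contDiffAt_linDeriv {m n : WithTop ℕ∞} (h : ContDiffAt ℝ n F x) (hmn : m + 1 ≤ n) :
    ContDiffAt ℝ m (linDeriv A F) x :=
  (h.fderiv_right hmn).clm_apply A.contDiff.contDiffAt

theorem SmoothOffZero.differentiableAt (hF : SmoothOffZero F) (hx : x ≠ 0) :
    DifferentiableAt ℝ F x :=
  (hF x hx).differentiableAt (by simp)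

theorem smoothOffZero_linDeriv (hF : SmoothOffZero F) (A : E →L[ℝ] E) :
    SmoothOffZero (linDeriv A F) :=
  fun x hx => contDiffAt_linDeriv (hF x hx) (by simp)

theorem smoothOffZero_norm_pow (n : ℕ) : SmoothOffZero fun x : E => ‖x‖ ^ n :=
  fun _ hx => (contDiffAt_norm ℝ hx).pow n

theorem linDeriv_comp_norm_sq {φ : ℝ → V} (hA : IsSkew A) (hφ : DifferentiableAt ℝ φ (‖x‖ ^ 2)) :
    linDeriv A (fun y => φ (‖y‖ ^ 2)) x = 0 := by
  have h : HasFDerivAt (fun y : E => φ (‖y‖ ^ 2))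
      ((fderiv ℝ φ (‖x‖ ^ 2)).comp (2 • innerSL ℝ x)) x :=
    hφ.hasFDerivAt.comp x (hasStrictFDerivAt_norm_sq x).hasFDerivAt
  rw [linDeriv, h.fderiv]
  simp [real_inner_comm (A x), hA x]

theorem linDeriv_norm_pow (hA : IsSkew A) (n : ℕ) (hx : x ≠ 0) :
    linDeriv A (fun y => ‖y‖ ^ n) x = 0 := by
  have hφ : DifferentiableAt ℝ (fun t => √t ^ n) (‖x‖ ^ 2) :=
    (Real.hasDerivAt_sqrt (by positivity)).differentiableAt.fun_pow n
  simpa [Real.sqrt_sq] using linDeriv_comp_norm_sq hA hφ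

theorem linDeriv_id_of_homogeneous {n : ℕ} (hF : DifferentiableAt ℝ F x)
    (h : ∀ t : ℝ, 0 < t → F (t • x) = t ^ n • F x) :
    linDeriv (.id ℝ E) F x = (n : ℝ) • F x := by
  have hd : HasFDerivAt F (fderiv ℝ F x) ((1 : ℝ) • x) := by simpa using hF.hasFDerivAt
  have hray : HasDerivAt (fun t : ℝ => t • x) x 1 := by
    simpa using (hasDerivAt_id (1 : ℝ)).smul_const x
  have hpow : HasDerivAt (fun t : ℝ => t ^ n • F x) ((n : ℝ) • F x) 1 := by
    simpa using (hasDerivAt_pow n (1 : ℝ)).smul_const (F x)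
  refine (hd.comp_hasDerivAt (1 : ℝ) (f := fun t : ℝ => t • x) hray).unique
    (hpow.congr_of_eventuallyEq ?_)
  filter_upwards [lt_mem_nhds one_pos] with t ht using h t ht

theorem fderiv_linDeriv (h : ContDiffAt ℝ 2 F x) (v : E) :
    fderiv ℝ (linDeriv A F) x v = fderiv ℝ (fderiv ℝ F) x v (A x) + fderiv ℝ F x (A v) := by
  have hF' : DifferentiableAt ℝ (fderiv ℝ F) x :=
    (h.fderiv_right (m := 1) le_rfl).differentiableAt one_ne_zero
  change fderiv ℝ (fun y => fderiv ℝ F y (A y)) x v = _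
  rw [fderiv_clm_apply hF' A.differentiableAt]
  simp [add_comm]

theorem linDeriv_linDeriv (h : ContDiffAt ℝ 2 F x) :
    linDeriv A (linDeriv B F) x =
      fderiv ℝ (fderiv ℝ F) x (A x) (B x) + fderiv ℝ F x (B (A x)) :=
  fderiv_linDeriv h _

theorem fderiv_fderiv_apply (h : ContDiffAt ℝ 2 F x) (v w : E) :
    fderiv ℝ (fun y => fderiv ℝ F y w) x v = fderiv ℝ (fderiv ℝ F) x v w := by
  have hF' : DifferentiableAt ℝ (fderiv ℝ F) x :=
    (h.fderiv_right (m := 1) le_rfl).differentiableAt one_ne_zero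
  rw [fderiv_clm_apply hF' (differentiableAt_const w)]
  simp

theorem fderiv_fderiv_comm (h : ContDiffAt ℝ 2 F x) (v w : E) :
    fderiv ℝ (fderiv ℝ F) x v w = fderiv ℝ (fderiv ℝ F) x w v :=
  h.isSymmSndFDerivAt (by simp) v w

variable {ι : Type*} [Fintype ι] (b : OrthonormalBasis ι ℝ E)

include b in
theorem laplacian_eq_sum_fderiv_fderiv [FiniteDimensional ℝ E] (F : E → V) (x : E) :
    (Δ F) x = ∑ k, fderiv ℝ (fderiv ℝ F) x (b k) (b k) := by
  simp [InnerProductSpace.laplacian_eq_iteratedFDeriv_orthonormalBasis F b,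
    iteratedFDeriv_two_apply]

theorem contDiffAt_laplacian [FiniteDimensional ℝ E] {m n : WithTop ℕ∞}
    (h : ContDiffAt ℝ n F x) (hmn : m + 1 + 1 ≤ n) : ContDiffAt ℝ m (Δ F) x := by
  rw [funext (laplacian_eq_sum_fderiv_fderiv (stdOrthonormalBasis ℝ E) F)]
  exact ContDiffAt.sum fun k _ => (((h.fderiv_right hmn).fderiv_right le_rfl).clm_apply
    contDiffAt_const).clm_apply contDiffAt_const

theorem sum_inner_smul_map (L : E →L[ℝ] V) (x : E) : ∑ i, ⟪b i, x⟫ • L (b i) = L x := by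
  simpa only [map_sum, map_smul] using congrArg L (b.sum_repr' x)

theorem sum_planeRot_planeRot (x : E) :
    ∑ i, ∑ j, planeRot (b i) (b j) (planeRot (b i) (b j) x) =
      (2 - 2 * Fintype.card ι : ℝ) • x := by
  classical
  have hterm : ∀ i j, planeRot (b i) (b j) (planeRot (b i) (b j) x) =
      (if i = j then (2 : ℝ) • ⟪b i, x⟫ • b i else 0) - ⟪b i, x⟫ • b i - ⟪b j, x⟫ • b j := by
    intro i j
    by_cases hij : i = j
    · subst hij
      simp [planeRot_apply]
      module
    · simp [planeRot_apply, inner_sub_right, real_inner_smul_right, b.inner_eq_ite, hij,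
        Ne.symm hij]
      module
  simp only [hterm, Finset.sum_sub_distrib, Finset.sum_ite_eq, Finset.mem_univ, if_true,
    Finset.sum_const, Finset.card_univ, ← Finset.smul_sum, b.sum_repr']
  module

theorem sum_bilin_planeRot (S : E →L[ℝ] E →L[ℝ] V) (x : E) :
    ∑ i, ∑ j, S (planeRot (b i) (b j) x) (planeRot (b i) (b j) x) =
      (2 * ‖x‖ ^ 2) • ∑ k, S (b k) (b k) - (2 : ℝ) • S x x := by
  have hsq : ∑ i, ⟪b i, x⟫ ^ 2 = ‖x‖ ^ 2 := by simpa using b.sum_sq_norm_inner_right x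
  have hdiag : ∑ i, ∑ j, ⟪b i, x⟫ ^ 2 • S (b j) (b j) = ‖x‖ ^ 2 • ∑ k, S (b k) (b k) := by
    simp only [← Finset.smul_sum, ← Finset.sum_smul, hsq]
  have hcross : ∑ i, ∑ j, ⟪b i, x⟫ • ⟪b j, x⟫ • S (b i) (b j) = S x x := by
    simp only [← Finset.smul_sum, sum_inner_smul_map]
    exact sum_inner_smul_map b (S.flip x) x
  have hterm : ∀ i j, S (planeRot (b i) (b j) x) (planeRot (b i) (b j) x) =
      ⟪b i, x⟫ ^ 2 • S (b j) (b j) + ⟪b j, x⟫ ^ 2 • S (b i) (b i) -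
        ⟪b i, x⟫ • ⟪b j, x⟫ • S (b i) (b j) - ⟪b j, x⟫ • ⟪b i, x⟫ • S (b j) (b i) := by
    intro i j
    simp only [planeRot_apply, map_sub, map_smul, sub_apply, smul_apply]
    module
  simp only [hterm, Finset.sum_sub_distrib, Finset.sum_add_distrib]
  rw [hcross, Finset.sum_comm (f := fun i j => ⟪b j, x⟫ ^ 2 • S (b i) (b i)),
    Finset.sum_comm (f := fun i j => ⟪b j, x⟫ • ⟪b i, x⟫ • S (b j) (b i)), hcross, hdiag]
  module

theorem norm_sq_smul_laplacian [FiniteDimensional ℝ E] (h : ContDiffAt ℝ 2 F x) :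
    ‖x‖ ^ 2 • (Δ F) x =
      (1 / 2 : ℝ) • ∑ i, ∑ j, linDeriv (planeRot (b i) (b j)) (linDeriv (planeRot (b i) (b j)) F) x
      + (Fintype.card ι - 2 : ℝ) • linDeriv (.id ℝ E) F x
      + linDeriv (.id ℝ E) (linDeriv (.id ℝ E) F) x := by
  have hrot : ∑ i, ∑ j, fderiv ℝ F x (planeRot (b i) (b j) (planeRot (b i) (b j) x)) =
      (2 - 2 * Fintype.card ι : ℝ) • fderiv ℝ F x x := by
    rw [← map_smul, ← sum_planeRot_planeRot b]
    simp only [map_sum]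
  simp only [linDeriv_linDeriv h, Finset.sum_add_distrib, sum_bilin_planeRot b, hrot,
    laplacian_eq_sum_fderiv_fderiv b]
  simp only [linDeriv, ContinuousLinearMap.id_apply]
  module

include b in
theorem IsSkew.sum_bilin_eq_zero (hA : IsSkew A) (S : E →L[ℝ] E →L[ℝ] V)
    (hS : ∀ v w, S v w = S w v) : ∑ k, S (A (b k)) (b k) = 0 := by
  have hexp : ∑ k, S (A (b k)) (b k) = ∑ k, ∑ l, ⟪A (b k), b l⟫ • S (b l) (b k) := by
    refine Finset.sum_congr rfl fun k _ => ?_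
    simpa only [real_inner_comm, ContinuousLinearMap.flip_apply] using
      (sum_inner_smul_map b (S.flip (b k)) (A (b k))).symm
  have hneg : ∑ k, ∑ l, ⟪A (b k), b l⟫ • S (b l) (b k) =
      -∑ k, ∑ l, ⟪A (b k), b l⟫ • S (b l) (b k) := by
    conv_lhs => rw [Finset.sum_comm]
    simp only [← Finset.sum_neg_distrib]
    refine Finset.sum_congr rfl fun k _ => Finset.sum_congr rfl fun l _ => ?_
    rw [hA.inner_apply, hS, neg_smul]
  have : (2 : ℝ) • ∑ k, S (A (b k)) (b k) = 0 := by
    rw [two_smul, hexp]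
    nth_rewrite 1 [hneg]
    exact neg_add_cancel _
  exact (smul_eq_zero.1 this).resolve_left two_ne_zero

theorem fderiv_fderiv_linDeriv (h : ContDiffAt ℝ 3 F x) (v : E) :
    fderiv ℝ (fderiv ℝ (linDeriv A F)) x v v =
      linDeriv A (fun y => fderiv ℝ (fderiv ℝ F) y v v) x +
        (2 : ℝ) • fderiv ℝ (fderiv ℝ F) x (A v) v := by
  have hnear : ∀ᶠ y in 𝓝 x, ContDiffAt ℝ 2 F y :=
    (h.of_le (by norm_num)).eventually (by simp)
  have hF : ContDiffAt ℝ 2 F x := h.of_le (by norm_num)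
  have hdF : ∀ w, ContDiffAt ℝ 2 (fun y => fderiv ℝ F y w) x := fun w =>
    (h.fderiv_right (m := 2) (by norm_num)).clm_apply contDiffAt_const
  have hfst : (fun y => fderiv ℝ (linDeriv A F) y v) =ᶠ[𝓝 x]
      fun y => linDeriv A (fun z => fderiv ℝ F z v) y + fderiv ℝ F y (A v) := by
    filter_upwards [hnear] with y hy
    rw [fderiv_linDeriv hy, linDeriv, fderiv_fderiv_apply hy, fderiv_fderiv_comm hy]
  have hsnd : (fun y => fderiv ℝ (fun z => fderiv ℝ F z v) y v) =ᶠ[𝓝 x]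
      fun y => fderiv ℝ (fderiv ℝ F) y v v := by
    filter_upwards [hnear] with y hy using fderiv_fderiv_apply hy v v
  have hd : DifferentiableAt ℝ (linDeriv A fun z => fderiv ℝ F z v) x :=
    (contDiffAt_linDeriv (m := 1) (hdF v) (by norm_num)).differentiableAt one_ne_zero
  have hd' : DifferentiableAt ℝ (fun y => fderiv ℝ F y (A v)) x :=
    (hdF (A v)).differentiableAt two_ne_zero
  rw [← fderiv_fderiv_apply (contDiffAt_linDeriv h (by norm_num)), hfst.fderiv_eq,
    fderiv_fun_add hd hd', add_apply, fderiv_linDeriv (hdF v), fderiv_fderiv_comm (hdF v),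
    ← fderiv_fderiv_apply (hdF v), hsnd.fderiv_eq, fderiv_fderiv_apply hF, fderiv_fderiv_apply hF,
    fderiv_fderiv_comm hF v, linDeriv]
  module

theorem IsSkew.laplacian_linDeriv [FiniteDimensional ℝ E] (hA : IsSkew A)
    (h : ContDiffAt ℝ 3 F x) : (Δ (linDeriv A F)) x = linDeriv A (Δ F) x := by
  let b := stdOrthonormalBasis ℝ E
  have hF : ContDiffAt ℝ 2 F x := h.of_le (by norm_num)
  have hd : ∀ k, DifferentiableAt ℝ (fun y => fderiv ℝ (fderiv ℝ F) y (b k) (b k)) x := fun k =>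
    ((((h.fderiv_right (m := 2) (by norm_num)).fderiv_right (m := 1) (by norm_num)).clm_apply
      contDiffAt_const).clm_apply contDiffAt_const).differentiableAt one_ne_zero
  have hsum : linDeriv A (Δ F) x =
      ∑ k, linDeriv A (fun y => fderiv ℝ (fderiv ℝ F) y (b k) (b k)) x := by
    rw [funext (laplacian_eq_sum_fderiv_fderiv b F), linDeriv, fderiv_fun_sum fun k _ => hd k]
    simp only [linDeriv, _root_.sum_apply]
  rw [laplacian_eq_sum_fderiv_fderiv b, hsum]
  simp only [fderiv_fderiv_linDeriv h, Finset.sum_add_distrib, ← Finset.smul_sum,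
    hA.sum_bilin_eq_zero b _ (fderiv_fderiv_comm hF), smul_zero, add_zero]

theorem laplacian_clm_pow [FiniteDimensional ℝ E] (ℓ : E →L[ℝ] ℂ) (n : ℕ) (x : E) :
    (Δ fun y => ℓ y ^ n) x = n * (n - 1 : ℕ) * ℓ x ^ (n - 1 - 1) * ∑ k, ℓ (b k) ^ 2 := by
  have hpow : ∀ (m : ℕ) (y v : E),
      fderiv ℝ (fun z => ℓ z ^ m) y v = m * ℓ y ^ (m - 1) * ℓ v := fun m y v => by
    simp [fderiv_fun_pow m ℓ.differentiableAt]
  rw [laplacian_eq_sum_fderiv_fderiv b, Finset.mul_sum]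
  refine Finset.sum_congr rfl fun k _ => ?_
  rw [← fderiv_fderiv_apply (ℓ.contDiff.pow n).contDiffAt]
  simp only [hpow, mul_right_comm _ _ (ℓ (b k))]
  rw [fderiv_const_mul (ℓ.differentiableAt.fun_pow _), smul_apply, hpow, smul_eq_mul]
  ring

end LinearVectorFields

section SphereDerivations

variable {d : ℕ}

theorem radialExt_coe (h : Sph d → ℂ) (r : Sph d) : radialExt h r = h r := by
  rw [radialExt, dif_neg (coe_ne_zero r)]
  congr 1
  ext1
  simp [norm_eq_of_mem_sphere r]

theorem radialExt_smul_pos (h : Sph d → ℂ) {t : ℝ} (ht : 0 < t) (x : Amb d) :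
    radialExt h (t • x) = radialExt h x := by
  by_cases hx : x = 0
  · simp [hx]
  rw [radialExt, radialExt, dif_neg hx, dif_neg (smul_ne_zero ht.ne' hx)]
  congr 1
  ext1
  simp only [norm_smul, Real.norm_of_nonneg ht.le, smul_smul]
  congr 1
  field_simp

theorem exists_pos_smul_eq {x : Amb d} (hx : x ≠ 0) :
    ∃ t : ℝ, 0 < t ∧ ∃ r : Sph d, t • (r : Amb d) = x :=
  ⟨‖x‖, norm_pos_iff.2 hx, ⟨‖x‖⁻¹ • x, by simp [norm_smul, hx]⟩, by simp [smul_smul, hx]⟩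

theorem eventually_ne_zero {x : Amb d} (hx : x ≠ 0) : ∀ᶠ y in 𝓝 x, y ≠ 0 :=
  isOpen_ne.mem_nhds hx

variable [Fact (2 ≤ d)] {A : Amb d →L[ℝ] Amb d} {n : ℕ} {x : Amb d}

theorem smoothOffZero_radialExt (f : Schwartz d) : SmoothOffZero (radialExt f) :=
  fun _ hx => contDiffAt_radialExt f hx

theorem differentiableAt_radialExt (f : Schwartz d) (hx : x ≠ 0) :
    DifferentiableAt ℝ (radialExt f) x :=
  (smoothOffZero_radialExt f).differentiableAt hx

/-- The smooth function on the sphere obtained by restricting a function which is smooth away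
from the origin. -/
def SmoothOffZero.restr {F : Amb d → ℂ} (hF : SmoothOffZero F) : Schwartz d :=
  ⟨fun r => F r, fun r =>
    ContMDiffAt.comp r (hF r (coe_ne_zero r)).contMDiffAt contMDiff_coe_sphere.contMDiffAt⟩

@[simp] theorem SmoothOffZero.restr_apply {F : Amb d → ℂ} (hF : SmoothOffZero F) (r : Sph d) :
    hF.restr r = F r := rfl

theorem radialExt_const_smul (c : ℂ) (f : Schwartz d) : radialExt ⇑(c • f) = c • radialExt f :=
  radialExt_smul c f

/-- The derivative of functions on the sphere along the tangential part of the linear vector field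
`x ↦ A x`. -/
noncomputable def sphDeriv (A : Amb d →L[ℝ] Amb d) : Schwartz d →ₗ[ℂ] Schwartz d where
  toFun f := (smoothOffZero_linDeriv (smoothOffZero_radialExt f) A).restr
  map_add' f g := DFunLike.ext _ _ fun r => by
    have hd := fun f : Schwartz d => differentiableAt_radialExt f (coe_ne_zero r)
    simp only [SmoothOffZero.restr_apply, Schwartz.add_apply, linDeriv, radialExt_add,
      fderiv_add (hd f) (hd g), add_apply]
  map_smul' c f := DFunLike.ext _ _ fun r => by
    have hd := differentiableAt_radialExt f (coe_ne_zero r)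
    simp only [SmoothOffZero.restr_apply, Schwartz.smul_apply, linDeriv, radialExt_const_smul,
      fderiv_const_smul hd, smul_apply, RingHom.id_apply, smul_eq_mul]

theorem sphDeriv_apply (A : Amb d →L[ℝ] Amb d) (f : Schwartz d) (r : Sph d) :
    sphDeriv A f r = linDeriv A (radialExt f) r := rfl

theorem radialExt_sphDeriv (A : Amb d →L[ℝ] Amb d) (f : Schwartz d) (hx : x ≠ 0) :
    radialExt (sphDeriv A f) x = linDeriv A (radialExt f) x := by
  obtain ⟨t, ht, r, rfl⟩ := exists_pos_smul_eq hx
  have hhom : (fun y => radialExt f (t • y)) = radialExt f :=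
    funext fun y => radialExt_smul_pos f ht y
  have hderiv := fderiv_comp_smul (𝕜 := ℝ) (f := radialExt f) (x := (r : Amb d)) t
  rw [hhom] at hderiv
  rw [radialExt_smul_pos _ ht, radialExt_coe, sphDeriv_apply, linDeriv, linDeriv, hderiv, map_smul,
    map_smul, smul_apply]

theorem Schwartz.sum_apply {ι : Type*} (s : Finset ι) (f : ι → Schwartz d) (r : Sph d) :
    (∑ i ∈ s, f i) r = ∑ i ∈ s, f i r :=
  map_sum ((LinearMap.proj r : (Sph d → ℂ) →ₗ[ℂ] ℂ) ∘ₗ (smoothSubmodule d).subtype) f s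

/-- The extension of `f` to a function which is homogeneous of degree `n`; for spherical harmonics
of order `n` this is the solid harmonic. -/
noncomputable def solidExt (n : ℕ) (f : Schwartz d) (x : Amb d) : ℂ := ‖x‖ ^ n • radialExt f x

theorem smoothOffZero_solidExt (n : ℕ) (f : Schwartz d) : SmoothOffZero (solidExt n f) :=
  fun x hx => (smoothOffZero_norm_pow n x hx).smul (smoothOffZero_radialExt f x hx)

theorem solidExt_coe (n : ℕ) (f : Schwartz d) (r : Sph d) : solidExt n f r = f r := by
  simp [solidExt, radialExt_coe]

theorem solidExt_smul_pos (n : ℕ) (f : Schwartz d) {t : ℝ} (ht : 0 < t) (x : Amb d) :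
    solidExt n f (t • x) = t ^ n • solidExt n f x := by
  rw [solidExt, solidExt, radialExt_smul_pos _ ht, norm_smul, Real.norm_of_nonneg ht.le, mul_pow,
    mul_smul]

theorem solidExt_zero_left (f : Schwartz d) : solidExt 0 f = radialExt f := by
  ext x
  simp [solidExt]

theorem linDeriv_solidExt (hA : IsSkew A) (n : ℕ) (f : Schwartz d) (hx : x ≠ 0) :
    linDeriv A (solidExt n f) x = solidExt n (sphDeriv A f) x := by
  have h := linDeriv_smul (A := A) ((smoothOffZero_norm_pow n).differentiableAt hx)
    (differentiableAt_radialExt f hx)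
  rwa [linDeriv_norm_pow hA n hx, zero_smul, add_zero, ← radialExt_sphDeriv A f hx] at h

theorem linDeriv_linDeriv_solidExt (hA : IsSkew A) (n : ℕ) (f : Schwartz d) (hx : x ≠ 0) :
    linDeriv A (linDeriv A (solidExt n f)) x = solidExt n (sphDeriv A (sphDeriv A f)) x := by
  rw [← linDeriv_solidExt hA n _ hx]
  exact linDeriv_congr <|
    (eventually_ne_zero hx).mono fun y hy => linDeriv_solidExt hA n f hy

theorem linDeriv_id_solidExt (n : ℕ) (f : Schwartz d) (hx : x ≠ 0) :
    linDeriv (.id ℝ _) (solidExt n f) x = (n : ℝ) • solidExt n f x :=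
  linDeriv_id_of_homogeneous ((smoothOffZero_solidExt n f).differentiableAt hx)
    fun _ ht => solidExt_smul_pos n f ht x

theorem linDeriv_id_linDeriv_id_solidExt (n : ℕ) (f : Schwartz d) (hx : x ≠ 0) :
    linDeriv (.id ℝ _) (linDeriv (.id ℝ _) (solidExt n f)) x = ((n : ℝ) ^ 2) • solidExt n f x := by
  rw [linDeriv_congr (G := (n : ℝ) • solidExt n f)
    ((eventually_ne_zero hx).mono fun y hy => linDeriv_id_solidExt n f hy), linDeriv,
    fderiv_const_smul ((smoothOffZero_solidExt n f).differentiableAt hx), smul_apply, ← linDeriv,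
    linDeriv_id_solidExt n f hx, smul_smul, sq]

/-- The infinitesimal rotation `x_i ∂_j - x_j ∂_i` of the sphere. -/
noncomputable abbrev sphRot (i j : Fin d) : Schwartz d →ₗ[ℂ] Schwartz d :=
  sphDeriv (planeRot (EuclideanSpace.basisFun (Fin d) ℝ i) (EuclideanSpace.basisFun (Fin d) ℝ j))

theorem norm_sq_smul_laplacian_solidExt_eq_sum (n : ℕ) (f : Schwartz d) (hx : x ≠ 0) :
    ‖x‖ ^ 2 • (Δ (solidExt n f)) x =
      (1 / 2 : ℝ) • ∑ i, ∑ j, solidExt n (sphRot i j (sphRot i j f)) x +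
        ((n : ℝ) * (n + d - 2)) • solidExt n f x := by
  have h2 : ContDiffAt ℝ 2 (solidExt n f) x :=
    (smoothOffZero_solidExt n f x hx).of_le (WithTop.coe_le_coe.2 le_top)
  rw [norm_sq_smul_laplacian (EuclideanSpace.basisFun (Fin d) ℝ) h2, linDeriv_id_solidExt n f hx,
    linDeriv_id_linDeriv_id_solidExt n f hx, Fintype.card_fin]
  simp only [linDeriv_linDeriv_solidExt (isSkew_planeRot _ _) n f hx]
  module

theorem lapBeltrami_eq_sum (f : Schwartz d) :
    lapBeltrami d f = (1 / 2 : ℂ) • ∑ i, ∑ j, sphRot i j (sphRot i j f) :=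
  DFunLike.ext _ _ fun r => by
    have h := norm_sq_smul_laplacian_solidExt_eq_sum 0 f (coe_ne_zero r)
    simp only [norm_eq_of_mem_sphere r, solidExt_coe, solidExt_zero_left, one_pow, one_smul,
      Nat.cast_zero, zero_mul, zero_smul, add_zero] at h
    change (Δ (radialExt f)) (r : Amb d) = _
    rw [h]
    simp [Schwartz.sum_apply]

theorem norm_sq_smul_laplacian_solidExt (n : ℕ) (f : Schwartz d) (hx : x ≠ 0) :
    ‖x‖ ^ 2 • (Δ (solidExt n f)) x =
      solidExt n (lapBeltrami d f) x + ((n : ℝ) * (n + d - 2)) • solidExt n f x := by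
  rw [norm_sq_smul_laplacian_solidExt_eq_sum n f hx]
  congr 1
  obtain ⟨t, ht, r, rfl⟩ := exists_pos_smul_eq hx
  simp [solidExt_smul_pos _ _ ht, solidExt_coe, lapBeltrami_eq_sum, Schwartz.sum_apply,
    Finset.mul_sum, mul_left_comm]

theorem radialExt_lapBeltrami (f : Schwartz d) (hx : x ≠ 0) :
    radialExt (lapBeltrami d f) x = ‖x‖ ^ 2 • (Δ (radialExt f)) x := by
  simpa only [solidExt_zero_left, Nat.cast_zero, zero_mul, zero_smul, add_zero] using
    (norm_sq_smul_laplacian_solidExt 0 f hx).symm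

theorem sphDeriv_lapBeltrami (hA : IsSkew A) (f : Schwartz d) :
    sphDeriv A (lapBeltrami d f) = lapBeltrami d (sphDeriv A f) :=
  DFunLike.ext _ _ fun r => by
    have hr := coe_ne_zero r
    have hlap : DifferentiableAt ℝ (Δ (radialExt f)) (r : Amb d) :=
      (contDiffAt_laplacian (m := 1) (smoothOffZero_radialExt f r hr)
        (by norm_cast)).differentiableAt one_ne_zero
    have h3 : ContDiffAt ℝ 3 (radialExt f) (r : Amb d) :=
      (smoothOffZero_radialExt f r hr).of_le (WithTop.coe_le_coe.2 le_top)
    have hext : radialExt (sphDeriv A f) =ᶠ[𝓝 (r : Amb d)] linDeriv A (radialExt f) :=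
      (eventually_ne_zero hr).mono fun y hy => radialExt_sphDeriv A f hy
    rw [sphDeriv_apply,
      linDeriv_congr ((eventually_ne_zero hr).mono fun y hy => radialExt_lapBeltrami f hy),
      linDeriv_smul ((smoothOffZero_norm_pow 2).differentiableAt hr) hlap,
      linDeriv_norm_pow hA 2 hr, ← hA.laplacian_linDeriv h3, norm_eq_of_mem_sphere r, one_pow,
      one_smul, zero_smul, add_zero]
    exact (InnerProductSpace.laplacian_congr_nhds hext).eq_of_nhds.symm

end SphereDerivations

section SphericalHarmonics

variable {d : ℕ} [Fact (2 ≤ d)] {n : ℕ} {f : Schwartz d} {x : Amb d}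

theorem mem_Harm : f ∈ Harm d n ↔ lapBeltrami d f = (-((n : ℂ) * ((n : ℂ) + (d : ℂ) - 2))) • f :=
  End.mem_eigenspace_iff

theorem sphDeriv_mem_Harm {A : Amb d →L[ℝ] Amb d} (hA : IsSkew A) (hf : f ∈ Harm d n) :
    sphDeriv A f ∈ Harm d n := by
  rw [mem_Harm] at hf ⊢
  rw [← sphDeriv_lapBeltrami hA, hf, map_smul]

theorem laplacian_solidExt_of_mem_Harm (hf : f ∈ Harm d n) (hx : x ≠ 0) :
    (Δ (solidExt n f)) x = 0 := by
  rw [mem_Harm] at hf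
  have h := norm_sq_smul_laplacian_solidExt n f hx
  have hzero : solidExt n (lapBeltrami d f) x + ((n : ℝ) * (n + d - 2)) • solidExt n f x = 0 := by
    simp only [hf, solidExt, radialExt_const_smul, Pi.smul_apply, Complex.real_smul, smul_eq_mul]
    push_cast
    ring
  exact (smul_eq_zero.1 (h.trans hzero)).resolve_left (by simpa using hx)

/-- The `n`-th power of a linear form, restricted to the sphere. -/
noncomputable def linPow (ℓ : Amb d →L[ℝ] ℂ) (n : ℕ) : Schwartz d :=
  SmoothOffZero.restr (F := fun x => ℓ x ^ n) fun _ _ => (ℓ.contDiff.pow n).contDiffAt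

theorem linPow_apply (ℓ : Amb d →L[ℝ] ℂ) (n : ℕ) (r : Sph d) : linPow ℓ n r = ℓ r ^ n := rfl

theorem solidExt_linPow (ℓ : Amb d →L[ℝ] ℂ) (n : ℕ) (hx : x ≠ 0) :
    solidExt n (linPow ℓ n) x = ℓ x ^ n := by
  obtain ⟨t, ht, r, rfl⟩ := exists_pos_smul_eq hx
  rw [solidExt_smul_pos _ _ ht, solidExt_coe, linPow_apply, map_smul, smul_pow]

theorem lapBeltrami_linPow (ℓ : Amb d →L[ℝ] ℂ) (n : ℕ) :
    lapBeltrami d (linPow ℓ n) + (n * (n + d - 2) : ℂ) • linPow ℓ n =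
      (n * (n - 1 : ℕ) * ∑ k, ℓ (EuclideanSpace.basisFun (Fin d) ℝ k) ^ 2) •
        linPow ℓ (n - 1 - 1) := by
  refine DFunLike.ext _ _ fun r => ?_
  have h := norm_sq_smul_laplacian_solidExt n (linPow ℓ n) (coe_ne_zero r)
  have hΔ := (InnerProductSpace.laplacian_congr_nhds
    ((eventually_ne_zero (coe_ne_zero r)).mono fun _ => solidExt_linPow ℓ n)).eq_of_nhds
  rw [hΔ, laplacian_clm_pow (EuclideanSpace.basisFun (Fin d) ℝ),
    norm_eq_of_mem_sphere, one_pow, one_smul, solidExt_coe, solidExt_coe, Complex.real_smul] at h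
  rw [Schwartz.add_apply, Schwartz.smul_apply, Schwartz.smul_apply, linPow_apply ℓ (n - 1 - 1)]
  push_cast at h
  linear_combination -h

theorem linPow_mem_Harm {ℓ : Amb d →L[ℝ] ℂ}
    (hℓ : ∑ k, ℓ (EuclideanSpace.basisFun (Fin d) ℝ k) ^ 2 = 0) (n : ℕ) :
    linPow ℓ n ∈ Harm d n := by
  have h := lapBeltrami_linPow ℓ n
  rw [hℓ, mul_zero, zero_smul] at h
  rw [mem_Harm, eq_neg_of_add_eq_zero_left h, ← neg_smul]

theorem exists_mem_Harm_ne_zero (n : ℕ) : ∃ f ∈ Harm d n, f ≠ 0 := by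
  have hd : 2 ≤ d := Fact.out
  let i₀ : Fin d := ⟨0, by omega⟩
  let i₁ : Fin d := ⟨1, by omega⟩
  have h01 : i₀ ≠ i₁ := by simp [i₀, i₁]
  let ℓ : Amb d →L[ℝ] ℂ := (EuclideanSpace.proj (𝕜 := ℝ) i₀).smulRight 1 +
    (EuclideanSpace.proj (𝕜 := ℝ) i₁).smulRight Complex.I
  have hℓ : ∀ x, ℓ x = x i₀ + x i₁ * Complex.I := fun x => by simp [ℓ]
  have hisotropic : ∑ k, ℓ (EuclideanSpace.basisFun (Fin d) ℝ k) ^ 2 = 0 := by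
    have hk : ∀ k, ℓ (EuclideanSpace.basisFun (Fin d) ℝ k) ^ 2 =
        (if i₀ = k then 1 else 0) - (if i₁ = k then 1 else 0) := fun k => by
      by_cases h0 : i₀ = k
      · subst h0
        simp [hℓ, h01.symm]
      · by_cases h1 : i₁ = k <;> simp [hℓ, h0, h1]
    simp only [hk, Finset.sum_sub_distrib, Finset.sum_ite_eq, Finset.mem_univ, if_true, sub_self]
  refine ⟨linPow ℓ n, linPow_mem_Harm hisotropic n, fun h0 => ?_⟩
  have h := DFunLike.congr_fun h0 (⟨EuclideanSpace.single i₀ 1, by simp⟩ : Sph d)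
  rw [linPow_apply] at h
  change _ = (0 : ℂ) at h
  simp [hℓ, h01.symm] at h

end SphericalHarmonics

section IntegrationByParts

open scoped RealInnerProductSpace

theorem IsSkew.integral_linDeriv {E V : Type*} [NormedAddCommGroup E] [InnerProductSpace ℝ E]
    [FiniteDimensional ℝ E] [MeasurableSpace E] [BorelSpace E] [NormedAddCommGroup V]
    [NormedSpace ℝ V] {A : E →L[ℝ] E} {H : E → V} (hA : IsSkew A) (hH : ContDiff ℝ 1 H)
    (hc : HasCompactSupport H) : ∫ x, linDeriv A H x = 0 := by
  let b := stdOrthonormalBasis ℝ E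
  have hcoord : ∀ k, Continuous fun x => ⟪b k, A x⟫ := fun k => by fun_prop
  have hint : ∀ k, Integrable fun x => ⟪b k, A x⟫ • fderiv ℝ H x (b k) := fun k =>
    ((hcoord k).smul ((hH.continuous_fderiv one_ne_zero).clm_apply
      continuous_const)).integrable_of_hasCompactSupport
      (hc.fderiv_apply (𝕜 := ℝ) (b k)).smul_left
  have hderiv : ∀ k x, fderiv ℝ (fun y => ⟪b k, A y⟫) x (b k) = 0 := fun k x => by
    have h : HasFDerivAt (fun y => ⟪b k, A y⟫) ((innerSL ℝ (b k)).comp A) x :=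
      ((innerSL ℝ (b k)).comp A).hasFDerivAt
    rw [h.fderiv]
    exact (real_inner_comm _ _).trans (hA (b k))
  have hterm : ∀ k, ∫ x, ⟪b k, A x⟫ • fderiv ℝ H x (b k) = 0 := fun k => by
    rw [integral_smul_fderiv_eq_neg_fderiv_smul_of_integrable (by simp [hderiv]) (hint k)
      (((hcoord k).smul hH.continuous).integrable_of_hasCompactSupport hc.smul_left)
      (fun x _ => ((innerSL ℝ (b k)).comp A).differentiableAt)
      (fun x _ => hH.differentiable one_ne_zero x)]
    simp [hderiv]
  calc
    ∫ x, linDeriv A H x = ∫ x, ∑ k, ⟪b k, A x⟫ • fderiv ℝ H x (b k) :=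
      integral_congr_ae (.of_forall fun x => (sum_inner_smul_map b (fderiv ℝ H x) (A x)).symm)
    _ = 0 := by rw [integral_finsetSum _ fun k _ => hint k, Finset.sum_eq_zero fun k _ => hterm k]

end IntegrationByParts

section PolarCoordinates

variable {d : ℕ}

/-- A bump function of the squared norm; it localises integrals to a neighbourhood of a sphere,
away from the origin. -/
noncomputable def shellBump : ContDiffBump (2 : ℝ) := ⟨1 / 2, 1, by norm_num, by norm_num⟩

theorem shellBump_eq_zero_of_le_one {t : ℝ} (ht : t ≤ 1) : shellBump t = 0 :=
  shellBump.zero_of_le_dist <| by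
    rw [Real.dist_eq, abs_sub_comm]
    exact le_trans (by change (1 : ℝ) ≤ 2 - t; linarith) (le_abs_self _)

theorem hasCompactSupport_shellBump_norm_sq :
    HasCompactSupport fun x : Amb d => shellBump (‖x‖ ^ 2) := by
  refine HasCompactSupport.of_support_subset_isCompact (isCompact_closedBall 0 2) fun x hx => ?_
  rw [mem_closedBall_zero_iff]
  by_contra! h
  refine hx (shellBump.zero_of_le_dist ?_)
  rw [Real.dist_eq]
  exact le_trans (by change (1 : ℝ) ≤ ‖x‖ ^ 2 - 2; nlinarith) (le_abs_self _)

theorem contDiff_shellBump_norm_sq_smul {V : Type*} [NormedAddCommGroup V] [NormedSpace ℝ V]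
    {F : Amb d → V} (hF : SmoothOffZero F) :
    ContDiff ℝ ∞ fun x => shellBump (‖x‖ ^ 2) • F x := by
  refine contDiff_iff_contDiffAt.2 fun x => ?_
  rcases eq_or_ne x 0 with rfl | hx
  · refine (contDiffAt_const (c := (0 : V))).congr_of_eventuallyEq ?_
    filter_upwards [ball_mem_nhds (0 : Amb d) one_pos] with x hx
    rw [mem_ball_zero_iff] at hx
    rw [shellBump_eq_zero_of_le_one (by nlinarith [norm_nonneg x]), zero_smul]
  · exact (shellBump.contDiff.comp (contDiff_norm_sq ℝ)).contDiffAt.smul (hF x hx)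

variable [Fact (2 ≤ d)]

instance : Nontrivial (Amb d) :=
  have hd : 2 ≤ d := Fact.out
  Module.nontrivial_of_finrank_pos (R := ℝ) (by rw [finrank_euclideanSpace_fin]; omega)

theorem integral_radial_smul_radialExt (a : ℝ → ℝ) (b : Sph d → ℂ) :
    ∫ x : Amb d, a ‖x‖ • radialExt b x =
      (∫ t in Ioi (0 : ℝ), t ^ (d - 1) * a t) • ∫ r, b r ∂(surf d) := by
  have hfr : finrank ℝ (Amb d) = d := finrank_euclideanSpace_fin
  calc
    ∫ x : Amb d, a ‖x‖ • radialExt b x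
      = ∫ x : ({(0 : Amb d)}ᶜ : Set (Amb d)), a ‖x.1‖ • radialExt b x.1
          ∂((volume : Measure (Amb d)).comap (↑)) := by
      rw [integral_subtype_comap (measurableSet_singleton _).compl
        fun x : Amb d => a ‖x‖ • radialExt b x, restrict_compl_singleton]
    _ = ∫ x : Sph d × Ioi (0 : ℝ), b x.1 * (a x.2 : ℂ)
          ∂((surf d).prod (.volumeIoiPow (finrank ℝ (Amb d) - 1))) := by
      rw [surf, ←
        (volume : Measure (Amb d)).measurePreserving_homeomorphUnitSphereProd.integral_comp
          (Homeomorph.measurableEmbedding _)]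
      refine integral_congr_ae (Eventually.of_forall fun x => ?_)
      simp only [homeomorphUnitSphereProd_apply_snd_coe, radialExt, dif_neg (show (x : Amb d) ≠ 0
        from x.2), Complex.real_smul, mul_comm]
      congr 2
      exact Subtype.ext (by simp)
    _ = (∫ r, b r ∂(surf d)) *
        ((∫ x : Ioi (0 : ℝ), a x ∂(.volumeIoiPow (finrank ℝ (Amb d) - 1)) : ℝ) : ℂ) := by
      rw [integral_prod_mul b fun x : Ioi (0 : ℝ) => (a x : ℂ), integral_complex_ofReal]
    _ = _ := by
      rw [mul_comm, ← Complex.real_smul, hfr]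
      congr 1
      simp only [Measure.volumeIoiPow, ENNReal.ofReal]
      rw [integral_withDensity_eq_integral_smul
          (measurable_subtype_coe.pow_const _).real_toNNReal,
        integral_subtype_comap measurableSet_Ioi fun t : ℝ => Real.toNNReal (t ^ (d - 1)) • a t]
      refine setIntegral_congr_fun measurableSet_Ioi fun t ht => ?_
      rw [NNReal.smul_def, Real.coe_toNNReal _ (pow_nonneg (le_of_lt ht) _), smul_eq_mul]

theorem setIntegral_shellBump_ne_zero :
    ∫ t in Ioi (0 : ℝ), t ^ (d - 1) * shellBump (t ^ 2) ≠ 0 := fun h0 => by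
  have hcont : Continuous fun x : Amb d => shellBump (‖x‖ ^ 2) :=
    (shellBump.contDiff (n := 0)).continuous.comp (by fun_prop)
  obtain ⟨x, hx⟩ := exists_norm_eq (Amb d) (c := √2) (by positivity)
  have hxpos : shellBump (‖x‖ ^ 2) ≠ 0 := by
    rw [hx, Real.sq_sqrt zero_le_two]
    exact (shellBump.pos_of_mem_ball (mem_ball_self shellBump.rOut_pos)).ne'
  refine (hcont.integral_pos_of_hasCompactSupport_nonneg_nonzero (μ := volume)
    hasCompactSupport_shellBump_norm_sq (fun x => shellBump.nonneg) hxpos).ne' ?_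
  rw [integral_fun_norm_addHaar volume fun t => shellBump (t ^ 2)]
  simp [h0]

theorem linDeriv_shellBump_norm_sq_smul {A : Amb d →L[ℝ] Amb d} (hA : IsSkew A) (f : Schwartz d)
    (x : Amb d) : linDeriv A (fun y => shellBump (‖y‖ ^ 2) • radialExt f y) x =
      shellBump (‖x‖ ^ 2) • radialExt (sphDeriv A f) x := by
  rcases eq_or_ne x 0 with rfl | hx
  · simp [linDeriv, radialExt]
  have hφ : DifferentiableAt ℝ shellBump (‖x‖ ^ 2) :=
    shellBump.contDiff.contDiffAt.differentiableAt one_ne_zero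
  have hφ' : DifferentiableAt ℝ (fun y : Amb d => shellBump (‖y‖ ^ 2)) x :=
    (shellBump.contDiff.comp (contDiff_norm_sq ℝ)).contDiffAt.differentiableAt one_ne_zero
  rw [linDeriv_smul hφ' (differentiableAt_radialExt f hx), linDeriv_comp_norm_sq hA hφ, zero_smul,
    add_zero, radialExt_sphDeriv A f hx]

theorem integral_sphDeriv {A : Amb d →L[ℝ] Amb d} (hA : IsSkew A) (f : Schwartz d) :
    ∫ r, sphDeriv A f r ∂(surf d) = 0 := by
  have h := hA.integral_linDeriv
    ((contDiff_shellBump_norm_sq_smul (smoothOffZero_radialExt f)).of_le (by norm_cast))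
    hasCompactSupport_shellBump_norm_sq.smul_right
  simp only [linDeriv_shellBump_norm_sq_smul hA f] at h
  rw [integral_radial_smul_radialExt fun t => shellBump (t ^ 2)] at h
  exact (smul_eq_zero.1 h).resolve_left setIntegral_shellBump_ne_zero

end PolarCoordinates

section InnerProduct

variable {d : ℕ} [Fact (2 ≤ d)] {A : Amb d →L[ℝ] Amb d}

/-- The pointwise product of smooth functions on the sphere. -/
def Schwartz.mul (f g : Schwartz d) : Schwartz d :=
  ⟨fun r => f r * g r, (contDiff_mul (𝕜 := ℝ) (𝔸 := ℂ) (n := ∞)).contMDiff.comp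
    (f.contMDiff.prodMk_space g.contMDiff)⟩

@[simp] theorem Schwartz.mul_apply (f g : Schwartz d) (r : Sph d) :
    f.mul g r = f r * g r := rfl

/-- The pointwise complex conjugate of a smooth function on the sphere. -/
noncomputable def Schwartz.conj (f : Schwartz d) : Schwartz d :=
  ⟨fun r => (starRingEnd ℂ) (f r), (Complex.conjCLE.contDiff.contMDiff (n := ∞)).comp f.contMDiff⟩

@[simp] theorem Schwartz.conj_apply (f : Schwartz d) (r : Sph d) :
    f.conj r = (starRingEnd ℂ) (f r) := rfl

@[simp] theorem Schwartz.conj_conj (f : Schwartz d) : f.conj.conj = f :=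
  DFunLike.ext _ _ fun r => by simp

theorem Schwartz.integrable (f : Schwartz d) : Integrable f (surf d) :=
  f.contMDiff.continuous.integrable_of_hasCompactSupport (HasCompactSupport.of_compactSpace _)

theorem sphDeriv_mul (A : Amb d →L[ℝ] Amb d) (f g : Schwartz d) :
    sphDeriv A (f.mul g) = f.mul (sphDeriv A g) + (sphDeriv A f).mul g :=
  DFunLike.ext _ _ fun r => by
    have hr := coe_ne_zero r
    have hext : radialExt (f.mul g) = fun x => radialExt f x • radialExt g x := by
      ext x
      by_cases hx : x = 0 <;> simp [radialExt, hx]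
    rw [sphDeriv_apply, hext,
      linDeriv_smul (differentiableAt_radialExt f hr) (differentiableAt_radialExt g hr)]
    simp [radialExt_coe, sphDeriv_apply]

theorem sphDeriv_conj (A : Amb d →L[ℝ] Amb d) (f : Schwartz d) :
    sphDeriv A f.conj = (sphDeriv A f).conj :=
  DFunLike.ext _ _ fun r => by
    have hext : radialExt f.conj = Complex.conjCLE ∘ radialExt f := by
      ext x
      by_cases hx : x = 0 <;> simp [radialExt, hx]
    rw [sphDeriv_apply, hext, linDeriv, Complex.conjCLE.comp_fderiv]
    rfl

theorem ip_sphDeriv (hA : IsSkew A) (f g : Schwartz d) :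
    ip (sphDeriv A f) g = -ip f (sphDeriv A g) := by
  have hsum := integral_sphDeriv hA (f.mul g.conj)
  rw [sphDeriv_mul, sphDeriv_conj] at hsum
  simp only [Schwartz.add_apply] at hsum
  rw [integral_add (Schwartz.integrable _) (Schwartz.integrable _)] at hsum
  exact eq_neg_of_add_eq_zero_right hsum

theorem ip_smul_right (c : ℂ) (f g : Schwartz d) : ip f (c • g) = conj c * ip f g := by
  rw [← ip_conj, ip_smul_left, map_mul, ip_conj]

/-- The linear form `⟨·, g⟩`. -/
noncomputable def ipₗ (g : Schwartz d) : Schwartz d →ₗ[ℂ] ℂ where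
  toFun f := ip f g
  map_add' f f' := ip_add_left f f' g
  map_smul' c f := ip_smul_left c f g

theorem ip_sum_left {ι : Type*} (s : Finset ι) (f : ι → Schwartz d) (g : Schwartz d) :
    ip (∑ k ∈ s, f k) g = ∑ k ∈ s, ip (f k) g := map_sum (ipₗ g) f s

theorem ip_sub_left (f f' g : Schwartz d) : ip (f - f') g = ip f g - ip f' g :=
  map_sub (ipₗ g) f f'

theorem ip_zero_left (g : Schwartz d) : ip 0 g = 0 := map_zero (ipₗ g)

theorem ip_sum_right {ι : Type*} (s : Finset ι) (f : Schwartz d) (g : ι → Schwartz d) :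
    ip f (∑ k ∈ s, g k) = ∑ k ∈ s, ip f (g k) := by
  rw [← ip_conj, ip_sum_left, map_sum]
  simp only [ip_conj]

theorem ip_lapBeltrami_eq_sum (f g : Schwartz d) :
    ip (lapBeltrami d f) g = -((1 / 2 : ℂ) * ∑ i, ∑ j, ip (sphRot i j f) (sphRot i j g)) := by
  rw [lapBeltrami_eq_sum, ip_smul_left, ip_sum_left]
  simp only [ip_sum_left, ip_sphDeriv (isSkew_planeRot _ _) (sphRot _ _ f) g,
    Finset.sum_neg_distrib, mul_neg]

theorem ip_lapBeltrami (f g : Schwartz d) : ip (lapBeltrami d f) g = ip f (lapBeltrami d g) := by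
  rw [← ip_conj (lapBeltrami d g), ip_lapBeltrami_eq_sum, ip_lapBeltrami_eq_sum]
  simp [ip_conj, map_ofNat (starRingEnd ℂ) 2]

/-- The squared `ℒ²` norm of a smooth function on the sphere. -/
noncomputable def normSq (f : Schwartz d) : ℝ := ∫ r, ‖f r‖ ^ 2 ∂(surf d)

theorem ip_self (f : Schwartz d) : ip f f = (normSq f : ℂ) := by
  rw [ip, normSq, ← integral_complex_ofReal]
  simp only [Complex.mul_conj, Complex.normSq_eq_norm_sq]

theorem normSq_nonneg (f : Schwartz d) : 0 ≤ normSq f :=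
  integral_nonneg fun _ => sq_nonneg _

end InnerProduct

section LaplaceEigenvalues

variable {d : ℕ} [Fact (2 ≤ d)] {n m : ℕ} {f g : Schwartz d}

/-- The eigenvalue `n (n + d - 2)` of `-Δ` on the spherical harmonics of order `n`. -/
def lapEig (d n : ℕ) : ℝ := n * (n + d - 2)

theorem mem_Harm_iff_lapEig : f ∈ Harm d n ↔ lapBeltrami d f = ((-lapEig d n : ℝ) : ℂ) • f := by
  rw [mem_Harm]
  simp [lapEig]

theorem lapEig_strictMono : StrictMono (lapEig d) := by
  refine strictMono_nat_of_lt_succ fun n => ?_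
  have : (2 : ℝ) ≤ d := by exact_mod_cast (Fact.out : 2 ≤ d)
  simp only [lapEig, Nat.cast_add, Nat.cast_one]
  nlinarith [(Nat.cast_nonneg n : (0 : ℝ) ≤ n)]

theorem lapEig_nonneg (n : ℕ) : 0 ≤ lapEig d n := by
  simpa [lapEig] using (lapEig_strictMono (d := d)).monotone n.zero_le

theorem ip_eq_zero_of_mem_Harm (hnm : n ≠ m) (hf : f ∈ Harm d n) (hg : g ∈ Harm d m) :
    ip f g = 0 := by
  have h := ip_lapBeltrami f g
  rw [mem_Harm_iff_lapEig.1 hf, mem_Harm_iff_lapEig.1 hg, ip_smul_left, ip_smul_right,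
    Complex.conj_ofReal] at h
  by_contra h0
  exact hnm ((lapEig_strictMono (d := d)).injective
    (neg_injective (Complex.ofReal_injective (mul_right_cancel₀ h0 h))))

theorem sum_normSq_sphRot (hf : f ∈ Harm d n) :
    ∑ i, ∑ j, normSq (sphRot i j f) = 2 * lapEig d n * normSq f := by
  have h := ip_lapBeltrami_eq_sum f f
  rw [mem_Harm_iff_lapEig.1 hf, ip_smul_left] at h
  simp only [ip_self] at h
  have hreal : -lapEig d n * normSq f = -(1 / 2 * ∑ i, ∑ j, normSq (sphRot i j f)) := by
    rw [← Complex.ofReal_inj]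
    push_cast at h ⊢
    exact h
  linarith

theorem normSq_sphRot_le (hf : f ∈ Harm d n) (i j : Fin d) :
    normSq (sphRot i j f) ≤ 2 * lapEig d n * normSq f := by
  rw [← sum_normSq_sphRot hf]
  exact (Finset.single_le_sum (f := fun j => normSq (sphRot i j f)) (fun _ _ => normSq_nonneg _)
      (Finset.mem_univ j)).trans
    (Finset.single_le_sum (f := fun i => ∑ j, normSq (sphRot i j f))
      (fun _ _ => Finset.sum_nonneg fun _ _ => normSq_nonneg _) (Finset.mem_univ i))

end LaplaceEigenvalues

section MeanValue

open scoped RealInnerProductSpace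

variable {E V : Type*} [NormedAddCommGroup E]

theorem hasDerivAt_max_zero_pow (n : ℕ) (t : ℝ) :
    HasDerivAt (fun t : ℝ => max t 0 ^ (n + 2)) ((n + 2) * max t 0 ^ (n + 1)) t := by
  rcases lt_trichotomy t 0 with ht | rfl | ht
  · rw [max_eq_right ht.le, zero_pow n.succ_ne_zero, mul_zero]
    refine (hasDerivAt_const t (0 : ℝ)).congr_of_eventuallyEq ?_
    filter_upwards [gt_mem_nhds ht] with s hs
    rw [max_eq_right hs.le, zero_pow (n + 1).succ_ne_zero]
  · rw [max_self, zero_pow n.succ_ne_zero, mul_zero, hasDerivAt_iff_isLittleO]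
    simp only [max_self, sub_zero, smul_zero, zero_pow (n + 1).succ_ne_zero]
    refine Asymptotics.IsBigO.trans_isLittleO (g := fun t : ℝ => t ^ (n + 2))
      (Asymptotics.IsBigO.of_bound 1 (Eventually.of_forall fun s => ?_))
      (by simpa using Asymptotics.isLittleO_pow_pow (𝕜 := ℝ) (show 1 < n + 2 by omega))
    rw [one_mul, norm_pow, norm_pow, Real.norm_of_nonneg (le_max_right _ _)]
    exact pow_le_pow_left₀ (le_max_right _ _) (max_le (le_abs_self s) (abs_nonneg s)) _
  · rw [max_eq_left ht.le]
    have h := hasDerivAt_pow (n + 2) t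
    push_cast at h
    refine h.congr_of_eventuallyEq ?_
    filter_upwards [lt_mem_nhds ht] with s hs
    rw [max_eq_left hs.le]

/-- The truncated power `(1 - ‖y‖²)₊^n`, the weight of the mean value property. -/
noncomputable def truncPow (n : ℕ) (y : E) : ℝ := max (1 - ‖y‖ ^ 2) 0 ^ n

theorem continuous_truncPow (n : ℕ) : Continuous (truncPow n : E → ℝ) := by
  unfold truncPow
  fun_prop

theorem truncPow_nonneg (n : ℕ) (y : E) : 0 ≤ truncPow n y :=
  pow_nonneg (le_max_right _ _) n

theorem truncPow_le_one (n : ℕ) (y : E) : truncPow n y ≤ 1 :=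
  pow_le_one₀ (le_max_right _ _) (max_le (by nlinarith [norm_nonneg y]) zero_le_one)

theorem truncPow_eq_zero (n : ℕ) {y : E} (hy : 1 ≤ ‖y‖) : truncPow (n + 1) y = 0 := by
  rw [truncPow, max_eq_right (by nlinarith), zero_pow n.succ_ne_zero]

variable [InnerProductSpace ℝ E]

theorem hasFDerivAt_truncPow (n : ℕ) (y : E) :
    HasFDerivAt (truncPow (n + 2)) ((-2 * (n + 2) * truncPow (n + 1) y) • innerSL ℝ y) y := by
  have houter : HasDerivAt (fun t : ℝ => max (1 - t) 0 ^ (n + 2))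
      ((n + 2) * max (1 - ‖y‖ ^ 2) 0 ^ (n + 1) * -1) (‖y‖ ^ 2) :=
    (hasDerivAt_max_zero_pow n (1 - ‖y‖ ^ 2)).comp (‖y‖ ^ 2) ((hasDerivAt_id _).const_sub 1)
  refine (houter.comp_hasFDerivAt y (hasStrictFDerivAt_norm_sq y).hasFDerivAt).congr_fderiv ?_
  ext v
  simp only [truncPow, smul_apply, innerSL_apply_apply, smul_eq_mul, nsmul_eq_mul, Nat.cast_ofNat]
  ring

section Affine

variable [NormedAddCommGroup V] [NormedSpace ℝ V] {F : E → V}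

theorem fderiv_fderiv_comp_add_smul (hF : ContDiff ℝ 2 F) (x : E) (s : ℝ) (y v w : E) :
    fderiv ℝ (fun y => fderiv ℝ F (x + s • y) v) y w =
      s • fderiv ℝ (fderiv ℝ F) (x + s • y) w v := by
  have hF' : DifferentiableAt ℝ (fderiv ℝ F) (x + s • y) :=
    (hF.fderiv_right (m := 1) le_rfl).differentiable one_ne_zero _
  have haff : HasFDerivAt (fun y : E => x + s • y) (s • ContinuousLinearMap.id ℝ E) y :=
    ((hasFDerivAt_id y).const_smul s).const_add x
  have hcomp : fderiv ℝ (fun y => fderiv ℝ F (x + s • y) v) y = _ :=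
    ((hF'.hasFDerivAt.comp y haff).clm_apply (hasFDerivAt_const v y)).fderiv
  rw [hcomp]
  simp

end Affine

variable [FiniteDimensional ℝ E]

theorem hasCompactSupport_truncPow (n : ℕ) : HasCompactSupport (truncPow (n + 1) : E → ℝ) := by
  refine HasCompactSupport.of_support_subset_isCompact (isCompact_closedBall 0 1) fun x hx => ?_
  rw [mem_closedBall_zero_iff]
  by_contra! h
  exact hx (truncPow_eq_zero n h.le)

variable [MeasurableSpace E] [BorelSpace E]

theorem integral_truncPow_pos (n : ℕ) : 0 < ∫ y : E, truncPow (n + 1) y :=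
  (continuous_truncPow _).integral_pos_of_hasCompactSupport_nonneg_nonzero
    (hasCompactSupport_truncPow n) (truncPow_nonneg _) (x := 0) (by simp [truncPow])

section Normed

variable [NormedAddCommGroup V] [NormedSpace ℝ V] {F : E → V} {x : E}

theorem integrable_truncPow_smul (n : ℕ) {G : E → V} (hG : Continuous G) :
    Integrable fun y => truncPow (n + 1) y • G y :=
  ((continuous_truncPow _).smul hG).integrable_of_hasCompactSupport
    (hasCompactSupport_truncPow n).smul_right

theorem integral_truncPow_smul_fderiv_apply (n : ℕ) {G : E → V} (hG : ContDiff ℝ 1 G) (v : E) :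
    ∫ y, truncPow (n + 2) y • fderiv ℝ G y v =
      (2 * (n + 2) : ℝ) • ∫ y, truncPow (n + 1) y • ⟪y, v⟫ • G y := by
  have hfd : ∀ y, fderiv ℝ (truncPow (n + 2)) y v • G y =
      (-(2 * (n + 2)) : ℝ) • truncPow (n + 1) y • ⟪y, v⟫ • G y := fun y => by
    rw [(hasFDerivAt_truncPow n y).fderiv]
    simp only [smul_apply, innerSL_apply_apply, smul_smul, smul_eq_mul]
    ring_nf
  have hint : Integrable fun y => truncPow (n + 1) y • ⟪y, v⟫ • G y :=
    integrable_truncPow_smul n ((by fun_prop : Continuous fun y : E => ⟪y, v⟫).smul hG.continuous)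
  rw [integral_smul_fderiv_eq_neg_fderiv_smul_of_integrable
    (by simp only [hfd]; exact hint.smul (-(2 * (n + 2)) : ℝ))
    (integrable_truncPow_smul _ ((hG.continuous_fderiv one_ne_zero).clm_apply continuous_const))
    (integrable_truncPow_smul _ hG.continuous)
    (fun y _ => (hasFDerivAt_truncPow n y).differentiableAt)
    (fun y _ => hG.differentiable one_ne_zero y)]
  simp only [hfd]
  rw [integral_smul, neg_smul, neg_neg]

theorem integral_truncPow_smul_fderiv (hF : ContDiff ℝ 2 F) (x : E) (n : ℕ) (s : ℝ) :
    (2 * (n + 2) : ℝ) • ∫ y, truncPow (n + 1) y • fderiv ℝ F (x + s • y) y =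
      s • ∫ y, truncPow (n + 2) y • (Δ F) (x + s • y) := by
  let b := stdOrthonormalBasis ℝ E
  have haff : Continuous fun y : E => x + s • y := by fun_prop
  have hF' : ContDiff ℝ 1 (fderiv ℝ F) := hF.fderiv_right le_rfl
  have hpd : ∀ k, ContDiff ℝ 1 fun y => fderiv ℝ F (x + s • y) (b k) := fun k =>
    (hF'.comp (by fun_prop : ContDiff ℝ 1 fun y : E => x + s • y)).clm_apply contDiff_const
  have hint : ∀ k, Integrable fun y =>
      truncPow (n + 2) y • fderiv ℝ (fderiv ℝ F) (x + s • y) (b k) (b k) := fun k =>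
    integrable_truncPow_smul _ ((((hF'.continuous_fderiv one_ne_zero).comp haff).clm_apply
      continuous_const).clm_apply continuous_const)
  have hint' : ∀ k, Integrable fun y =>
      truncPow (n + 1) y • ⟪y, b k⟫ • fderiv ℝ F (x + s • y) (b k) := fun k =>
    integrable_truncPow_smul _ ((by fun_prop : Continuous fun y : E => ⟪y, b k⟫).smul
      (hpd k).continuous)
  calc
    _ = ∑ k, (2 * (n + 2) : ℝ) •
        ∫ y, truncPow (n + 1) y • ⟪y, b k⟫ • fderiv ℝ F (x + s • y) (b k) := by
      rw [← Finset.smul_sum, ← integral_finsetSum _ fun k _ => hint' k]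
      simp only [← Finset.smul_sum, real_inner_comm (b _), sum_inner_smul_map]
    _ = ∑ k, s • ∫ y, truncPow (n + 2) y • fderiv ℝ (fderiv ℝ F) (x + s • y) (b k) (b k) := by
      refine Finset.sum_congr rfl fun k _ => ?_
      rw [← integral_truncPow_smul_fderiv_apply n (hpd k), ← integral_smul]
      simp only [fderiv_fderiv_comp_add_smul hF, smul_comm s]
    _ = _ := by
      rw [← Finset.smul_sum, ← integral_finsetSum _ fun k _ => hint k]
      simp only [← Finset.smul_sum, laplacian_eq_sum_fderiv_fderiv b]

theorem hasDerivAt_integral_truncPow_smul (hF : ContDiff ℝ 1 F) (x : E) (n : ℕ) (s : ℝ) :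
    HasDerivAt (fun s : ℝ => ∫ y, truncPow (n + 1) y • F (x + s • y))
      (∫ y, truncPow (n + 1) y • fderiv ℝ F (x + s • y) y) s := by
  have hF' : Continuous (fderiv ℝ F) := hF.continuous_fderiv one_ne_zero
  have hint : ∀ t : ℝ, Integrable fun y => truncPow (n + 1) y • F (x + t • y) := fun t =>
    integrable_truncPow_smul n (hF.continuous.comp (by fun_prop))
  have hint' : Integrable fun y => truncPow (n + 1) y • fderiv ℝ F (x + s • y) y :=
    integrable_truncPow_smul n ((hF'.comp (by fun_prop)).clm_apply continuous_id)
  obtain ⟨C, hC⟩ := (isCompact_closedBall x (|s| + 1)).exists_bound_of_continuousOn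
    hF'.continuousOn
  refine (hasDerivAt_integral_of_dominated_loc_of_deriv_le
    (F' := fun t y => truncPow (n + 1) y • fderiv ℝ F (x + t • y) y)
    (bound := fun y => truncPow (n + 1) y • C) (ball_mem_nhds s one_pos)
    (.of_forall fun t => (hint t).aestronglyMeasurable) (hint s) hint'.aestronglyMeasurable
    (.of_forall fun y t ht => ?_) (integrable_truncPow_smul n continuous_const)
    (.of_forall fun y t _ => ?_)).2
  · rcases le_or_gt 1 ‖y‖ with hy | hy
    · simp [truncPow_eq_zero n hy]
    have ht' : |t| ≤ |s| + 1 := by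
      rw [mem_ball, Real.dist_eq] at ht
      linarith [abs_sub_abs_le_abs_sub t s]
    have hmem : x + t • y ∈ closedBall x (|s| + 1) := by
      rw [mem_closedBall, dist_self_add_left, norm_smul, Real.norm_eq_abs]
      nlinarith [abs_nonneg t, norm_nonneg y]
    rw [norm_smul, Real.norm_of_nonneg (truncPow_nonneg _ _), smul_eq_mul]
    exact mul_le_mul_of_nonneg_left
      (((fderiv ℝ F _).unit_le_opNorm y hy.le).trans (hC _ hmem)) (truncPow_nonneg _ _)
  · have hline : HasDerivAt (fun t : ℝ => x + t • y) y t := by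
      simpa using ((hasDerivAt_id t).smul_const y).const_add x
    exact ((hF.differentiable one_ne_zero _).hasFDerivAt.comp_hasDerivAt t hline).const_smul _

theorem integral_truncPow_smul_of_laplacian_eq_zero (hF : ContDiff ℝ 2 F) {ε : ℝ}
    (hΔ : ∀ y ∈ ball x ε, (Δ F) y = 0) (n : ℕ) {s : ℝ} (hs : |s| < ε) :
    ∫ y, truncPow (n + 1) y • F (x + s • y) = ∫ y : E, truncPow (n + 1) y • F x := by
  have hderiv : ∀ t ∈ Ioo (-ε) ε,
      HasDerivAt (fun s : ℝ => ∫ y, truncPow (n + 1) y • F (x + s • y)) 0 t := fun t ht => by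
    convert hasDerivAt_integral_truncPow_smul (hF.of_le one_le_two) x n t using 1
    have hzero : ∀ y, truncPow (n + 2) y • (Δ F) (x + t • y) = 0 := fun y => by
      rcases le_or_gt 1 ‖y‖ with hy | hy
      · rw [truncPow_eq_zero _ hy, zero_smul]
      rw [hΔ, smul_zero]
      rw [mem_ball, dist_self_add_left, norm_smul, Real.norm_eq_abs]
      nlinarith [abs_lt.2 ht, abs_nonneg t, norm_nonneg y]
    have h := integral_truncPow_smul_fderiv hF x n t
    simp only [hzero, integral_zero, smul_zero] at h
    exact ((smul_eq_zero.1 h).resolve_left (by positivity)).symm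
  have hε : 0 < ε := (abs_nonneg s).trans_lt hs
  have h := isOpen_Ioo.is_const_of_deriv_eq_zero isPreconnected_Ioo
    (fun t ht => (hderiv t ht).differentiableAt.differentiableWithinAt)
    (fun t ht => (hderiv t ht).deriv) (abs_lt.1 hs) ⟨neg_lt_zero.2 hε, hε⟩
  simpa only [zero_smul, add_zero] using h

end Normed

variable [NormedAddCommGroup V] [InnerProductSpace ℝ V] {F : E → V} {x : E}

-- Integrate `‖F‖² ≥ 2 ⟪F x, F⟫ - ‖F x‖²` against the weight.
theorem norm_sq_le_integral_truncPow [CompleteSpace V] (hF : ContDiff ℝ 2 F) {ε : ℝ}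
    (hΔ : ∀ y ∈ ball x ε, (Δ F) y = 0) (n : ℕ) {s : ℝ} (hs : |s| < ε) :
    (∫ y : E, truncPow (n + 1) y) * ‖F x‖ ^ 2 ≤
      ∫ y, truncPow (n + 1) y * ‖F (x + s • y)‖ ^ 2 := by
  have hFc : Continuous fun y : E => F (x + s • y) := hF.continuous.comp (by fun_prop)
  have hinner : ∫ y, truncPow (n + 1) y * ⟪F x, F (x + s • y)⟫ =
      (∫ y : E, truncPow (n + 1) y) * ‖F x‖ ^ 2 := by
    simp only [← real_inner_smul_right]
    rw [integral_inner (integrable_truncPow_smul n hFc),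
      integral_truncPow_smul_of_laplacian_eq_zero hF hΔ n hs, integral_smul_const,
      real_inner_smul_right, real_inner_self_eq_norm_sq]
  have hint : Integrable fun y => 2 * (truncPow (n + 1) y * ⟪F x, F (x + s • y)⟫) :=
    (integrable_truncPow_smul n (continuous_const.inner hFc)).const_mul 2
  have hint' : Integrable fun y : E => truncPow (n + 1) y * ‖F x‖ ^ 2 :=
    integrable_truncPow_smul n continuous_const
  calc
    _ = ∫ y, (2 * (truncPow (n + 1) y * ⟪F x, F (x + s • y)⟫) -
          truncPow (n + 1) y * ‖F x‖ ^ 2) := by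
      rw [integral_sub hint hint', integral_const_mul, integral_mul_const, hinner]
      ring
    _ ≤ _ := by
      refine integral_mono (hint.sub hint') (integrable_truncPow_smul n (hFc.norm.pow 2))
        fun y => ?_
      have hsq : 0 ≤ ‖F x‖ ^ 2 - 2 * ⟪F x, F (x + s • y)⟫ + ‖F (x + s • y)‖ ^ 2 := by
        rw [← norm_sub_sq_real]
        positivity
      dsimp only
      nlinarith [mul_nonneg (truncPow_nonneg (n + 1) y) hsq]

end MeanValue

section Annulus

variable {d : ℕ} {ε : ℝ} {V : Type*} [NormedAddCommGroup V]

/-- The closed annulus of radii `1 ± ε`. -/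
def annulus (d : ℕ) (ε : ℝ) : Set (Amb d) := {x | ‖x‖ ∈ Icc (1 - ε) (1 + ε)}

theorem isCompact_annulus (ε : ℝ) : IsCompact (annulus d ε) :=
  (isCompact_closedBall (0 : Amb d) (1 + ε)).of_isClosed_subset
    (isClosed_Icc.preimage continuous_norm) fun _ hx => mem_closedBall_zero_iff.2 hx.2

theorem ne_zero_of_mem_annulus (hε : ε < 1) {x : Amb d} (hx : x ∈ annulus d ε) : x ≠ 0 :=
  norm_pos_iff.1 ((sub_pos.2 hε).trans_le hx.1)

theorem mem_annulus_of_dist_le (r : Sph d) {x : Amb d} (hx : ‖x - r‖ ≤ ε) : x ∈ annulus d ε := by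
  have h := abs_le.1 ((abs_norm_sub_norm_le x (r : Amb d)).trans hx)
  rw [norm_eq_of_mem_sphere r] at h
  exact ⟨by linarith, by linarith⟩

theorem setIntegral_Icc_pow_le (hε0 : 0 ≤ ε) (hε : ε ≤ 1) (k : ℕ) :
    ∫ t in Icc (1 - ε) (1 + ε), t ^ k ≤ 2 * ε * (1 + ε) ^ k := by
  calc
    _ ≤ ∫ t in Icc (1 - ε) (1 + ε), (1 + ε) ^ k :=
      setIntegral_mono_on ((continuous_pow _).continuousOn.integrableOn_compact isCompact_Icc)
        (continuousOn_const.integrableOn_compact isCompact_Icc) measurableSet_Icc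
        fun t ht => pow_le_pow_left₀ (by linarith [ht.1]) ht.2 _
    _ = _ := by
      rw [setIntegral_const, measureReal_def, Real.volume_Icc, ENNReal.toReal_ofReal (by linarith),
        smul_eq_mul]
      ring

theorem exists_contDiff_eqOn_ball [NormedSpace ℝ V] {F : Amb d → V} (hF : SmoothOffZero F)
    (r : Sph d) : ∃ G : Amb d → V, ContDiff ℝ ∞ G ∧ EqOn G F (ball r (3 / 4)) := by
  let χ : ContDiffBump (r : Amb d) := ⟨3 / 4, 7 / 8, by norm_num, by norm_num⟩
  refine ⟨fun y => χ y • F y, contDiff_iff_contDiffAt.2 fun x => ?_, fun y hy => ?_⟩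
  · rcases eq_or_ne x 0 with rfl | hx
    · refine (contDiffAt_const (c := (0 : V))).congr_of_eventuallyEq ?_
      filter_upwards [ball_mem_nhds (0 : Amb d) (show (0 : ℝ) < 1 / 8 by norm_num)] with x hx
      rw [χ.zero_of_le_dist, zero_smul]
      change (7 / 8 : ℝ) ≤ dist x r
      have hr := norm_sub_norm_le (r : Amb d) x
      rw [norm_eq_of_mem_sphere r] at hr
      rw [mem_ball_zero_iff] at hx
      rw [dist_comm, dist_eq_norm]
      linarith
    · exact χ.contDiff.contDiffAt.smul (hF x hx)
  · dsimp only
    rw [χ.one_of_mem_closedBall (ball_subset_closedBall hy), one_smul]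

theorem exists_contDiff_laplacian_eq_zero_eqOn_ball [NormedSpace ℝ V] {F : Amb d → V}
    (hF : SmoothOffZero F) (hΔ : ∀ x ≠ 0, (Δ F) x = 0) (r : Sph d) :
    ∃ G : Amb d → V, ContDiff ℝ ∞ G ∧ EqOn G F (ball r (3 / 4)) ∧
      ∀ y ∈ ball (r : Amb d) (3 / 4), (Δ G) y = 0 := by
  obtain ⟨G, hG, hGF⟩ := exists_contDiff_eqOn_ball hF r
  have hne : ∀ y ∈ ball (r : Amb d) (3 / 4), y ≠ 0 := by
    rintro y hy rfl
    rw [mem_ball, dist_zero_left, norm_eq_of_mem_sphere r] at hy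
    norm_num at hy
  refine ⟨G, hG, hGF, fun y hy => ?_⟩
  rw [← hΔ y (hne y hy)]
  exact InnerProductSpace.laplacian_congr_nhds
    (eventuallyEq_of_mem (isOpen_ball.mem_nhds hy) hGF) |>.eq_of_nhds

theorem norm_sq_le_integral_annulus [InnerProductSpace ℝ V] [CompleteSpace V] {F : Amb d → V}
    (hF : SmoothOffZero F) (hΔ : ∀ x ≠ 0, (Δ F) x = 0) (hε0 : 0 < ε) (hε : ε ≤ 1 / 2)
    (r : Sph d) :
    (∫ y : Amb d, truncPow 2 y) * ‖F r‖ ^ 2 ≤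
      (ε ^ d)⁻¹ * ∫ x in annulus d ε, ‖F x‖ ^ 2 := by
  have hK := (isCompact_annulus (d := d) ε).measurableSet
  obtain ⟨G, hG, hGF, hΔG⟩ := exists_contDiff_laplacian_eq_zero_eqOn_ball hF hΔ r
  let g : Amb d → ℝ := (annulus d ε).indicator fun x => ‖F x‖ ^ 2
  have hg0 : ∀ x, 0 ≤ g x := indicator_nonneg fun _ _ => sq_nonneg _
  have hg : Integrable g := (integrable_indicator_iff hK).2 <|
    ContinuousOn.integrableOn_compact (isCompact_annulus ε) fun x hx =>
      ((hF x (ne_zero_of_mem_annulus (by linarith) hx)).continuousAt.norm.pow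
        2).continuousWithinAt
  have hle : ∀ y, truncPow 2 y * ‖G (r + ε • y)‖ ^ 2 ≤ g (r + ε • y) := fun y => by
    rcases le_or_gt 1 ‖y‖ with hy | hy
    · simpa only [truncPow_eq_zero 1 hy, zero_mul] using hg0 _
    have hdist : ‖((r : Amb d) + ε • y) - r‖ ≤ ε := by
      rw [add_sub_cancel_left, norm_smul, Real.norm_of_nonneg hε0.le]
      nlinarith
    have hball : (r : Amb d) + ε • y ∈ ball (r : Amb d) (3 / 4) :=
      mem_ball_iff_norm.2 (by linarith)
    simp only [g, indicator_of_mem (mem_annulus_of_dist_le r hdist), hGF hball]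
    exact mul_le_of_le_one_left (sq_nonneg _) (truncPow_le_one _ _)
  calc
    _ ≤ ∫ y : Amb d, truncPow 2 y * ‖G (r + ε • y)‖ ^ 2 := by
      rw [← hGF (mem_ball_self (by norm_num))]
      exact norm_sq_le_integral_truncPow (hG.of_le (by norm_cast)) hΔG 1
        (by rw [abs_of_pos hε0]; linarith)
    _ ≤ ∫ y, g (r + ε • y) := integral_mono_of_nonneg
      (.of_forall fun y => mul_nonneg (truncPow_nonneg _ _) (sq_nonneg _))
      ((hg.comp_add_left (r : Amb d)).comp_smul hε0.ne') (.of_forall hle)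
    _ = _ := by
      rw [Measure.integral_comp_smul volume (fun y => g (r + y)) ε,
        integral_add_left_eq_self g (r : Amb d), ← integral_indicator hK,
        finrank_euclideanSpace_fin, abs_of_pos (by positivity), smul_eq_mul]

variable [Fact (2 ≤ d)]

theorem setIntegral_annulus_pow_smul_radialExt (hε : ε < 1) (k : ℕ) (b : Sph d → ℂ) :
    ∫ x in annulus d ε, ‖x‖ ^ k • radialExt b x =
      (∫ t in Icc (1 - ε) (1 + ε), t ^ (d - 1 + k)) • ∫ r, b r ∂(surf d) := by
  let a : ℝ → ℝ := (Icc (1 - ε) (1 + ε)).indicator fun t => t ^ k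
  have hind : (annulus d ε).indicator (fun x => ‖x‖ ^ k • radialExt b x) =
      fun x => a ‖x‖ • radialExt b x :=
    funext fun x => indicator_smul_apply_left (annulus d ε) (fun x => ‖x‖ ^ k) (radialExt b) x
  have ha : ∀ t, t ^ (d - 1) * a t =
      (Icc (1 - ε) (1 + ε)).indicator (fun t => t ^ (d - 1 + k)) t := fun t => by
    simp only [a, pow_add, ← indicator_mul_right _ (fun t : ℝ => t ^ (d - 1))]
  have hsub : Icc (1 - ε) (1 + ε) ⊆ Ioi 0 := fun t ht => (sub_pos.2 hε).trans_le ht.1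
  rw [← integral_indicator (isCompact_annulus ε).measurableSet, hind,
    integral_radial_smul_radialExt]
  simp only [ha]
  rw [setIntegral_indicator measurableSet_Icc, inter_eq_right.2 hsub]

end Annulus

section SupNorm

variable {d : ℕ} [Fact (2 ≤ d)] {ε : ℝ} {s : Finset ℕ} {f : ℕ → Schwartz d}

/-- The sum of the harmonic homogeneous extensions of spherical harmonics `f n` of order `n`. -/
noncomputable def solidSum (s : Finset ℕ) (f : ℕ → Schwartz d) (x : Amb d) : ℂ :=
  ∑ n ∈ s, solidExt n (f n) x

theorem smoothOffZero_solidSum (s : Finset ℕ) (f : ℕ → Schwartz d) :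
    SmoothOffZero (solidSum s f) :=
  fun x hx => ContDiffAt.sum fun n _ => smoothOffZero_solidExt n (f n) x hx

theorem solidSum_coe (s : Finset ℕ) (f : ℕ → Schwartz d) (r : Sph d) :
    solidSum s f r = ∑ n ∈ s, f n r := by
  simp only [solidSum, solidExt_coe]

theorem laplacian_solidSum (hf : ∀ n ∈ s, f n ∈ Harm d n) {x : Amb d} (hx : x ≠ 0) :
    (Δ (solidSum s f)) x = 0 := by
  induction s using Finset.induction_on with
  | empty =>
    have hzero : solidSum ∅ f = fun _ => 0 := funext fun y => Finset.sum_empty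
    rw [hzero, InnerProductSpace.laplacian_const, Pi.zero_apply]
  | insert n s hn ih =>
    have hsum : solidSum (insert n s) f = solidExt n (f n) + solidSum s f :=
      funext fun y => Finset.sum_insert hn
    have hsmooth := (smoothOffZero_solidExt n (f n) x hx).of_le (m := 2) (by norm_cast)
    rw [hsum, hsmooth.laplacian_add ((smoothOffZero_solidSum s f x hx).of_le (by norm_cast)),
      laplacian_solidExt_of_mem_Harm (hf n (s.mem_insert_self n)) hx,
      ih fun m hm => hf m (Finset.mem_insert_of_mem hm), add_zero]

theorem setIntegral_annulus_solidExt_mul_conj (hε : ε < 1) (n m : ℕ) (f g : Schwartz d) :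
    ∫ x in annulus d ε, solidExt n f x * conj (solidExt m g x) =
      (∫ t in Icc (1 - ε) (1 + ε), t ^ (d - 1 + (n + m))) • ip f g := by
  rw [ip, ← setIntegral_annulus_pow_smul_radialExt hε]
  refine integral_congr_ae (.of_forall fun x => ?_)
  have hprod : radialExt (fun r => f r * conj (g r)) x = radialExt f x * conj (radialExt g x) := by
    by_cases hx : x = 0 <;> simp [radialExt, hx]
  simp only [solidExt, hprod, Complex.real_smul, map_mul, Complex.conj_ofReal, pow_add]
  push_cast
  ring

theorem setIntegral_annulus_norm_sq_solidSum (hε : ε < 1) (hf : ∀ n ∈ s, f n ∈ Harm d n) :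
    ∫ x in annulus d ε, ‖solidSum s f x‖ ^ 2 =
      ∑ n ∈ s, (∫ t in Icc (1 - ε) (1 + ε), t ^ (d - 1 + (n + n))) * normSq (f n) := by
  have hint : ∀ n m, IntegrableOn (fun x => solidExt n (f n) x * conj (solidExt m (f m) x))
      (annulus d ε) := fun n m =>
    ContinuousOn.integrableOn_compact (isCompact_annulus ε) fun x hx =>
      have hx0 := ne_zero_of_mem_annulus hε hx
      ((smoothOffZero_solidExt n (f n) x hx0).continuousAt.mul
        (Complex.continuous_conj.continuousAt.comp
          (smoothOffZero_solidExt m (f m) x hx0).continuousAt)).continuousWithinAt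
  have hexpand : ∀ x, ((‖solidSum s f x‖ ^ 2 : ℝ) : ℂ) =
      ∑ n ∈ s, ∑ m ∈ s, solidExt n (f n) x * conj (solidExt m (f m) x) := fun x => by
    rw [← Complex.normSq_eq_norm_sq, ← Complex.mul_conj, solidSum, map_sum, Finset.sum_mul_sum]
  rw [← Complex.ofReal_inj, ← integral_complex_ofReal]
  simp only [hexpand]
  rw [integral_finsetSum _ fun n _ => integrable_finsetSum _ fun m _ => hint n m,
    Complex.ofReal_sum]
  refine Finset.sum_congr rfl fun n hn => ?_
  rw [integral_finsetSum _ fun m _ => hint n m]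
  simp only [setIntegral_annulus_solidExt_mul_conj hε]
  rw [Finset.sum_eq_single_of_mem n hn fun m hm hmn => by
    rw [ip_eq_zero_of_mem_Harm hmn.symm (hf n hn) (hf m hm), smul_zero], ip_self,
    Complex.ofReal_mul, Complex.real_smul]

theorem setIntegral_annulus_norm_sq_solidSum_le (hε0 : 0 ≤ ε) (hε : ε < 1) {N : ℕ}
    (hs : ∀ n ∈ s, n ≤ N) (hf : ∀ n ∈ s, f n ∈ Harm d n) :
    ∫ x in annulus d ε, ‖solidSum s f x‖ ^ 2 ≤
      2 * ε * (1 + ε) ^ (d - 1 + 2 * N) * ∑ n ∈ s, normSq (f n) := by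
  rw [setIntegral_annulus_norm_sq_solidSum hε hf, Finset.mul_sum]
  refine Finset.sum_le_sum fun n hn => mul_le_mul_of_nonneg_right ?_ (normSq_nonneg _)
  refine (setIntegral_Icc_pow_le hε0 hε.le _).trans ?_
  gcongr
  · linarith
  · linarith [hs n hn]

theorem one_add_pow_le_two_pow_mul_exp (hε0 : 0 ≤ ε) (hε : ε ≤ 1) (k m : ℕ) :
    (1 + ε) ^ (k + m) ≤ 2 ^ k * Real.exp (m * ε) := by
  rw [pow_add, Real.exp_nat_mul]
  gcongr
  · linarith
  · linarith [Real.add_one_le_exp ε]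

-- The annulus of half-width `1 / (2N)` is thin enough for solid harmonics of degree at most `N` to
-- stay bounded on it; this produces the sharp power `N ^ (d - 1)`.
theorem exists_norm_sq_sum_le (d : ℕ) [Fact (2 ≤ d)] : ∃ C : ℝ, 0 < C ∧ ∀ N : ℕ, 1 ≤ N →
    ∀ s : Finset ℕ, (∀ n ∈ s, n ≤ N) → ∀ f : ℕ → Schwartz d, (∀ n ∈ s, f n ∈ Harm d n) →
      ∀ r, ‖∑ n ∈ s, f n r‖ ^ 2 ≤ C * (N : ℝ) ^ (d - 1) * ∑ n ∈ s, normSq (f n) := by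
  have hc := integral_truncPow_pos (E := Amb d) 1
  set c := ∫ y : Amb d, truncPow (1 + 1) y with hcdef
  refine ⟨2 ^ d * 2 ^ (d - 1) * Real.exp 1 / c, by positivity, fun N hN s hs f hf r => ?_⟩
  have hN' : (1 : ℝ) ≤ N := by exact_mod_cast hN
  set ε : ℝ := 1 / (2 * N) with hε
  have hε0 : 0 < ε := by positivity
  have hε2 : ε ≤ 1 / 2 := one_div_le_one_div_of_le (by norm_num) (by linarith)
  have hpow : (1 + ε) ^ (d - 1 + 2 * N) ≤ 2 ^ (d - 1) * Real.exp 1 := by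
    convert one_add_pow_le_two_pow_mul_exp hε0.le (by linarith) (d - 1) (2 * N) using 3
    rw [hε]
    push_cast
    field_simp
  have hεd : (ε ^ d)⁻¹ * (2 * ε) = 2 ^ d * (N : ℝ) ^ (d - 1) := by
    obtain ⟨k, rfl⟩ : ∃ k, d = k + 1 := ⟨d - 1, by have := (Fact.out : 2 ≤ d); omega⟩
    rw [Nat.add_sub_cancel, hε, one_div, inv_pow, inv_inv, mul_pow, pow_succ (N : ℝ)]
    field_simp
  have hS : 0 ≤ ∑ n ∈ s, normSq (f n) := Finset.sum_nonneg fun _ _ => normSq_nonneg _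
  rw [div_mul_eq_mul_div, div_mul_eq_mul_div, le_div_iff₀' hc, ← solidSum_coe]
  calc
    c * ‖solidSum s f r‖ ^ 2 ≤ (ε ^ d)⁻¹ * ∫ x in annulus d ε, ‖solidSum s f x‖ ^ 2 :=
      norm_sq_le_integral_annulus (smoothOffZero_solidSum s f)
        (fun x hx => laplacian_solidSum hf hx) hε0 hε2 r
    _ ≤ (ε ^ d)⁻¹ * (2 * ε * (1 + ε) ^ (d - 1 + 2 * N) * ∑ n ∈ s, normSq (f n)) := by
      gcongr
      exact setIntegral_annulus_norm_sq_solidSum_le hε0.le (by linarith) hs hf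
    _ ≤ (ε ^ d)⁻¹ * (2 * ε * (2 ^ (d - 1) * Real.exp 1) * ∑ n ∈ s, normSq (f n)) := by gcongr
    _ = (ε ^ d)⁻¹ * (2 * ε) * (2 ^ (d - 1) * Real.exp 1 * ∑ n ∈ s, normSq (f n)) := by ring
    _ = _ := by
      rw [hεd]
      ring

end SupNorm

section SquareIntegrable

variable {d : ℕ} [Fact (2 ≤ d)]

/-- The embedding of smooth functions on the sphere into `ℒ²`. -/
noncomputable def toL2 (d : ℕ) [Fact (2 ≤ d)] : Schwartz d →ₗ[ℂ] Lp ℂ 2 (surf d) :=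
  (ContinuousMap.toLp 2 (surf d) ℂ : C(Sph d, ℂ) →L[ℂ] Lp ℂ 2 (surf d)).toLinearMap ∘ₗ toContₗ d

theorem coeFn_toL2 (f : Schwartz d) : toL2 d f =ᵐ[surf d] f :=
  ContinuousMap.coeFn_toLp (𝕜 := ℂ) (surf d) (toContₗ d f)

theorem inner_toL2 (f g : Schwartz d) : inner ℂ (toL2 d f) (toL2 d g) = ip g f := by
  rw [L2.inner_def]
  refine integral_congr_ae ?_
  filter_upwards [coeFn_toL2 f, coeFn_toL2 g] with r hf hg
  rw [hf, hg]
  rfl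

theorem norm_toL2_sq (f : Schwartz d) : ‖toL2 d f‖ ^ 2 = normSq f := by
  rw [← Complex.ofReal_inj, ← ip_self, ← inner_toL2, inner_self_eq_norm_sq_to_K,
    Complex.ofReal_pow]
  rfl

theorem normSq_smul (c : ℂ) (f : Schwartz d) : normSq (c • f) = ‖c‖ ^ 2 * normSq f := by
  rw [← norm_toL2_sq, map_smul, norm_smul, mul_pow, norm_toL2_sq]

theorem norm_apply_le (f : Schwartz d) (r : Sph d) : ‖f r‖ ≤ ‖toCont d f‖ :=
  (toCont d f).norm_coe_le_norm r

theorem integrable_norm_sq (f : Schwartz d) : Integrable (fun r => ‖f r‖ ^ 2) (surf d) :=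
  (f.contMDiff.continuous.norm.pow 2).integrable_of_hasCompactSupport
    (HasCompactSupport.of_compactSpace _)

section SupNormControlled

variable {W : Submodule ℂ (Schwartz d)} {C : ℝ}

-- Apply the hypothesis to `f = ∑ i, conj (Y i r) • Y i`, for which `f r = normSq f`.
theorem sum_norm_sq_le_of_orthonormal {ι : Type*} [Fintype ι] [DecidableEq ι] {Y : ι → Schwartz d}
    (hC0 : 0 ≤ C) (hC : ∀ f ∈ W, ‖toCont d f‖ ^ 2 ≤ C * normSq f) (hY : ∀ i, Y i ∈ W)
    (hip : ∀ i j, ip (Y i) (Y j) = if i = j then 1 else 0) (r : Sph d) :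
    ∑ i, ‖Y i r‖ ^ 2 ≤ C := by
  set T := ∑ i, ‖Y i r‖ ^ 2 with hT
  have hT0 : 0 ≤ T := Finset.sum_nonneg fun _ _ => sq_nonneg _
  let f : Schwartz d := ∑ i, conj (Y i r) • Y i
  have hf : f ∈ W := Submodule.sum_mem _ fun i _ => Submodule.smul_mem _ _ (hY i)
  have hfr : f r = (T : ℂ) := by
    simp only [f, Schwartz.sum_apply, Schwartz.smul_apply, hT, Complex.ofReal_sum,
      ← Complex.normSq_eq_conj_mul_self, Complex.normSq_eq_norm_sq]
  have hfn : normSq f = T := by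
    rw [← Complex.ofReal_inj, ← ip_self]
    simp only [f, ip_sum_left, ip_sum_right, ip_smul_left, ip_smul_right, hip, mul_ite, mul_one,
      mul_zero, Finset.sum_ite_eq', Finset.mem_univ, if_true, hT,
      Complex.ofReal_sum, Complex.conj_conj, Complex.mul_conj, Complex.normSq_eq_norm_sq]
  have hle := (pow_le_pow_left₀ (norm_nonneg _) (norm_apply_le f r) 2).trans (hC f hf)
  rw [hfr, hfn, Complex.norm_real, Real.norm_of_nonneg hT0] at hle
  by_contra! hlt
  nlinarith

theorem card_le_of_orthonormal {ι : Type*} [Fintype ι] [DecidableEq ι] {Y : ι → Schwartz d}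
    (hC0 : 0 ≤ C) (hC : ∀ f ∈ W, ‖toCont d f‖ ^ 2 ≤ C * normSq f) (hY : ∀ i, Y i ∈ W)
    (hip : ∀ i j, ip (Y i) (Y j) = if i = j then 1 else 0) :
    (Fintype.card ι : ℝ) ≤ (surf d).real univ * C := by
  have hnormSq : ∀ i, normSq (Y i) = 1 := fun i => by
    rw [← Complex.ofReal_inj, ← ip_self, hip, if_pos rfl, Complex.ofReal_one]
  have hint : ∀ i ∈ Finset.univ, Integrable (fun r => ‖Y i r‖ ^ 2) (surf d) :=
    fun i _ => integrable_norm_sq (Y i)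
  calc
    (Fintype.card ι : ℝ) = ∑ i, normSq (Y i) := by simp [hnormSq]
    _ = ∫ r, ∑ i, ‖Y i r‖ ^ 2 ∂(surf d) := (integral_finsetSum _ hint).symm
    _ ≤ ∫ _, C ∂(surf d) := integral_mono (integrable_finsetSum _ hint) (integrable_const _)
      (sum_norm_sq_le_of_orthonormal hC0 hC hY hip)
    _ = _ := by rw [integral_const, smul_eq_mul]

theorem finiteDimensional_map_toL2 (hC0 : 0 ≤ C)
    (hC : ∀ f ∈ W, ‖toCont d f‖ ^ 2 ≤ C * normSq f) :
    FiniteDimensional ℂ (W.map (toL2 d)) := by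
  obtain ⟨K, hK⟩ := exists_nat_ge ((surf d).real univ * C)
  refine Module.rank_lt_aleph0_iff.1 ((rank_le (n := K) fun s hs => ?_).trans_lt
    Cardinal.natCast_lt_aleph0)
  have : FiniteDimensional ℂ (Submodule.span ℂ (s : Set (W.map (toL2 d)))) :=
    FiniteDimensional.span_finset ℂ s
  let b := stdOrthonormalBasis ℂ (Submodule.span ℂ (s : Set (W.map (toL2 d))))
  have hb := (b.orthonormal.comp_linearIsometry (Submodule.subtypeₗᵢ _)).comp_linearIsometry
    (W.map (toL2 d)).subtypeₗᵢ
  choose Y hYW hYb using fun i => (b i : W.map (toL2 d)).2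
  have hip : ∀ i j, ip (Y i) (Y j) = if i = j then 1 else 0 := fun i j => by
    rw [← inner_toL2, hYb, hYb]
    exact (orthonormal_iff_ite.1 hb j i).trans (if_congr eq_comm rfl rfl)
  have hcard := (card_le_of_orthonormal hC0 hC hYW hip).trans hK
  rw [Fintype.card_fin, finrank_span_finset_eq_card hs] at hcard
  exact_mod_cast hcard

end SupNormControlled

end SquareIntegrable

section HarmonicProjections

variable {d : ℕ} [Fact (2 ≤ d)] {n m : ℕ} {f g h q Y : Schwartz d}

theorem exists_norm_toCont_sq_le (d : ℕ) [Fact (2 ≤ d)] : ∃ C : ℝ, 0 < C ∧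
    ∀ (n : ℕ), ∀ f ∈ Harm d n, ‖toCont d f‖ ^ 2 ≤ C * ((n : ℝ) + 1) ^ (d - 1) * normSq f := by
  obtain ⟨C, hC, h⟩ := exists_norm_sq_sum_le d
  refine ⟨C, hC, fun n f hf => ?_⟩
  have hb : 0 ≤ C * ((n : ℝ) + 1) ^ (d - 1) * normSq f :=
    mul_nonneg (by positivity) (normSq_nonneg f)
  rw [← Real.sqrt_le_sqrt_iff hb, Real.sqrt_sq (norm_nonneg _),
    ContinuousMap.norm_le _ (Real.sqrt_nonneg _)]
  intro r
  have hr := h (n + 1) n.succ_pos {n} (by simp) (fun _ => f) (by simpa using hf) r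
  simp only [Finset.sum_singleton, Nat.cast_add, Nat.cast_one] at hr
  exact Real.le_sqrt_of_sq_le hr

instance finiteDimensional_map_toL2_Harm (n : ℕ) :
    FiniteDimensional ℂ ((Harm d n).map (toL2 d)) := by
  obtain ⟨C, hC, h⟩ := exists_norm_toCont_sq_le d
  exact finiteDimensional_map_toL2 (by positivity) (h n)

theorem exists_isHarmPart (n : ℕ) (h : Schwartz d) : ∃ q, IsHarmPart n h q := by
  let W := (Harm d n).map (toL2 d)
  obtain ⟨q, hq, hqP⟩ := (W.orthogonalProjectionOnto (toL2 d h)).2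
  refine ⟨q, hq, fun Y hY => ?_⟩
  have horth := W.starProjection_inner_eq_zero (toL2 d h) (toL2 d Y) (Submodule.mem_map_of_mem hY)
  rw [Submodule.starProjection_apply, ← hqP, ← map_sub, inner_toL2] at horth
  rw [← sub_eq_zero, ← ip_sub_left, ← ip_conj, horth, map_zero]

theorem isHarmPart_harmPart (n : ℕ) (h : Schwartz d) : IsHarmPart n h (harmPart n h) := by
  rw [harmPart, dif_pos (exists_isHarmPart n h)]
  exact (exists_isHarmPart n h).choose_spec

theorem harmPart_mem (n : ℕ) (h : Schwartz d) : harmPart n h ∈ Harm d n :=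
  (isHarmPart_harmPart n h).1

theorem ip_harmPart (h : Schwartz d) (hY : Y ∈ Harm d n) : ip (harmPart n h) Y = ip h Y :=
  ((isHarmPart_harmPart n h).2 Y hY).symm

theorem IsHarmPart.harmPart_eq (hq : IsHarmPart n h q) : harmPart n h = q :=
  (isHarmPart_harmPart n h).unique hq

theorem harmPart_add (n : ℕ) (f g : Schwartz d) :
    harmPart n (f + g) = harmPart n f + harmPart n g :=
  IsHarmPart.harmPart_eq ⟨add_mem (harmPart_mem n f) (harmPart_mem n g), fun Y hY => by
    rw [ip_add_left, ip_add_left, ip_harmPart f hY, ip_harmPart g hY]⟩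

theorem harmPart_smul (n : ℕ) (c : ℂ) (f : Schwartz d) :
    harmPart n (c • f) = c • harmPart n f :=
  IsHarmPart.harmPart_eq ⟨Submodule.smul_mem _ _ (harmPart_mem n f), fun Y hY => by
    rw [ip_smul_left, ip_smul_left, ip_harmPart f hY]⟩

theorem harmPart_sub (n : ℕ) (f g : Schwartz d) :
    harmPart n (f - g) = harmPart n f - harmPart n g :=
  IsHarmPart.harmPart_eq ⟨sub_mem (harmPart_mem n f) (harmPart_mem n g), fun Y hY => by
    rw [ip_sub_left, ip_sub_left, ip_harmPart f hY, ip_harmPart g hY]⟩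

theorem harmPart_of_mem (hY : Y ∈ Harm d n) : harmPart n Y = Y :=
  IsHarmPart.harmPart_eq ⟨hY, fun _ _ => rfl⟩

theorem harmPart_of_mem_of_ne (hnm : n ≠ m) (hY : Y ∈ Harm d n) : harmPart m Y = 0 :=
  IsHarmPart.harmPart_eq ⟨zero_mem _, fun Z hZ => by
    rw [ip_zero_left, ip_eq_zero_of_mem_Harm hnm hY hZ]⟩

theorem harmPart_lapBeltrami (n : ℕ) (f : Schwartz d) :
    harmPart n (lapBeltrami d f) = ((-lapEig d n : ℝ) : ℂ) • harmPart n f :=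
  IsHarmPart.harmPart_eq ⟨Submodule.smul_mem _ _ (harmPart_mem n f), fun Y hY => by
    rw [ip_lapBeltrami, mem_Harm_iff_lapEig.1 hY, ip_smul_left, ip_smul_right, ip_harmPart f hY,
      Complex.conj_ofReal]⟩

theorem lapBeltrami_conj (f : Schwartz d) : lapBeltrami d f.conj = (lapBeltrami d f).conj := by
  rw [lapBeltrami_eq_sum, lapBeltrami_eq_sum]
  refine DFunLike.ext _ _ fun r => ?_
  simp only [Schwartz.smul_apply, Schwartz.sum_apply, Schwartz.conj_apply, sphDeriv_conj, map_mul,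
    map_sum, map_div₀, map_one, map_ofNat]

theorem Schwartz.conj_mem_Harm (hf : f ∈ Harm d n) : f.conj ∈ Harm d n := by
  rw [mem_Harm_iff_lapEig] at hf ⊢
  rw [lapBeltrami_conj, hf]
  refine DFunLike.ext _ _ fun r => ?_
  simp only [Schwartz.conj_apply, Schwartz.smul_apply, map_mul, Complex.conj_ofReal]

theorem ip_conj_conj (f g : Schwartz d) : ip f.conj g.conj = conj (ip f g) := by
  rw [ip, ip, ← integral_conj]
  simp only [Schwartz.conj_apply, map_mul]

theorem harmPart_conj (n : ℕ) (f : Schwartz d) : harmPart n f.conj = (harmPart n f).conj :=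
  IsHarmPart.harmPart_eq ⟨Schwartz.conj_mem_Harm (harmPart_mem n f), fun Y hY => by
    rw [← Schwartz.conj_conj Y, ip_conj_conj, ip_conj_conj,
      ip_harmPart f (Schwartz.conj_mem_Harm hY)]⟩

theorem normSq_sum_of_mem_Harm (s : Finset ℕ) {f : ℕ → Schwartz d}
    (hf : ∀ n ∈ s, f n ∈ Harm d n) : normSq (∑ n ∈ s, f n) = ∑ n ∈ s, normSq (f n) := by
  rw [← Complex.ofReal_inj, ← ip_self, ip_sum_left, Complex.ofReal_sum]
  refine Finset.sum_congr rfl fun n hn => ?_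
  rw [ip_sum_right, Finset.sum_eq_single_of_mem n hn fun m hm hmn =>
    ip_eq_zero_of_mem_Harm hmn.symm (hf n hn) (hf m hm), ip_self]

theorem sum_normSq_harmPart_le (s : Finset ℕ) (h : Schwartz d) :
    ∑ n ∈ s, normSq (harmPart n h) ≤ normSq h := by
  set S := ∑ n ∈ s, harmPart n h with hS
  have hnormSq : normSq S = ∑ n ∈ s, normSq (harmPart n h) :=
    normSq_sum_of_mem_Harm s fun n _ => harmPart_mem n h
  have hip : ip h S = normSq S := by
    rw [hnormSq, hS, ip_sum_right, Complex.ofReal_sum]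
    exact Finset.sum_congr rfl fun n _ => by rw [← ip_harmPart h (harmPart_mem n h), ip_self]
  have hpyth : ip (h - S) (h - S) = (normSq h : ℂ) - normSq S := by
    rw [ip_sub_left, ← ip_conj (h - S) h, ← ip_conj (h - S) S, ip_sub_left, ip_sub_left, hip,
      ip_self, ip_self, ← ip_conj h S, hip]
    simp
  rw [ip_self, ← Complex.ofReal_sub, Complex.ofReal_inj] at hpyth
  linarith [normSq_nonneg (h - S)]

theorem normSq_harmPart_le (n : ℕ) (h : Schwartz d) : normSq (harmPart n h) ≤ normSq h := by
  simpa using sum_normSq_harmPart_le {n} h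

theorem add_one_le_one_add_lapEig (n : ℕ) : (n : ℝ) + 1 ≤ 1 + lapEig d n := by
  have hd : (2 : ℝ) ≤ d := by exact_mod_cast (Fact.out : 2 ≤ d)
  have hn : (n : ℝ) ≤ n * n := by exact_mod_cast Nat.le_mul_self n
  rw [lapEig]
  nlinarith [n.cast_nonneg (α := ℝ)]

theorem lapEig_le (n : ℕ) : lapEig d n ≤ d * ((n : ℝ) + 1) ^ 2 := by
  have hd : (2 : ℝ) ≤ d := by exact_mod_cast (Fact.out : 2 ≤ d)
  have hn : (0 : ℝ) ≤ n := n.cast_nonneg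
  rw [lapEig]
  nlinarith [mul_nonneg hn (by linarith : (0 : ℝ) ≤ d),
    mul_nonneg (sq_nonneg (n : ℝ)) (by linarith : (0 : ℝ) ≤ d - 1)]

end HarmonicProjections

section RadialDerivatives

variable {d : ℕ} [Fact (2 ≤ d)] {x : Amb d}

theorem norm_radialExt_le (f : Schwartz d) (x : Amb d) : ‖radialExt f x‖ ≤ ‖toCont d f‖ := by
  rw [radialExt]
  split_ifs
  · simp
  · exact norm_apply_le f _

-- By homogeneity the derivative in the radial direction vanishes, so only rotations contribute.
theorem fderiv_radialExt (f : Schwartz d) (hx : x ≠ 0) :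
    fderiv ℝ (radialExt f) x = (‖x‖ ^ 2)⁻¹ • ∑ i, ∑ j, x i •
      (EuclideanSpace.proj j : Amb d →L[ℝ] ℝ).smulRight (radialExt (sphRot i j f) x) := by
  set b := EuclideanSpace.basisFun (Fin d) ℝ
  set L := fderiv ℝ (radialExt f) x
  have hEuler : L x = 0 := by
    simpa [solidExt_zero_left, linDeriv] using linDeriv_id_solidExt 0 f hx
  have hcoord : ∀ y : Amb d, ∑ i, y i • L (b i) = L y := fun y => by
    simpa only [b, EuclideanSpace.basisFun_inner] using sum_inner_smul_map b L y
  have hrot : ∀ i j, radialExt (sphRot i j f) x = x i • L (b j) - x j • L (b i) := fun i j => by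
    rw [radialExt_sphDeriv _ f hx, linDeriv, planeRot_apply, map_sub, map_smul, map_smul,
      EuclideanSpace.basisFun_inner, EuclideanSpace.basisFun_inner]
  rw [eq_inv_smul_iff₀ (pow_ne_zero 2 (norm_ne_zero_iff.2 hx))]
  ext v
  have hrow : ∀ i, ∑ j, x i • v j • radialExt (sphRot i j f) x =
      x i ^ 2 • L v - (∑ j, v j * x j) • x i • L (b i) := fun i => by
    simp only [← hcoord v, Finset.smul_sum, Finset.sum_smul, ← Finset.sum_sub_distrib, hrot]
    exact Finset.sum_congr rfl fun j _ => by module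
  calc
    ‖x‖ ^ 2 • L v = ∑ i, ∑ j, x i • v j • radialExt (sphRot i j f) x := by
      simp only [hrow, Finset.sum_sub_distrib, ← Finset.smul_sum, hcoord, hEuler, smul_zero,
        sub_zero, ← Finset.sum_smul, EuclideanSpace.real_norm_sq_eq]
    _ = _ := by simp

theorem norm_fderiv_radialExt_le (f : Schwartz d) (hx : x ≠ 0) :
    ‖fderiv ℝ (radialExt f) x‖ ≤ ‖x‖⁻¹ * ∑ i, ∑ j, ‖toCont d (sphRot i j f)‖ := by
  have hterm : ∀ i j, ‖x i • (EuclideanSpace.proj j : Amb d →L[ℝ] ℝ).smulRight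
      (radialExt (sphRot i j f) x)‖ ≤ ‖x‖ * ‖toCont d (sphRot i j f)‖ := fun i j => by
    have hproj : ‖(EuclideanSpace.proj j : Amb d →L[ℝ] ℝ)‖ ≤ 1 :=
      ContinuousLinearMap.opNorm_le_bound _ zero_le_one fun v => by
        simpa using PiLp.norm_apply_le v j
    rw [norm_smul, ContinuousLinearMap.norm_smulRight_apply]
    exact mul_le_mul (PiLp.norm_apply_le x i) ((mul_le_of_le_one_left (norm_nonneg _) hproj).trans
      (norm_radialExt_le _ x)) (by positivity) (norm_nonneg x)
  rw [fderiv_radialExt f hx, norm_smul, norm_inv, norm_pow, norm_norm]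
  calc
    (‖x‖ ^ 2)⁻¹ * _ ≤ (‖x‖ ^ 2)⁻¹ * ∑ i, ∑ j, ‖x‖ * ‖toCont d (sphRot i j f)‖ :=
      mul_le_mul_of_nonneg_left (norm_sum_le_of_le _ fun i _ => norm_sum_le_of_le _ fun j _ =>
        hterm i j) (by positivity)
    _ = ‖x‖⁻¹ * ∑ i, ∑ j, ‖toCont d (sphRot i j f)‖ := by
      simp only [← Finset.mul_sum]
      field_simp

end RadialDerivatives

section RapidlyDecreasingSeries

variable {d : ℕ} [Fact (2 ≤ d)] {n : ℕ} {c : ℕ → ℝ} {f : Schwartz d} {Y : ℕ → Schwartz d}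
  {x : Amb d}

/-- A sequence of spherical harmonics, the `n`-th of order `n`, with rapidly decreasing norms. Such
sequences are the terms of the Fourier expansions of smooth functions on the sphere. -/
structure RapidDecay (Y : ℕ → Schwartz d) : Prop where
  mem : ∀ n, Y n ∈ Harm d n
  decay : ∀ k : ℕ, ∃ C : ℝ, ∀ n : ℕ, ((n : ℝ) + 1) ^ k * normSq (Y n) ≤ C

/-- Real sequences of at most polynomial growth, the symbols of the operators which act on all of
`𝒮(S^{d-1})`. -/
def PolyBounded (c : ℕ → ℝ) : Prop := ∃ (C : ℝ) (q : ℕ), ∀ n : ℕ, |c n| ≤ C * ((n : ℝ) + 1) ^ q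

theorem RapidDecay.sphRot (hY : RapidDecay Y) (i j : Fin d) :
    RapidDecay fun n => sphRot i j (Y n) := by
  refine ⟨fun n => sphDeriv_mem_Harm (isSkew_planeRot _ _) (hY.mem n), fun k => ?_⟩
  obtain ⟨C, hC⟩ := hY.decay (k + 2)
  refine ⟨2 * d * C, fun n => ?_⟩
  calc
    ((n : ℝ) + 1) ^ k * normSq (Spherical.sphRot i j (Y n))
      ≤ ((n : ℝ) + 1) ^ k * (2 * (d * ((n : ℝ) + 1) ^ 2) * normSq (Y n)) := by
        have := normSq_nonneg (Y n)
        grw [normSq_sphRot_le (hY.mem n) i j, lapEig_le]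
    _ = 2 * d * (((n : ℝ) + 1) ^ (k + 2) * normSq (Y n)) := by ring
    _ ≤ 2 * d * C := mul_le_mul_of_nonneg_left (hC n) (by positivity)

theorem RapidDecay.smul (hY : RapidDecay Y) (hc : PolyBounded c) :
    RapidDecay fun n => (c n : ℂ) • Y n := by
  obtain ⟨A, q, hA⟩ := hc
  refine ⟨fun n => Submodule.smul_mem _ _ (hY.mem n), fun k => ?_⟩
  obtain ⟨C, hC⟩ := hY.decay (k + 2 * q)
  refine ⟨A ^ 2 * C, fun n => ?_⟩
  calc
    ((n : ℝ) + 1) ^ k * normSq ((c n : ℂ) • Y n)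
      = ((n : ℝ) + 1) ^ k * (|c n| ^ 2 * normSq (Y n)) := by
        rw [normSq_smul, Complex.norm_real, Real.norm_eq_abs]
    _ ≤ ((n : ℝ) + 1) ^ k * ((A * ((n : ℝ) + 1) ^ q) ^ 2 * normSq (Y n)) := by
        have := normSq_nonneg (Y n)
        grw [hA n]
    _ = A ^ 2 * (((n : ℝ) + 1) ^ (k + 2 * q) * normSq (Y n)) := by ring
    _ ≤ A ^ 2 * C := mul_le_mul_of_nonneg_left (hC n) (sq_nonneg A)

/-- The operator `Id - Δ`, whose powers define the topology of `𝒮(S^{d-1})`. -/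
noncomputable abbrev idSubLap (d : ℕ) [Fact (2 ≤ d)] : End ℂ (Schwartz d) :=
  LinearMap.id - lapBeltrami d

theorem harmPart_idSubLap (n : ℕ) (h : Schwartz d) :
    harmPart n (idSubLap d h) = ((1 + lapEig d n : ℝ) : ℂ) • harmPart n h := by
  rw [LinearMap.sub_apply, LinearMap.id_apply, harmPart_sub, harmPart_lapBeltrami,
    Complex.ofReal_neg, neg_smul, sub_neg_eq_add, Complex.ofReal_add, add_smul, Complex.ofReal_one,
    one_smul]

theorem harmPart_idSubLap_pow (n k : ℕ) (h : Schwartz d) :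
    harmPart n ((idSubLap d ^ k) h) = (((1 + lapEig d n) ^ k : ℝ) : ℂ) • harmPart n h := by
  induction k with
  | zero => simp
  | succ k ih =>
    rw [pow_succ', Module.End.mul_apply, harmPart_idSubLap, ih, smul_smul, ← Complex.ofReal_mul,
      ← pow_succ']

theorem idSubLap_of_mem_Harm (hf : f ∈ Harm d n) :
    idSubLap d f = ((1 + lapEig d n : ℝ) : ℂ) • f := by
  rw [LinearMap.sub_apply, LinearMap.id_apply, mem_Harm_iff_lapEig.1 hf, Complex.ofReal_neg,
    neg_smul, sub_neg_eq_add, Complex.ofReal_add, add_smul, Complex.ofReal_one, one_smul]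

theorem rapidDecay_harmPart (h : Schwartz d) : RapidDecay fun n => harmPart n h := by
  refine ⟨fun n => harmPart_mem n h, fun k => ⟨normSq ((idSubLap d ^ k) h), fun n => ?_⟩⟩
  have hle := add_one_le_one_add_lapEig (d := d) n
  have hone : 1 ≤ 1 + lapEig d n := le_add_of_nonneg_right (lapEig_nonneg n)
  calc
    ((n : ℝ) + 1) ^ k * normSq (harmPart n h)
      ≤ ((1 + lapEig d n) ^ k) ^ 2 * normSq (harmPart n h) := by
        refine mul_le_mul_of_nonneg_right ?_ (normSq_nonneg _)
        exact (pow_le_pow_left₀ (by positivity) hle k).trans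
          (le_self_pow₀ (one_le_pow₀ hone) two_ne_zero)
    _ = normSq (harmPart n ((idSubLap d ^ k) h)) := by
        rw [harmPart_idSubLap_pow, normSq_smul, Complex.norm_real, Real.norm_eq_abs, sq_abs]
    _ ≤ _ := normSq_harmPart_le n _

theorem RapidDecay.summable (hY : RapidDecay Y) : Summable fun n => ‖toCont d (Y n)‖ := by
  obtain ⟨A, hA, h⟩ := exists_norm_toCont_sq_le d
  obtain ⟨C, hC⟩ := hY.decay (d - 1 + 4)
  have hsq : ∀ n : ℕ, (‖toCont d (Y n)‖ * ((n : ℝ) + 1) ^ 2) ^ 2 ≤ A * C := fun n => by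
    calc
      (‖toCont d (Y n)‖ * ((n : ℝ) + 1) ^ 2) ^ 2
        = ‖toCont d (Y n)‖ ^ 2 * ((n : ℝ) + 1) ^ 4 := by ring
      _ ≤ A * ((n : ℝ) + 1) ^ (d - 1) * normSq (Y n) * ((n : ℝ) + 1) ^ 4 :=
        mul_le_mul_of_nonneg_right (h n _ (hY.mem n)) (by positivity)
      _ = A * (((n : ℝ) + 1) ^ (d - 1 + 4) * normSq (Y n)) := by ring
      _ ≤ A * C := mul_le_mul_of_nonneg_left (hC n) hA.le
  refine .of_nonneg_of_le (fun n => norm_nonneg _)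
    (fun n => (le_div_iff₀ (by positivity)).2 (Real.le_sqrt_of_sq_le (hsq n))) ?_
  simpa [div_eq_mul_inv] using
    ((summable_nat_add_iff 1).2 (Real.summable_nat_pow_inv.2 one_lt_two)).mul_left (√(A * C))

theorem RapidDecay.summable_radialExt (hY : RapidDecay Y) (x : Amb d) :
    Summable fun n => radialExt (Y n) x :=
  .of_norm_bounded hY.summable fun n => norm_radialExt_le (Y n) x

theorem RapidDecay.hasFDerivAt_tsum (hY : RapidDecay Y) (hx : x ≠ 0) :
    Summable (fun n => fderiv ℝ (radialExt (Y n)) x) ∧ HasFDerivAt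
      (fun y => ∑' n, radialExt (Y n) y) (∑' n, fderiv ℝ (radialExt (Y n)) x) x := by
  have hpos : 0 < ‖x‖ / 2 := half_pos (norm_pos_iff.2 hx)
  have hnorm : ∀ y ∈ ball x (‖x‖ / 2), ‖x‖ / 2 ≤ ‖y‖ := fun y hy => by
    have := norm_sub_norm_le x y
    rw [mem_ball, dist_comm, dist_eq_norm] at hy
    linarith
  have hne : ∀ y ∈ ball x (‖x‖ / 2), y ≠ 0 := fun y hy =>
    norm_pos_iff.1 (hpos.trans_le (hnorm y hy))
  have hbound : ∀ n, ∀ y ∈ ball x (‖x‖ / 2), ‖fderiv ℝ (radialExt (Y n)) y‖ ≤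
      (‖x‖ / 2)⁻¹ * ∑ i, ∑ j, ‖toCont d (Spherical.sphRot i j (Y n))‖ := fun n y hy =>
    (norm_fderiv_radialExt_le _ (hne y hy)).trans (mul_le_mul_of_nonneg_right
      (inv_anti₀ hpos (hnorm y hy)) (by positivity))
  have hsummable := (summable_sum fun i (_ : i ∈ Finset.univ) => summable_sum
    fun j (_ : j ∈ Finset.univ) => (hY.sphRot i j).summable).mul_left (‖x‖ / 2)⁻¹
  have hmem : x ∈ ball x (‖x‖ / 2) := mem_ball_self hpos
  exact ⟨.of_norm_bounded hsummable fun n => hbound n x hmem,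
    hasFDerivAt_tsum_of_isPreconnected hsummable isOpen_ball (convex_ball x _).isPreconnected
      (fun n y hy => (differentiableAt_radialExt (Y n) (hne y hy)).hasFDerivAt) hbound hmem
      (hY.summable_radialExt x) hmem⟩

theorem RapidDecay.fderiv_tsum (hY : RapidDecay Y) (hx : x ≠ 0) :
    fderiv ℝ (fun y => ∑' n, radialExt (Y n) y) x = (‖x‖ ^ 2)⁻¹ • ∑ i, ∑ j, x i •
      (EuclideanSpace.proj j : Amb d →L[ℝ] ℝ).smulRight
        (∑' n, radialExt (Spherical.sphRot i j (Y n)) x) := by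
  rw [(hY.hasFDerivAt_tsum hx).2.fderiv]
  simp only [fderiv_radialExt _ hx]
  refine ((hasSum_sum fun i _ => hasSum_sum fun j _ => HasSum.const_smul (x i) ?_).const_smul
    _).tsum_eq
  exact ((hY.sphRot i j).summable_radialExt x).hasSum.mapL
    (ContinuousLinearMap.smulRightL ℝ (Amb d) ℂ (EuclideanSpace.proj j))

theorem RapidDecay.contDiffOn_tsum (k : ℕ) : ∀ {Y : ℕ → Schwartz d}, RapidDecay Y →
    ContDiffOn ℝ k (fun x => ∑' n, radialExt (Y n) x) {0}ᶜ := by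
  induction k with
  | zero => exact fun hY => contDiffOn_zero.2 fun x hx =>
      (hY.hasFDerivAt_tsum hx).2.continuousAt.continuousWithinAt
  | succ k ih =>
    intro Y hY
    refine (contDiffOn_succ_iff_fderiv_of_isOpen (n := k) isOpen_compl_singleton).2
      ⟨fun x hx => (hY.hasFDerivAt_tsum hx).2.differentiableAt.differentiableWithinAt, by simp, ?_⟩
    refine ContDiffOn.congr ?_ fun x hx => hY.fderiv_tsum hx
    refine ((contDiff_norm_sq ℝ).contDiffOn.inv fun x hx =>
      pow_ne_zero 2 (norm_ne_zero_iff.2 hx)).smul ?_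
    exact ContDiffOn.sum fun i _ => ContDiffOn.sum fun j _ =>
      (EuclideanSpace.proj (𝕜 := ℝ) i).contDiff.contDiffOn.smul
        (contDiffOn_const.smulRight (ih (hY.sphRot i j)))

theorem RapidDecay.smoothOffZero (hY : RapidDecay Y) :
    SmoothOffZero fun x => ∑' n, radialExt (Y n) x := fun _ hx =>
  (contDiffOn_infty.2 fun k => RapidDecay.contDiffOn_tsum k hY).contDiffAt
    (isOpen_compl_singleton.mem_nhds hx)

/-- The sum of a rapidly decreasing series of spherical harmonics. -/
noncomputable def RapidDecay.sum (hY : RapidDecay Y) : Schwartz d := hY.smoothOffZero.restr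

theorem RapidDecay.hasSum_apply (hY : RapidDecay Y) (r : Sph d) :
    HasSum (fun n => Y n r) (hY.sum r) := by
  simpa only [RapidDecay.sum, SmoothOffZero.restr_apply, radialExt_coe] using
    (hY.summable_radialExt r).hasSum

theorem RapidDecay.radialExt_sum (hY : RapidDecay Y) (hx : x ≠ 0) :
    radialExt hY.sum x = ∑' n, radialExt (Y n) x := by
  simp only [radialExt, dif_neg hx, (hY.hasSum_apply _).tsum_eq]

theorem RapidDecay.sphRot_sum (hY : RapidDecay Y) (i j : Fin d) :
    Spherical.sphRot i j hY.sum = (hY.sphRot i j).sum := by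
  refine DFunLike.ext _ _ fun r => HasSum.unique ?_ ((hY.sphRot i j).hasSum_apply r)
  have hr := coe_ne_zero r
  obtain ⟨hsummable, hderiv⟩ := hY.hasFDerivAt_tsum hr
  rw [sphDeriv_apply, linDeriv_congr ((eventually_ne_zero hr).mono fun y hy => hY.radialExt_sum hy),
    linDeriv, hderiv.fderiv]
  exact hsummable.hasSum.mapL (ContinuousLinearMap.apply ℝ ℂ _)

theorem RapidDecay.hasSum_lapBeltrami (hY : RapidDecay Y) (r : Sph d) :
    HasSum (fun n => lapBeltrami d (Y n) r) (lapBeltrami d hY.sum r) := by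
  simp only [lapBeltrami_eq_sum, Schwartz.smul_apply, Schwartz.sum_apply, RapidDecay.sphRot_sum]
  exact (hasSum_sum fun i _ => hasSum_sum fun j _ =>
    ((hY.sphRot i j).sphRot i j).hasSum_apply r).mul_left _

theorem polyBounded_one_add_lapEig : PolyBounded fun n => 1 + lapEig d n := by
  refine ⟨1 + d, 2, fun n => ?_⟩
  have hone : (1 : ℝ) ≤ ((n : ℝ) + 1) ^ 2 := one_le_pow₀ (le_add_of_nonneg_left n.cast_nonneg)
  rw [abs_of_nonneg (add_nonneg zero_le_one (lapEig_nonneg n))]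
  linarith [lapEig_le (d := d) n]

theorem RapidDecay.idSubLap (hY : RapidDecay Y) : RapidDecay fun n => idSubLap d (Y n) := by
  simpa only [idSubLap_of_mem_Harm (hY.mem _)] using hY.smul polyBounded_one_add_lapEig

theorem RapidDecay.idSubLap_sum (hY : RapidDecay Y) :
    Spherical.idSubLap d hY.sum = hY.idSubLap.sum :=
  DFunLike.ext _ _ fun r => HasSum.unique ((hY.hasSum_apply r).sub (hY.hasSum_lapBeltrami r))
    (hY.idSubLap.hasSum_apply r)

theorem RapidDecay.tendsto_norm (hY : RapidDecay Y) :
    Tendsto (fun N => ‖toCont d (∑ n ∈ Finset.range N, Y n - hY.sum)‖) atTop (𝓝 0) := by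
  have hsummable : Summable fun n => toCont d (Y n) := hY.summable.of_norm
  have htsum : ∑' n, toCont d (Y n) = toCont d hY.sum := ContinuousMap.ext fun r =>
    (hsummable.hasSum.mapL (ContinuousMap.evalCLM ℂ r)).unique (hY.hasSum_apply r)
  have hlim := tendsto_iff_norm_sub_tendsto_zero.1 hsummable.hasSum.tendsto_sum_nat
  simpa only [htsum, map_sub, map_sum] using hlim

theorem RapidDecay.tendsto_schwartzSeminorm (k : ℕ) : ∀ {Y : ℕ → Schwartz d} (hY : RapidDecay Y),
    Tendsto (fun N => schwartzSeminorm d k (∑ n ∈ Finset.range N, Y n - hY.sum)) atTop (𝓝 0) := by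
  induction k with
  | zero => exact fun hY => hY.tendsto_norm
  | succ k ih =>
    intro Y hY
    refine (ih hY.idSubLap).congr fun N => ?_
    rw [← hY.idSubLap_sum, ← map_sum, ← map_sub]
    simp only [schwartzSeminorm, Seminorm.comp_apply, LinearMap.comp_apply, pow_succ,
      Module.End.mul_apply]

theorem RapidDecay.tendsto_sum (hY : RapidDecay Y) :
    Tendsto (fun N => ∑ n ∈ Finset.range N, Y n) atTop (𝓝 hY.sum) :=
  schwartz_withSeminorms.tendsto_nhds _ _ |>.2 fun k _ hε =>
    (RapidDecay.tendsto_schwartzSeminorm k hY).eventually (gt_mem_nhds hε)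

end RapidlyDecreasingSeries

section Multipliers

variable {d : ℕ} [Fact (2 ≤ d)] {c : ℕ → ℝ}

instance : T2Space (Schwartz d) :=
  T2Space.of_injective_continuous (f := toCont d)
    (fun _ _ h => DFunLike.ext _ _ fun r => DFunLike.congr_fun h r) (toCont d).continuous

/-- The operator which multiplies the `n`-th level of the Fourier expansion by `c n`, for a symbol
`c` of polynomial growth. -/
noncomputable def multiplier (c : ℕ → ℝ) (hc : PolyBounded c) : Schwartz d →ₗ[ℂ] Schwartz d where
  toFun h := ((rapidDecay_harmPart h).smul hc).sum
  map_add' f g := DFunLike.ext _ _ fun r => by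
    refine (((rapidDecay_harmPart (f + g)).smul hc).hasSum_apply r).unique ?_
    simp only [harmPart_add, smul_add, Schwartz.add_apply]
    exact (((rapidDecay_harmPart f).smul hc).hasSum_apply r).add
      (((rapidDecay_harmPart g).smul hc).hasSum_apply r)
  map_smul' a f := DFunLike.ext _ _ fun r => by
    refine (((rapidDecay_harmPart (a • f)).smul hc).hasSum_apply r).unique ?_
    simp only [harmPart_smul, smul_comm _ a, Schwartz.smul_apply _ (_ • _), RingHom.id_apply]
    exact (((rapidDecay_harmPart f).smul hc).hasSum_apply r).mul_left a

theorem tendsto_multiplier (hc : PolyBounded c) (h : Schwartz d) :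
    Tendsto (fun N => ∑ n ∈ Finset.range N, (c n : ℂ) • harmPart n h) atTop
      (𝓝 (multiplier c hc h)) :=
  ((rapidDecay_harmPart h).smul hc).tendsto_sum

theorem norm_ip_le (f g : Schwartz d) :
    ‖ip f g‖ ≤ ‖toCont d f‖ * ‖toCont d g‖ * (surf d).real univ :=
  norm_integral_le_of_norm_le_const <| Eventually.of_forall fun r => by
    rw [norm_mul, RCLike.norm_conj]
    exact mul_le_mul (norm_apply_le f r) (norm_apply_le g r) (norm_nonneg _) (norm_nonneg _)

theorem tendsto_ip_of_tendsto_norm {F : ℕ → Schwartz d} {f : Schwartz d}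
    (h : Tendsto (fun N => ‖toCont d (F N - f)‖) atTop (𝓝 0)) (g : Schwartz d) :
    Tendsto (fun N => ip (F N) g) atTop (𝓝 (ip f g)) := by
  rw [tendsto_iff_norm_sub_tendsto_zero]
  refine squeeze_zero (fun _ => norm_nonneg _) (fun N => ?_)
    (by simpa using (h.mul_const ‖toCont d g‖).mul_const ((surf d).real univ))
  rw [← ip_sub_left]
  exact norm_ip_le _ g

theorem harmPart_multiplier (hc : PolyBounded c) (n : ℕ) (h : Schwartz d) :
    harmPart n (multiplier c hc h) = (c n : ℂ) • harmPart n h := by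
  refine IsHarmPart.harmPart_eq ⟨Submodule.smul_mem _ _ (harmPart_mem n h), fun Y hY => ?_⟩
  refine tendsto_nhds_unique
    (tendsto_ip_of_tendsto_norm ((rapidDecay_harmPart h).smul hc).tendsto_norm Y)
    (tendsto_const_nhds.congr' ?_)
  filter_upwards [eventually_gt_atTop n] with N hN
  rw [ip_sum_left, Finset.sum_eq_single_of_mem n (Finset.mem_range.2 hN)]
  exact fun m _ hmn =>
    ip_eq_zero_of_mem_Harm hmn (Submodule.smul_mem _ _ (harmPart_mem m h)) hY

end Multipliers

section Completeness

variable {d : ℕ} [Fact (2 ≤ d)] {n : ℕ} {f g : Schwartz d}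

theorem exists_lapBeltrami_add_lapEig_smul_eq (hf : f ∈ ⨆ m ∈ Set.Iio n, Harm d m) :
    ∃ u ∈ ⨆ m ∈ Set.Iio n, Harm d m, lapBeltrami d u + (lapEig d n : ℂ) • u = f := by
  suffices ⨆ m ∈ Set.Iio n, Harm d m ≤
      (⨆ m ∈ Set.Iio n, Harm d m).map (lapBeltrami d + (lapEig d n : ℂ) • LinearMap.id) from
    Submodule.mem_map.1 (this hf)
  refine iSup₂_le fun m hm Y hY => ?_
  have hne : (lapEig d n : ℂ) - lapEig d m ≠ 0 :=
    sub_ne_zero.2 fun h => (lapEig_strictMono hm).ne' (Complex.ofReal_injective h)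
  refine ⟨((lapEig d n : ℂ) - lapEig d m)⁻¹ • Y,
    Submodule.smul_mem _ _ (Submodule.mem_iSup_of_mem m (Submodule.mem_iSup_of_mem hm hY)), ?_⟩
  rw [map_smul, LinearMap.add_apply, LinearMap.smul_apply, LinearMap.id_apply,
    mem_Harm_iff_lapEig.1 hY, ← add_smul, smul_smul, Complex.ofReal_neg, neg_add_eq_sub,
    inv_mul_cancel₀ hne, one_smul]

theorem linPow_mem_iSup_Harm (ℓ : Amb d →L[ℝ] ℂ) (n : ℕ) :
    linPow ℓ n ∈ ⨆ m ∈ Set.Iic n, Harm d m := by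
  induction n using Nat.strong_induction_on with
  | _ n ih =>
    set κ : ℂ := n * (n - 1 : ℕ) * ∑ k, ℓ (EuclideanSpace.basisFun (Fin d) ℝ k) ^ 2 with hκ
    have hlower : κ • linPow ℓ (n - 1 - 1) ∈ ⨆ m ∈ Set.Iio n, Harm d m := by
      rcases n.eq_zero_or_pos with rfl | hn
      · simp [hκ]
      · have hsub : Set.Iic (n - 1 - 1) ⊆ Set.Iio n := Set.Iic_subset_Iio.2 (by omega)
        exact Submodule.smul_mem _ _
          (SetLike.le_def.1 (biSup_mono hsub) (ih (n - 1 - 1) (by omega)))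
    obtain ⟨u, hu, hu_eq⟩ := exists_lapBeltrami_add_lapEig_smul_eq hlower
    have hharm : linPow ℓ n - u ∈ Harm d n := by
      have h := lapBeltrami_linPow ℓ n
      rw [← hκ, ← hu_eq, lapEig] at h
      push_cast at h
      rw [mem_Harm, map_sub]
      rw [← sub_eq_zero] at h ⊢
      rw [← h]
      module
    rw [← sub_add_cancel (linPow ℓ n) u]
    exact Submodule.add_mem _
      (Submodule.mem_iSup_of_mem n (Submodule.mem_iSup_of_mem Set.self_mem_Iic hharm))
      (SetLike.le_def.1 (biSup_mono Set.Iio_subset_Iic_self) hu)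

theorem ip_eq_zero_of_mem_iSup_Harm (hf : ∀ n, harmPart n f = 0) {s : Set ℕ}
    (hg : g ∈ ⨆ m ∈ s, Harm d m) : ip g f = 0 := by
  let φ : Schwartz d →ₗ[ℂ] ℂ :=
    { toFun := fun h => ip h f
      map_add' := fun h h' => ip_add_left h h' f
      map_smul' := fun c h => ip_smul_left c h f }
  suffices ⨆ m ∈ s, Harm d m ≤ LinearMap.ker φ from this hg
  refine iSup₂_le fun m _ Y hY => ?_
  change ip Y f = 0
  rw [← ip_conj, ← ip_harmPart f hY, hf, ip_zero_left, map_zero]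

theorem integral_inner_pow_mul_eq_zero (hf : ∀ n, harmPart n f = 0) (r : Sph d) (n : ℕ) :
    ∫ x, (inner ℝ (r : Amb d) x : ℂ) ^ n * conj (f x) ∂(surf d) = 0 :=
  ip_eq_zero_of_mem_iSup_Harm hf
    (linPow_mem_iSup_Harm (Complex.ofRealCLM ∘L innerSL ℝ (r : Amb d)) n)

theorem integral_one_add_inner_pow_smul_eq_zero (hf : ∀ n, harmPart n f = 0) (r : Sph d) (n : ℕ) :
    ∫ x : Sph d, (1 + inner ℝ (r : Amb d) x) ^ n • conj (f x) ∂(surf d) = 0 := by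
  have hexpand : ∀ x : Sph d, (1 + inner ℝ (r : Amb d) x) ^ n • conj (f x) =
      ∑ k ∈ Finset.range (n + 1),
        (n.choose k : ℂ) * ((inner ℝ (r : Amb d) x : ℂ) ^ k * conj (f x)) := fun x => by
    rw [Complex.real_smul, add_comm, Complex.ofReal_pow, Complex.ofReal_add, Complex.ofReal_one,
      add_pow, Finset.sum_mul]
    exact Finset.sum_congr rfl fun k _ => by rw [one_pow]; ring
  simp only [hexpand]
  rw [integral_finsetSum]
  · simp only [integral_const_mul, integral_inner_pow_mul_eq_zero hf, mul_zero,
      Finset.sum_const_zero]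
  · exact fun k _ => (integrable_ip (linPow (Complex.ofRealCLM ∘L innerSL ℝ (r : Amb d)) k)
      f).const_mul _

/- The powers `(1 + ⟨r, x⟩) ^ n` peak at `x = r`, so their normalised integrals against `f`
recover `f r`. -/
theorem eq_zero_of_harmPart_eq_zero (hf : ∀ n, harmPart n f = 0) : f = 0 := by
  refine DFunLike.ext _ _ fun r => ?_
  have hnorm : ∀ y : Sph d, ‖(y : Amb d)‖ = 1 := norm_eq_of_mem_sphere
  have hself : inner ℝ (r : Amb d) r = 1 := inner_self_eq_one_of_norm_eq_one (hnorm r)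
  have hpeak : ∀ y ∈ (univ : Set (Sph d)), y ≠ r →
      1 + inner ℝ (r : Amb d) y < 1 + inner ℝ (r : Amb d) r := fun y _ hy => by
    rw [hself, add_lt_add_iff_left, inner_lt_one_iff_real_of_norm_eq_one (hnorm r) (hnorm y)]
    exact fun h => hy (Subtype.ext h.symm)
  have hnonneg : ∀ y ∈ (univ : Set (Sph d)), 0 ≤ 1 + inner ℝ (r : Amb d) y := fun y _ => by
    linarith [neg_one_le_real_inner_of_norm_eq_one (hnorm r) (hnorm y)]
  have h := tendsto_setIntegral_pow_smul_of_unique_maximum_of_isCompact_of_continuousOn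
    (μ := surf d) (g := fun y => conj (f y)) isCompact_univ (by fun_prop) hpeak hnonneg
    (by rw [hself]; norm_num) (by simp)
    (Complex.continuous_conj.comp (toCont d f).continuous).continuousOn
  simp only [setIntegral_univ, integral_one_add_inner_pow_smul_eq_zero hf, smul_zero] at h
  exact (map_eq_zero _).1 (tendsto_nhds_unique h tendsto_const_nhds)

theorem ext_harmPart (h : ∀ n, harmPart n f = harmPart n g) : f = g :=
  sub_eq_zero.1 (eq_zero_of_harmPart_eq_zero fun n => by rw [harmPart_sub, h, sub_self])

end Completeness

section Growth

variable {c : ℕ → ℝ} {s : ℝ}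

theorem polyBounded_of_isBigO (h : c =O[atTop] fun n : ℕ => (n : ℝ) ^ s) : PolyBounded c := by
  obtain ⟨C, hC, hb⟩ := Asymptotics.bound_of_isBigO_nat_atTop h
  refine ⟨C + |c 0|, ⌈s⌉₊, fun n => ?_⟩
  rcases n.eq_zero_or_pos with rfl | hn
  · simpa using hC.le
  have hn' : (0 : ℝ) < n := Nat.cast_pos.2 hn
  have hpow : (n : ℝ) ^ s ≤ ((n : ℝ) + 1) ^ ⌈s⌉₊ :=
    calc (n : ℝ) ^ s ≤ (n : ℝ) ^ ((⌈s⌉₊ : ℕ) : ℝ) :=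
          Real.rpow_le_rpow_of_exponent_le (Nat.one_le_cast.2 hn) (Nat.le_ceil s)
      _ = (n : ℝ) ^ ⌈s⌉₊ := Real.rpow_natCast _ _
      _ ≤ ((n : ℝ) + 1) ^ ⌈s⌉₊ := by gcongr; linarith
  calc |c n| ≤ C * (n : ℝ) ^ s := by
        simpa only [Real.norm_eq_abs, abs_of_pos (Real.rpow_pos_of_pos hn' s)] using
          hb (Real.rpow_pos_of_pos hn' s).ne'
    _ ≤ (C + |c 0|) * ((n : ℝ) + 1) ^ ⌈s⌉₊ := by
        gcongr
        exact le_add_of_nonneg_right (abs_nonneg _)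

theorem polyBounded_one : PolyBounded fun _ => 1 := ⟨1, 0, fun n => by simp⟩

theorem PolyBounded.sqrt (hc : PolyBounded c) : PolyBounded fun n => √(c n) := by
  obtain ⟨C, q, hC⟩ := hc
  refine ⟨C + 1, q, fun n => ?_⟩
  rw [abs_of_nonneg (Real.sqrt_nonneg _)]
  calc √(c n) ≤ √((|c n| + 1) ^ 2) :=
        Real.sqrt_le_sqrt (by nlinarith [le_abs_self (c n), abs_nonneg (c n)])
    _ = |c n| + 1 := Real.sqrt_sq (by positivity)
    _ ≤ C * ((n : ℝ) + 1) ^ q + 1 * ((n : ℝ) + 1) ^ q :=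
        add_le_add (hC n) (by rw [one_mul]; exact one_le_pow₀ (by simp))
    _ = (C + 1) * ((n : ℝ) + 1) ^ q := (add_mul _ _ _).symm

theorem isTheta_sqrt (h0 : ∀ n, 0 ≤ c n) (h : c =Θ[atTop] fun n : ℕ => (n : ℝ) ^ s) :
    (fun n => √(c n)) =Θ[atTop] fun n : ℕ => (n : ℝ) ^ (s / 2) := by
  have hpow : ∀ n : ℕ, (n : ℝ) ^ (s / 2) = ((n : ℝ) ^ s) ^ (1 / 2 : ℝ) := fun n => by
    rw [← Real.rpow_mul (Nat.cast_nonneg n), mul_one_div]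
  simp only [hpow, Real.sqrt_eq_rpow]
  exact ⟨h.1.rpow (by norm_num) (Eventually.of_forall fun n => by positivity),
    h.2.rpow (by norm_num) (Eventually.of_forall h0)⟩

end Growth

section Multiplier

variable {d : ℕ} [Fact (2 ≤ d)] {c : ℕ → ℝ} {n : ℕ} {Y : Schwartz d}

theorem ip_harmPart_comm (n : ℕ) (f g : Schwartz d) :
    ip (harmPart n f) g = ip f (harmPart n g) := by
  rw [← ip_harmPart f (harmPart_mem n g), ← ip_conj, ← ip_harmPart g (harmPart_mem n f), ip_conj]

theorem ip_multiplier (hc : PolyBounded c) (f g : Schwartz d) :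
    ip (multiplier c hc f) g = ip f (multiplier c hc g) := by
  have hleft := tendsto_ip_of_tendsto_norm ((rapidDecay_harmPart f).smul hc).tendsto_norm g
  have hright := (Complex.continuous_conj.tendsto _).comp
    (tendsto_ip_of_tendsto_norm ((rapidDecay_harmPart g).smul hc).tendsto_norm f)
  rw [ip_conj] at hright
  refine tendsto_nhds_unique hleft (hright.congr fun N => ?_)
  simp only [Function.comp_apply, ip_sum_left, map_sum, ip_smul_left, map_mul, Complex.conj_ofReal,
    ip_conj, ip_harmPart_comm]

theorem ip_multiplier_self_nonneg (hc : PolyBounded c) (h0 : ∀ n, 0 ≤ c n) (f : Schwartz d) :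
    0 ≤ (ip (multiplier c hc f) f).re := by
  have hlim := tendsto_ip_of_tendsto_norm ((rapidDecay_harmPart f).smul hc).tendsto_norm f
  refine ge_of_tendsto' ((Complex.continuous_re.tendsto _).comp hlim) fun N => ?_
  simp only [Function.comp_apply, ip_sum_left, ip_smul_left, Complex.re_sum]
  refine Finset.sum_nonneg fun n _ => ?_
  rw [ip_harmPart_comm, ← ip_harmPart f (harmPart_mem n f), ip_self, ← Complex.ofReal_mul,
    Complex.ofReal_re]
  exact mul_nonneg (h0 n) (normSq_nonneg _)

theorem multiplier_of_mem_Harm (hc : PolyBounded c) (hY : Y ∈ Harm d n) :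
    multiplier c hc Y = (c n : ℂ) • Y := by
  refine tendsto_nhds_unique (tendsto_multiplier hc Y) (tendsto_const_nhds.congr' ?_)
  filter_upwards [eventually_gt_atTop n] with N hN
  rw [Finset.sum_eq_single_of_mem n (Finset.mem_range.2 hN), harmPart_of_mem hY]
  intro m _ hmn
  rw [harmPart_of_mem_of_ne hmn.symm hY, smul_zero]

theorem multiplier_multiplier {a b : ℕ → ℝ} (ha : PolyBounded a) (hb : PolyBounded b)
    (hc : PolyBounded c) (h : ∀ n, a n * b n = c n) (f : Schwartz d) :
    multiplier a ha (multiplier b hb f) = multiplier c hc f :=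
  ext_harmPart fun n => by
    rw [harmPart_multiplier, harmPart_multiplier, harmPart_multiplier, smul_smul,
      ← Complex.ofReal_mul, h]

theorem multiplier_one (f : Schwartz d) : multiplier (fun _ => 1) polyBounded_one f = f :=
  ext_harmPart fun n => by rw [harmPart_multiplier, Complex.ofReal_one, one_smul]

theorem multiplier_conj (hc : PolyBounded c) (f : Schwartz d) :
    multiplier c hc f.conj = (multiplier c hc f).conj :=
  ext_harmPart fun n => by
    rw [harmPart_conj, harmPart_multiplier, harmPart_multiplier, harmPart_conj]
    exact DFunLike.ext _ _ fun r => by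
      simp only [Schwartz.smul_apply, Schwartz.conj_apply, map_mul, Complex.conj_ofReal]

theorem eq_multiplier_of_forall_mem_Harm {R : Schwartz d →ₗ[ℂ] Schwartz d} (hc : PolyBounded c)
    (hsymm : ∀ f g, ip (R f) g = ip f (R g))
    (hR : ∀ n, ∀ Y ∈ Harm d n, R Y = (c n : ℂ) • Y) : R = multiplier c hc := by
  refine LinearMap.ext fun f => ext_harmPart fun n => ?_
  rw [harmPart_multiplier]
  refine IsHarmPart.harmPart_eq ⟨Submodule.smul_mem _ _ (harmPart_mem n f), fun Y hY => ?_⟩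
  rw [hsymm, hR n Y hY, ip_smul_right, ip_smul_left, ip_harmPart f hY, Complex.conj_ofReal]

end Multiplier

section HermitianSqrt

variable {d : ℕ} [Fact (2 ≤ d)] {D R : Schwartz d →ₗ[ℂ] Schwartz d} {σ : ℕ → ℝ} {p : ℝ}

/- `R` acts as `-√μ` on `R Y - √μ • Y`, so positivity forces this vector to vanish. -/
theorem IsHermitianSqrt.apply_of_apply_eq_smul (hR : IsHermitianSqrt D R) {μ : ℝ} (hμ : 0 < μ)
    {Y : Schwartz d} (hY : D Y = (μ : ℂ) • Y) : R Y = ((√μ : ℝ) : ℂ) • Y := by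
  set Z := R Y - ((√μ : ℝ) : ℂ) • Y with hZ
  have hRR : R (R Y) = (μ : ℂ) • Y := by rw [← LinearMap.comp_apply, hR.sq, hY]
  have hRZ : R Z = ((-√μ : ℝ) : ℂ) • Z := by
    have hsq : (μ : ℂ) = (√μ : ℝ) * (√μ : ℝ) := by
      rw [← Complex.ofReal_mul, Real.mul_self_sqrt hμ.le]
    rw [hZ, map_sub, map_smul, hRR, hsq, Complex.ofReal_neg]
    module
  have hnonneg := hR.nonneg Z
  rw [hRZ, ip_smul_left, ip_self, ← Complex.ofReal_mul, Complex.ofReal_re] at hnonneg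
  have hZ0 : normSq Z = 0 := by nlinarith [normSq_nonneg Z, Real.sqrt_pos.2 hμ]
  exact sub_eq_zero.1 (eq_zero_of_ip_self (by rw [ip_self, hZ0, Complex.ofReal_zero]))

theorem IsHermitianSqrt.eq_multiplier {hσ : PolyBounded σ}
    (hR : IsHermitianSqrt (multiplier σ hσ) R) (hpos : ∀ n, 0 < σ n) :
    R = multiplier (fun n => √(σ n)) hσ.sqrt :=
  eq_multiplier_of_forall_mem_Harm hσ.sqrt hR.selfAdjoint fun n _ hY =>
    hR.apply_of_apply_eq_smul (hpos n) (multiplier_of_mem_Harm hσ hY)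

theorem isHermitianSqrt_multiplier (hσ : PolyBounded σ) (h0 : ∀ n, 0 ≤ σ n) :
    IsHermitianSqrt (multiplier (d := d) σ hσ) (multiplier (fun n => √(σ n)) hσ.sqrt) where
  selfAdjoint := ip_multiplier _
  nonneg := ip_multiplier_self_nonneg _ fun _ => Real.sqrt_nonneg _
  sq := LinearMap.ext (multiplier_multiplier hσ.sqrt hσ.sqrt hσ fun n => Real.mul_self_sqrt (h0 n))

theorem IsPseudoDiff.exists_eq_multiplier (hD : IsPseudoDiff D σ p) :
    ∃ hσ : PolyBounded σ, D = multiplier σ hσ :=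
  ⟨polyBounded_of_isBigO (Asymptotics.isBigO_abs_left.1 hD.growth.1),
    LinearMap.ext fun h => tendsto_nhds_unique (hD.series h) (tendsto_multiplier _ h)⟩

theorem IsPosDef.symbol_pos {hσ : PolyBounded σ} (hpos : IsPosDef (multiplier (d := d) σ hσ))
    (n : ℕ) : 0 < σ n := by
  obtain ⟨Y, hY, hY0⟩ := exists_mem_Harm_ne_zero (d := d) n
  have h := (hpos Y hY0).2
  rw [multiplier_of_mem_Harm _ hY, ip_smul_left, ip_self, ← Complex.ofReal_mul,
    Complex.ofReal_re] at h
  exact pos_of_mul_pos_left h (normSq_nonneg Y)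

theorem IsPseudoDiff.isTheta_sqrt (hD : IsPseudoDiff D σ p) (h0 : ∀ n, 0 ≤ σ n) :
    (fun n => √(σ n)) =Θ[atTop] fun n : ℕ => (n : ℝ) ^ (p / 2) :=
  Spherical.isTheta_sqrt h0 (by simpa only [abs_of_nonneg (h0 _)] using hD.growth)

theorem IsPseudoDiff.multiplier_sqrt (hD : IsPseudoDiff D σ p) (h0 : ∀ n, 0 ≤ σ n)
    (hσ : PolyBounded σ) :
    IsPseudoDiff (multiplier (d := d) (fun n => √(σ n)) hσ.sqrt) (fun n => √(σ n)) (p / 2) where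
  series := tendsto_multiplier hσ.sqrt
  finite_zeros := hD.finite_zeros.subset fun n hn => by
    simpa [Real.sqrt_eq_zero (h0 n)] using hn
  order_nonneg := div_nonneg hD.order_nonneg zero_le_two
  growth := by simpa only [abs_of_nonneg (Real.sqrt_nonneg _)] using hD.isTheta_sqrt h0

theorem IsPseudoDiff.isBigO_inv_sqrt (hD : IsPseudoDiff D σ p) (h0 : ∀ n, 0 ≤ σ n) :
    (fun n => (√(σ n))⁻¹) =O[atTop] fun n : ℕ => (n : ℝ) ^ (-(p / 2)) := by
  simpa only [Real.rpow_neg (Nat.cast_nonneg _)] using (hD.isTheta_sqrt h0).inv.1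

end HermitianSqrt

section DyadicSum

theorem sum_range_two_pow {M : Type*} [AddCommMonoid M] (u : ℕ → M) (J : ℕ) :
    ∑ n ∈ Finset.range (2 ^ J), u n =
      u 0 + ∑ j ∈ Finset.range J, ∑ n ∈ Finset.Ico (2 ^ j) (2 ^ (j + 1)), u n := by
  induction J with
  | zero => simp
  | succ J ih =>
    rw [Finset.sum_range_succ, ← add_assoc, ← ih, Finset.sum_range_add_sum_Ico _
      (Nat.pow_le_pow_right two_pos (Nat.le_succ J))]

theorem norm_le_of_hasSum_of_dyadic_le {V : Type*} [SeminormedAddCommGroup V] {u : ℕ → V} {v : V}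
    (hu : HasSum u v) {b q : ℝ} (hq0 : 0 ≤ q) (hq1 : q < 1)
    (hb : ∀ j, ‖∑ n ∈ Finset.Ico (2 ^ j) (2 ^ (j + 1)), u n‖ ≤ b * q ^ j) :
    ‖v‖ ≤ ‖u 0‖ + b * (1 - q)⁻¹ := by
  have hb0 : 0 ≤ b := by simpa using (norm_nonneg _).trans (hb 0)
  have hgeom : ∀ J : ℕ, ∑ j ∈ Finset.range J, q ^ j ≤ (1 - q)⁻¹ := fun J => by
    rw [← tsum_geometric_of_lt_one hq0 hq1]
    exact (summable_geometric_of_lt_one hq0 hq1).sum_le_tsum _ fun _ _ => pow_nonneg hq0 _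
  have hlim := hu.tendsto_sum_nat.comp (tendsto_pow_atTop_atTop_of_one_lt one_lt_two)
  refine le_of_tendsto' hlim.norm fun J => ?_
  calc ‖∑ n ∈ Finset.range (2 ^ J), u n‖
      ≤ ‖u 0‖ + ∑ j ∈ Finset.range J, b * q ^ j := by
        rw [sum_range_two_pow]
        exact (norm_add_le _ _).trans (add_le_add_right (norm_sum_le_of_le _ fun j _ => hb j) _)
    _ ≤ ‖u 0‖ + b * (1 - q)⁻¹ := by
        rw [← Finset.mul_sum]
        gcongr
        exact hgeom J

theorem exists_abs_le_two_pow_rpow_of_isBigO {c : ℕ → ℝ} {s : ℝ} (hs : s ≤ 0)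
    (h : c =O[atTop] fun n : ℕ => (n : ℝ) ^ s) :
    ∃ A > 0, ∀ j n : ℕ, 2 ^ j ≤ n → |c n| ≤ A * ((2 : ℝ) ^ j) ^ s := by
  obtain ⟨A, hA, hcA⟩ := Asymptotics.bound_of_isBigO_nat_atTop h
  refine ⟨A, hA, fun j n hjn => ?_⟩
  have hjn' : (2 : ℝ) ^ j ≤ n := by exact_mod_cast hjn
  have hnpos := Real.rpow_pos_of_pos ((pow_pos two_pos j).trans_le hjn') s
  refine (hcA hnpos.ne').trans (mul_le_mul_of_nonneg_left ?_ hA.le)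
  rw [Real.norm_of_nonneg hnpos.le]
  exact Real.rpow_le_rpow_of_nonpos (by positivity) hjn' hs

end DyadicSum

section Embedding

variable (d : ℕ) [Fact (2 ≤ d)]

theorem exists_norm_sum_smul_harmPart_le : ∃ C > 0, ∀ N ≥ 1, ∀ s : Finset ℕ, (∀ n ∈ s, n ≤ N) →
    ∀ (c : ℕ → ℝ) (K : ℝ), 0 ≤ K → (∀ n ∈ s, |c n| ≤ K) → ∀ (f : Schwartz d) (r : Sph d),
      ‖∑ n ∈ s, ((c n : ℂ) • harmPart n f) r‖ ≤
        C * (N : ℝ) ^ (((d : ℝ) - 1) / 2) * K * ‖toL2 d f‖ := by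
  obtain ⟨B, hB, hnikolskii⟩ := exists_norm_sq_sum_le d
  refine ⟨√B, Real.sqrt_pos.2 hB, fun N hN s hs c K hK hc f r => ?_⟩
  have hNpow : ((N : ℝ) ^ (((d : ℝ) - 1) / 2)) ^ 2 = (N : ℝ) ^ (d - 1) := by
    rw [← Real.rpow_mul_natCast N.cast_nonneg, ← Real.rpow_natCast,
      Nat.cast_sub (one_le_two.trans Fact.out)]
    norm_num
  refine (pow_le_pow_iff_left₀ (norm_nonneg _) (by positivity) two_ne_zero).1 ?_
  calc ‖∑ n ∈ s, ((c n : ℂ) • harmPart n f) r‖ ^ 2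
      ≤ B * N ^ (d - 1) * ∑ n ∈ s, normSq ((c n : ℂ) • harmPart n f) :=
        hnikolskii N hN s hs _ (fun n _ => Submodule.smul_mem _ _ (harmPart_mem n f)) r
    _ ≤ B * N ^ (d - 1) * (K ^ 2 * ∑ n ∈ s, normSq (harmPart n f)) := by
        refine mul_le_mul_of_nonneg_left ?_ (by positivity)
        rw [Finset.mul_sum]
        refine Finset.sum_le_sum fun n hn => ?_
        rw [normSq_smul, Complex.norm_real]
        exact mul_le_mul_of_nonneg_right (pow_le_pow_left₀ (norm_nonneg _) (hc n hn) 2)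
          (normSq_nonneg _)
    _ ≤ B * N ^ (d - 1) * (K ^ 2 * normSq f) := by
        gcongr
        exact sum_normSq_harmPart_le s f
    _ = (√B * (N : ℝ) ^ (((d : ℝ) - 1) / 2) * K * ‖toL2 d f‖) ^ 2 := by
        rw [mul_pow, mul_pow, mul_pow, Real.sq_sqrt hB.le, hNpow, norm_toL2_sq]
        ring

variable {d}

/- Each dyadic block of the expansion of `multiplier c hc f` is controlled by the Nikolskii
inequality, and `p > d - 1` makes the block bounds decay geometrically. -/
theorem exists_norm_toCont_multiplier_le {c : ℕ → ℝ} (hc : PolyBounded c) {p : ℝ}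
    (hp : (d : ℝ) - 1 < p) (hO : c =O[atTop] fun n : ℕ => (n : ℝ) ^ (-(p / 2))) :
    ∃ C, ∀ f : Schwartz d, ‖toCont d (multiplier c hc f)‖ ≤ C * ‖toL2 d f‖ := by
  obtain ⟨B, hB, hnikolskii⟩ := exists_norm_sum_smul_harmPart_le d
  have hd : (2 : ℝ) ≤ d := Nat.ofNat_le_cast.2 Fact.out
  obtain ⟨A, hA, hdecay⟩ := exists_abs_le_two_pow_rpow_of_isBigO (s := -(p / 2)) (by linarith) hO
  set q : ℝ := (2 : ℝ) ^ (((d : ℝ) - 1 - p) / 2) with hq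
  have hq1 : q < 1 := Real.rpow_lt_one_of_one_lt_of_neg one_lt_two (by linarith)
  have hblock : ∀ (f : Schwartz d) (r : Sph d) (j : ℕ),
      ‖∑ n ∈ Finset.Ico (2 ^ j) (2 ^ (j + 1)), ((c n : ℂ) • harmPart n f) r‖ ≤
        B * 2 ^ (((d : ℝ) - 1) / 2) * A * ‖toL2 d f‖ * q ^ j := fun f r j => by
    refine (hnikolskii (2 ^ (j + 1)) Nat.one_le_two_pow _ (fun n hn => (Finset.mem_Ico.1 hn).2.le)
      c _ (by positivity) (fun n hn => hdecay j n (Finset.mem_Ico.1 hn).1) f r).trans_eq ?_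
    have hqj : q ^ j = ((2 : ℝ) ^ j) ^ (((d : ℝ) - 1) / 2) * ((2 : ℝ) ^ j) ^ (-(p / 2)) := by
      rw [← Real.rpow_add (by positivity), hq, ← Real.rpow_pow_comm two_pos.le]
      ring_nf
    rw [hqj, Nat.cast_pow, Nat.cast_ofNat, pow_succ', Real.mul_rpow two_pos.le (by positivity)]
    ring
  refine ⟨B * |c 0| + B * 2 ^ (((d : ℝ) - 1) / 2) * A * (1 - q)⁻¹, fun f => ?_⟩
  rw [ContinuousMap.norm_le _ (by have := sub_pos.2 hq1; positivity)]
  intro r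
  have hzero : ‖((c 0 : ℂ) • harmPart 0 f) r‖ ≤ B * |c 0| * ‖toL2 d f‖ := by
    simpa using hnikolskii 1 le_rfl {0} (by simp) c |c 0| (abs_nonneg _) (by simp) f r
  refine (norm_le_of_hasSum_of_dyadic_le (((rapidDecay_harmPart f).smul hc).hasSum_apply r)
    (by positivity) hq1 (hblock f r)).trans ?_
  linarith

end Embedding

section GeneralisedFunctions

variable {d : ℕ} [Fact (2 ≤ d)]

theorem ofL2_eq_inner (g : Lp ℂ 2 (surf d)) (φ : Schwartz d) :
    ofL2 g φ = inner ℂ (toL2 d φ.conj) g := by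
  rw [L2.inner_def, ofL2_apply]
  refine integral_congr_ae ?_
  filter_upwards [coeFn_toL2 φ.conj] with r hr
  rw [hr, Schwartz.conj_apply, RCLike.inner_apply, Complex.conj_conj]

theorem eq_zero_of_ofL2_eq_zero {g : Lp ℂ 2 (surf d)} (h : ofL2 g = 0) : g = 0 := by
  rw [Lp.eq_zero_iff_ae_eq_zero]
  refine ae_eq_zero_of_integral_contMDiff_smul_eq_zero (𝓡 (d - 1))
    ((Lp.memLp g).integrable one_le_two).locallyIntegrable fun u hu _ => ?_
  let φ : Schwartz d := ⟨fun r => (u r : ℂ), Complex.ofRealCLM.contDiff.contMDiff.comp hu⟩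
  calc ∫ r, u r • g r ∂(surf d) = ∫ r, g r * φ r ∂(surf d) :=
        integral_congr_ae (.of_forall fun r => Complex.real_smul.trans (mul_comm _ _))
    _ = ofL2 g φ := (ofL2_apply g φ).symm
    _ = 0 := by rw [h]; rfl

theorem ofL2_injective : Function.Injective (ofL2 (d := d)) := fun g g' h => by
  refine sub_eq_zero.1 (eq_zero_of_ofL2_eq_zero (ContinuousLinearMap.ext fun φ => ?_))
  rw [ofL2_eq_inner, inner_sub_right, ← ofL2_eq_inner, ← ofL2_eq_inner, h, sub_self]
  rfl

theorem denseRange_toL2 : DenseRange (toL2 d) := by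
  have hclosure : (LinearMap.range (toL2 d)).topologicalClosure = ⊤ := by
    rw [Submodule.topologicalClosure_eq_top_iff, Submodule.eq_bot_iff]
    intro g hg
    refine eq_zero_of_ofL2_eq_zero (ContinuousLinearMap.ext fun φ => ?_)
    rw [ofL2_eq_inner]
    exact hg _ ⟨_, rfl⟩
  rw [DenseRange, ← LinearMap.coe_range]
  exact Submodule.dense_iff_topologicalClosure_eq_top.2 hclosure

theorem ofL2_toL2 (f φ : Schwartz d) : ofL2 (toL2 d f) φ = ip f φ.conj := by
  rw [ofL2_eq_inner, inner_toL2]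

theorem continuous_ofL2_apply (φ : Schwartz d) : Continuous fun g => ofL2 g φ := by
  simp only [ofL2_eq_inner]
  fun_prop

theorem exists_ofL2_apply_eq (ℓ : Lp ℂ 2 (surf d) →L[ℂ] ℂ) :
    ∃ g : Lp ℂ 2 (surf d), ∀ φ, ofL2 g φ = conj (ℓ (toL2 d φ.conj)) :=
  ⟨(InnerProductSpace.toDual ℂ _).symm ℓ, fun φ => by
    rw [ofL2_eq_inner, ← inner_conj_symm, InnerProductSpace.toDual_symm_apply]⟩

theorem ofCont_eq_ofL2 (u : C(Sph d, ℂ)) :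
    ofCont u = ofL2 (ContinuousMap.toLp 2 (surf d) ℂ u) := by
  ext φ
  rw [ofL2_apply]
  refine integral_congr_ae ?_
  filter_upwards [ContinuousMap.coeFn_toLp (p := 2) (𝕜 := ℂ) (surf d) u] with r hr
  rw [hr]
  rfl

theorem ofCont_toCont (f φ : Schwartz d) : ofCont (toCont d f) φ = ip f φ.conj := by
  rw [ofCont_eq_ofL2]
  exact ofL2_toL2 f φ

theorem continuous_ofCont_apply (φ : Schwartz d) : Continuous fun u => ofCont u φ := by
  simp only [ofCont_eq_ofL2]
  exact (continuous_ofL2_apply φ).comp (ContinuousMap.toLp 2 (surf d) ℂ).continuous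

theorem ofCont_add (u v : C(Sph d, ℂ)) : ofCont (u + v) = ofCont u + ofCont v := by
  simp only [ofCont_eq_ofL2, map_add, ofL2_add]

theorem ofCont_smul (a : ℂ) (u : C(Sph d, ℂ)) : ofCont (a • u) = a • ofCont u := by
  simp only [ofCont_eq_ofL2, map_smul, ofL2_smul]

end GeneralisedFunctions

section NativeSpace

variable {d : ℕ} [Fact (2 ≤ d)]

/-- `ρ` is a symmetric inverse of the real operator `R` which maps `ℒ²` boundedly into the
continuous functions. -/
structure IsSmoothingInverse (R ρ : Schwartz d →ₗ[ℂ] Schwartz d) : Prop where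
  right_inv : ∀ φ, R (ρ φ) = φ
  left_inv : ∀ φ, ρ (R φ) = φ
  symm : ∀ f g, ip (ρ f) g = ip f (ρ g)
  map_conj : ∀ φ : Schwartz d, R φ.conj = (R φ).conj
  bound : ∃ C, ∀ φ, ‖toCont d (ρ φ)‖ ≤ C * ‖toL2 d φ‖

/-- The extension of a smoothing operator to `ℒ²`, with values in the continuous functions; zero
unless `ρ` is bounded from the `ℒ²` norm to the supremum norm. -/
noncomputable def smoothing (ρ : Schwartz d →ₗ[ℂ] Schwartz d) :
    Lp ℂ 2 (surf d) →L[ℂ] C(Sph d, ℂ) :=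
  ((toCont d : Schwartz d →ₗ[ℂ] C(Sph d, ℂ)) ∘ₗ ρ).extendOfNorm (toL2 d)

theorem IsSpline.exists_apply_eq_sum {D : Schwartz d →ₗ[ℂ] Schwartz d} {s : GenFun d}
    (hs : IsSpline D s) : ∃ (M : ℕ) (r : Fin M → Sph d) (α : Fin M → ℂ),
      ∀ φ, s (D φ) = ∑ i, α i * φ (r i) := by
  obtain ⟨M, r, α, hs⟩ := hs
  refine ⟨M, r, α, fun φ => (LinearMap.congr_fun hs φ).trans ?_⟩
  rw [ContinuousLinearMap.coe_coe, sum_apply]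
  rfl

namespace IsSmoothingInverse

variable {R ρ : Schwartz d →ₗ[ℂ] Schwartz d}

theorem inv_map_conj (h : IsSmoothingInverse R ρ) (φ : Schwartz d) : ρ φ.conj = (ρ φ).conj := by
  rw [← h.left_inv (ρ φ).conj, h.map_conj, h.right_inv]

theorem smoothing_toL2 (h : IsSmoothingInverse R ρ) (φ : Schwartz d) :
    smoothing ρ (toL2 d φ) = toCont d (ρ φ) :=
  LinearMap.extendOfNorm_eq denseRange_toL2 h.bound φ

theorem smoothing_toL2_conj_apply (h : IsSmoothingInverse R ρ) (φ : Schwartz d) (r : Sph d) :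
    smoothing ρ (toL2 d φ.conj) r = conj (ρ φ r) := by
  rw [h.smoothing_toL2, h.inv_map_conj]
  rfl

theorem ofCont_smoothing (h : IsSmoothingInverse R ρ) (g : Lp ℂ 2 (surf d)) (φ : Schwartz d) :
    ofCont (smoothing ρ g) (R φ) = ofL2 g φ := by
  refine denseRange_toL2.induction_on (p := fun g => ofCont (smoothing ρ g) (R φ) = ofL2 g φ) g
    (isClosed_eq ((continuous_ofCont_apply _).comp (smoothing ρ).continuous)
      (continuous_ofL2_apply φ)) fun χ => ?_
  rw [h.smoothing_toL2, ofCont_toCont, ofL2_toL2, ← h.map_conj, h.symm, h.left_inv]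

theorem actGen_ofCont_smoothing (h : IsSmoothingInverse R ρ) (g : Lp ℂ 2 (surf d)) :
    actGen R (ofCont (smoothing ρ g)) = (ofL2 g : Schwartz d →ₗ[ℂ] ℂ) :=
  LinearMap.ext fun φ => h.ofCont_smoothing g φ

theorem actGen_injective (h : IsSmoothingInverse R ρ) : Function.Injective (actGen R) := by
  intro f f' hf
  ext φ
  rw [← h.right_inv φ]
  exact LinearMap.congr_fun hf (ρ φ)

/-- The Riesz potential isomorphism from `ℒ²` onto the generalised Sobolev space. -/
noncomputable def potential (h : IsSmoothingInverse R ρ) : Lp ℂ 2 (surf d) ≃ₗ[ℂ] Sobolev R :=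
  LinearEquiv.ofBijective
    { toFun := fun g => (⟨ofCont (smoothing ρ g), g, h.actGen_ofCont_smoothing g⟩ : sobolev R)
      map_add' := fun g g' => Subtype.ext
        ((congrArg ofCont (map_add (smoothing ρ) g g')).trans (ofCont_add _ _))
      map_smul' := fun a g => Subtype.ext
        ((congrArg ofCont (map_smul (smoothing ρ) a g)).trans (ofCont_smul _ _)) }
    ⟨fun g g' hg => by
      refine ofL2_injective (ContinuousLinearMap.ext fun φ => ?_)
      have hcont : ofCont (smoothing ρ g) = ofCont (smoothing ρ g') := congrArg Subtype.val hg
      rw [← h.ofCont_smoothing, ← h.ofCont_smoothing, hcont],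
    fun f => by
      obtain ⟨g, hg⟩ := f.2
      exact ⟨g, Subtype.ext (h.actGen_injective ((h.actGen_ofCont_smoothing g).trans hg.symm))⟩⟩

theorem toGenFun_eq_ofCont (h : IsSmoothingInverse R ρ) (f : Sobolev R) :
    f.toGenFun = ofCont (smoothing ρ (h.potential.symm f)) :=
  (congrArg Sobolev.toGenFun (h.potential.apply_symm_apply f)).symm

theorem eq_potential_symm (h : IsSmoothingInverse R ρ) {f : Sobolev R} {g : Lp ℂ 2 (surf d)}
    (hg : actGen R f.toGenFun = (ofL2 g : Schwartz d →ₗ[ℂ] ℂ)) : g = h.potential.symm f := by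
  refine ofL2_injective (ContinuousLinearMap.ext fun φ => ?_)
  rw [h.toGenFun_eq_ofCont, h.actGen_ofCont_smoothing] at hg
  exact (LinearMap.congr_fun hg φ).symm

/-- The inner product `⟨f, f'⟩ = ⟨R f, R f'⟩` on the generalised Sobolev space. -/
@[reducible]
noncomputable def core (h : IsSmoothingInverse R ρ) : InnerProductSpace.Core ℂ (Sobolev R) where
  inner f f' := inner ℂ (h.potential.symm f) (h.potential.symm f')
  conj_inner_symm _ _ := inner_conj_symm _ _
  re_inner_nonneg _ := inner_self_nonneg
  add_left _ _ _ := by rw [map_add, inner_add_left]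
  smul_left _ _ _ := by rw [map_smul, inner_smul_left]
  definite _ hf := by rwa [inner_self_eq_zero, LinearEquiv.map_eq_zero_iff] at hf

theorem isSobolevRKHS (h : IsSmoothingInverse R ρ) : IsSobolevRKHS R := by
  refine ⟨h.core, fun f f' g g' hg hg' => ?_, ?_⟩
  · rw [h.eq_potential_symm hg, h.eq_potential_symm hg']
    rfl
  let _ : NormedAddCommGroup (Sobolev R) := h.core.toNormedAddCommGroup
  let _ : InnerProductSpace ℂ (Sobolev R) := InnerProductSpace.ofCore h.core.toCore
  let T : Sobolev R ≃ₗᵢ[ℂ] Lp ℂ 2 (surf d) := h.potential.symm.isometryOfInner fun _ _ => rfl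
  have hcomplete : CompleteSpace (Sobolev R) :=
    (T.toIsometryEquiv.isometry.isUniformInducing.completeSpace_congr T.surjective).2 inferInstance
  have hinj (f f' : Sobolev R) (hff' : smoothing ρ (T f) = smoothing ρ (T f')) : f = f' :=
    Subtype.ext ((h.toGenFun_eq_ofCont f).trans
      ((congrArg ofCont hff').trans (h.toGenFun_eq_ofCont f').symm))
  let K : RKHS ℂ (Sobolev R) (Sph d) ℂ :=
    { coeCLM := .pi fun r => (ContinuousMap.evalCLM ℂ r).comp
        ((smoothing ρ).comp (T : Sobolev R →L[ℂ] Lp ℂ 2 (surf d)))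
      coeCLM_injective := fun f f' hff' =>
        hinj f f' (ContinuousMap.ext fun r => congrFun hff' r) }
  exact ⟨hcomplete, K, fun f => ⟨smoothing ρ (T f), rfl, h.toGenFun_eq_ofCont f⟩⟩

/- By the Riesz representation theorem, the combination of point evaluations that `R s` amounts to
is given by a square-integrable function. -/
theorem mem_sobolev_of_isSpline (h : IsSmoothingInverse R ρ) {s : GenFun d}
    (hs : IsSpline (R ∘ₗ R) s) : s ∈ sobolev R := by
  obtain ⟨M, r, α, hs⟩ := hs.exists_apply_eq_sum
  obtain ⟨g, hg⟩ := exists_ofL2_apply_eq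
    (∑ i, conj (α i) • (ContinuousMap.evalCLM ℂ (r i)).comp (smoothing ρ))
  refine ⟨g, LinearMap.ext fun φ => ?_⟩
  calc s (R φ) = s (R (R (ρ φ))) := by rw [h.right_inv]
    _ = ∑ i, α i * ρ φ (r i) := hs (ρ φ)
    _ = conj (∑ i, conj (α i) * smoothing ρ (toL2 d φ.conj) (r i)) := by
      simp only [h.smoothing_toL2_conj_apply, map_sum, map_mul, Complex.conj_conj]
    _ = ofL2 g φ := by
      rw [hg, sum_apply]
      rfl

end IsSmoothingInverse

theorem IsPseudoDiff.isSmoothingInverse {D : Schwartz d →ₗ[ℂ] Schwartz d} {σ : ℕ → ℝ} {p : ℝ}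
    (hD : IsPseudoDiff D σ p) (hpos : ∀ n, 0 < σ n) (hσ : PolyBounded σ) (hp : (d : ℝ) - 1 < p) :
    ∃ hρ, IsSmoothingInverse (multiplier (d := d) (fun n => √(σ n)) hσ.sqrt)
      (multiplier (d := d) (fun n => (√(σ n))⁻¹) hρ) := by
  have hO := hD.isBigO_inv_sqrt fun n => (hpos n).le
  have hne (n : ℕ) : √(σ n) ≠ 0 := (Real.sqrt_pos.2 (hpos n)).ne'
  refine ⟨polyBounded_of_isBigO hO, ?_, ?_, ip_multiplier _, multiplier_conj _,
    exists_norm_toCont_multiplier_le _ hp hO⟩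
  · exact fun φ => (multiplier_multiplier _ _ polyBounded_one
      (fun n => mul_inv_cancel₀ (hne n)) φ).trans (multiplier_one φ)
  · exact fun φ => (multiplier_multiplier _ _ polyBounded_one
      (fun n => inv_mul_cancel₀ (hne n)) φ).trans (multiplier_one φ)

end NativeSpace

end Spherical

theorem proposition9 (d : ℕ) [Fact (2 ≤ d)] (D : Schwartz d →ₗ[ℂ] Schwartz d)
    (σ : ℕ → ℝ) (p : ℝ) (hD : IsPseudoDiff D σ p) (hpos : IsPosDef D) (hp : (d : ℝ) - 1 < p) :
    (∃! R : Schwartz d →ₗ[ℂ] Schwartz d, IsHermitianSqrt D R) ∧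
    (∀ n, 0 < σ n) ∧
    ∀ R : Schwartz d →ₗ[ℂ] Schwartz d, IsHermitianSqrt D R →
      IsPseudoDiff R (fun n => √(σ n)) (p / 2) ∧
      IsSobolevRKHS R ∧
      ∀ s : GenFun d, IsSpline D s → s ∈ sobolev R := by
  obtain ⟨hσ, rfl⟩ := hD.exists_eq_multiplier
  have hσpos : ∀ n, 0 < σ n := hpos.symbol_pos
  have hσnonneg : ∀ n, 0 ≤ σ n := fun n => (hσpos n).le
  refine ⟨⟨_, isHermitianSqrt_multiplier hσ hσnonneg, fun R hR => hR.eq_multiplier hσpos⟩,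
    hσpos, fun R hR => ?_⟩
  obtain rfl := hR.eq_multiplier hσpos
  obtain ⟨_, hinv⟩ := hD.isSmoothingInverse hσpos hσ hp
  exact ⟨hD.multiplier_sqrt hσnonneg hσ, hinv.isSobolevRKHS,
    fun s hs => hinv.mem_sobolev_of_isSpline (hR.sq.symm ▸ hs)⟩
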